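/- Let $Q$ be a tree network: a connected network with finitely many nodes and finitely many arcs of positive length, in which any two points are joined by only one simple path, endowed with the shortest-path metric $d$ and the length measure $\lambda$; put $\mu=\lambda(Q)$, and let $0<\alpha<2\mu$. Points in the interior of arcs are called regular here. **Definitions.** The extremity set $E$ is the set of regular points $x\in Q$ such that one of the components of $Q\setminus\{x\}$ has length less than $\alpha/2$. A closed unit speed path of length $L$ is a map $S:[0,L]\to Q$ with $d(S(t),S(t'))\le|t-t'|$ and $S(0)=S(L)$; it is a tour of a set $Y$ if its image is $Y$, and a Chinese Postman Tour (CPT) of $Y$ if moreover $L$ is minimal among all tours of $Y$. An *$E$-patrolling tour* is obtained as follows. If $\bar E=Q$, it is any CPT of $Q$. If $\bar E\ne Q$, let $\bar E^1,\dots,\bar E^k$ be the components of $\bar E$. Take a CPT $S$ of $Q$ that starts at a regular point outside $\bar E$ and that searches each $\bar E^j$ in a single CPT $C_j$ of $\bar E^j$, performed during a time interval $[b_j,b_j+\ell_j]$. For each $j$ insert into $S$ a second copy of $C_j$: immediately after the first one if $\lambda(\bar E^j)\ge\alpha/2$, and otherwise at the first time after $b_j+\ell_j$ at which $S$ returns to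 $\bar E^j$. The *$E$-patrolling strategy* belonging to an $E$-patrolling tour $S^E:[0,L]\to Q$ is its randomized periodic extension: the patrol $t\mapsto S^E((t+\Delta)\bmod L)$, $t\ge 0$, with $\Delta$ uniformly distributed on $[0,L]$. An attack at $x\in Q$ during $[\tau,\tau+\alpha]$, $\tau\ge0$, is intercepted if the patrol is at $x$ at some time in $[\tau,\tau+\alpha]$. **Theorem.** $E$-patrolling tours exist, and for every $E$-patrolling tour $S^E$, of length $L$, the following hold. 1. If $\bar E\neq Q$ then $L=2(\mu+\lambda(E))$. If $\bar E=Q$ then $L=\mu+\lambda(E)=2\mu$. In both cases the $L$-periodic extension of $S^E$, restricted to $[0,2(\mu+\lambda(E))]$ (that is, $S^E$ itself if $\bar E\ne Q$, and $S^E$ traversed twice if $\bar E=Q$), is a tour of $Q$ of length $2(\mu+\lambda(E))$ which visits every point of $Q$ at two times that differ by at least $\alpha$ modulo $2(\mu+\lambda(E))$. 2. The $E$-patrolling strategy intercepts every attack with probability at least $v^*=\alpha/(\mu+\lambda(E))$. -/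

import Mathlib

open Set MeasureTheory

noncomputable section

/-- A (finite, connected) network with underlying metric space `Q`: finitely many nodes and finitely
many arcs, each arc `a` being an open interval `(0, len a)` placed in `Q` by `param a`, which extends
to the closed interval `[0, len a]` with end points at nodes.  The open arcs are pairwise disjoint
and their union is the set of all points that are not nodes.  Arcs are parametrized by length, and
the distance of two points is the minimum length of a path between them (in particular `Q` is
connected).  Length of a path means its total variation. -/
structure Network (Q : Type*) [MetricSpace Q] where
  nodes : Set Q
  nodes_finite : nodes.Finite
  nodes_nonempty : nodes.Nonempty
  Arc : Type
  arcFintype : Fintype Arc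
  len : Arc → ℝ
  len_pos : ∀ a, 0 < len a
  param : Arc → ℝ → Q
  param_zero_mem : ∀ a, param a 0 ∈ nodes
  param_len_mem : ∀ a, param a (len a) ∈ nodes
  param_injOn : ∀ a, InjOn (param a) (Ioo 0 (len a))
  arcs_disjoint : ∀ a b, a ≠ b →
    Disjoint (param a '' Ioo 0 (len a)) (param b '' Ioo 0 (len b))
  iUnion_arcs : (⋃ a, param a '' Ioo 0 (len a)) = nodesᶜ
  param_length : ∀ a s t, 0 ≤ s → s ≤ t → t ≤ len a →
    eVariationOn (param a) (Icc s t) = ENNReal.ofReal (t - s)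
  isLeast_edist : ∀ x y : Q,
    IsLeast {l | ∃ p : ℝ → Q, ContinuousOn p (Icc 0 1) ∧ p 0 = x ∧ p 1 = y ∧
      l = eVariationOn p (Icc 0 1)} (edist x y)

attribute [instance] Network.arcFintype

/-- A closed unit speed path `S : [0, L] → Q` of length `L`. -/
def IsClosedUnitSpeedPath {Q : Type*} [MetricSpace Q] (S : ℝ → Q) (L : ℝ) : Prop :=
  0 ≤ L ∧ (∀ t ∈ Icc 0 L, ∀ t' ∈ Icc 0 L, dist (S t) (S t') ≤ |t - t'|) ∧ S 0 = S L

/-- `S : [0, L] → Q` is a tour of the set `Y`: a closed unit speed path in `Y` which visits all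
points of `Y`. -/
def IsTourOf {Q : Type*} [MetricSpace Q] (Y : Set Q) (S : ℝ → Q) (L : ℝ) : Prop :=
  IsClosedUnitSpeedPath S L ∧ S '' Icc 0 L = Y

/-- A Chinese Postman Tour (CPT) of `Y`: a tour of `Y` of minimum length. -/
def IsCPTOf {Q : Type*} [MetricSpace Q] (Y : Set Q) (S : ℝ → Q) (L : ℝ) : Prop :=
  IsTourOf Y S L ∧ ∀ (S' : ℝ → Q) (L' : ℝ), IsTourOf Y S' L' → L ≤ L'

/-- The extension with period `L` of a closed path `S : [0, L] → Q`, that is `t ↦ S (t mod L)`. -/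
def periodicExtension {Q : Type*} (S : ℝ → Q) (L : ℝ) (t : ℝ) : Q :=
  S (L * Int.fract (t / L))

/-- The probability that the randomized periodic extension of `S : [0, L] → Q` intercepts the attack
at the point `x` during `[τ, τ + α]`: the patrol is `t ↦ S ((t + Δ) mod L)` with `Δ` uniformly
distributed on `[0, L]`, and it intercepts if it is at `x` at some time in `[τ, τ + α]`. -/
def interceptionProb {Q : Type*} (S : ℝ → Q) (L α : ℝ) (x : Q) (τ : ℝ) : ℝ :=
  (ProbabilityTheory.cond (volume : Measure ℝ) (Icc 0 L)).real
    {Δ | ∃ t ∈ Icc τ (τ + α), periodicExtension S L (t + Δ) = x}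

namespace Network

variable {Q : Type*} [MetricSpace Q] (N : Network Q)

/-- A network is a tree if there is only one simple path between any two points. -/
def IsTree {Q : Type*} [MetricSpace Q] (_N : Network Q) : Prop :=
  ∀ p q : ℝ → Q, ContinuousOn p (Icc 0 1) → InjOn p (Icc 0 1) →
    ContinuousOn q (Icc 0 1) → InjOn q (Icc 0 1) → p 0 = q 0 → p 1 = q 1 →
    p '' Icc 0 1 = q '' Icc 0 1

/-- The length measure `λ` of a set of points: the sum over the arcs of Lebesgue measure. -/
def lam (Y : Set Q) : ℝ :=
  ∑ a, volume.real (Ioo 0 (N.len a) ∩ N.param a ⁻¹' Y)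

/-- The total length `μ` of the network. -/
def mu : ℝ := N.lam univ

/-- The extremity set `E`: those interior points `x` of arcs for which some connected component of
the complement of `x` has length less than `α / 2`. -/
def extremity (α : ℝ) : Set Q :=
  {x | x ∉ N.nodes ∧ ∃ y, y ≠ x ∧ N.lam (connectedComponentIn {x}ᶜ y) < α / 2}

/-- The connected components of the closure of the extremity set. -/
def extremityComponents (α : ℝ) : Set (Set Q) :=
  {C | ∃ x ∈ closure (N.extremity α), C = connectedComponentIn (closure (N.extremity α)) x}

open Classical in
/-- `SE : [0, L] → Q` is a tour underlying an `E`-patrolling strategy.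

If the closure of the extremity set `E` is all of `Q`, it is just a CPT of `Q`.

Otherwise let `C 0, …, C (k-1)` be the components of the closure of `E`. Start with a CPT
`S : [0, L₀] → Q` of `Q` which begins at a regular point outside the closure of `E` and which
searches every `C j` in a single CPT of `C j`, during the time interval `[b j, b j + ℓ j]`.
Then, for each `j`, insert into `S` at time `s j` a second copy of the piece of `S` on
`[b j, b j + ℓ j]`:
* if `λ (C j) ≥ α / 2`, then `s j = b j + ℓ j`, i.e. the second copy follows the first;
* otherwise `s j` is the first time after `b j + ℓ j` at which `S` returns to `C j`.

Time `t` of `S` corresponds to time `t + ∑_{s i < t} ℓ i` of `SE`, and the second copy of the CPT of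
`C j` starts at time `s j + ∑_{s i < s j} ℓ i` of `SE`. -/
def IsEPatrollingTour (α : ℝ) (SE : ℝ → Q) (L : ℝ) : Prop :=
  (closure (N.extremity α) = univ ∧ IsCPTOf univ SE L) ∨
  (closure (N.extremity α) ≠ univ ∧
    ∃ (S : ℝ → Q) (L₀ : ℝ) (k : ℕ) (C : Fin k → Set Q) (b ℓ s : Fin k → ℝ),
      IsCPTOf univ S L₀ ∧
      S 0 ∉ N.nodes ∧ S 0 ∉ closure (N.extremity α) ∧
      Function.Injective C ∧ range C = N.extremityComponents α ∧
      (∀ j, 0 ≤ b j ∧ b j + ℓ j ≤ L₀ ∧ IsCPTOf (C j) (fun u => S (b j + u)) (ℓ j)) ∧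
      (∀ j, α / 2 ≤ N.lam (C j) → s j = b j + ℓ j) ∧
      (∀ j, N.lam (C j) < α / 2 → b j + ℓ j < s j ∧ s j ≤ L₀ ∧ S (s j) ∈ C j ∧
        ∀ t ∈ Ioo (b j + ℓ j) (s j), S t ∉ C j) ∧
      L = L₀ + ∑ j, ℓ j ∧
      (∀ t ∈ Icc 0 L₀, SE (t + (∑ i with s i < t, ℓ i)) = S t) ∧
      (∀ j, ∀ u ∈ Icc 0 (ℓ j), SE (s j + (∑ i with s i < s j, ℓ i) + u) = S (b j + u)))

end Network

end

/-! Each arc `a` of a tree has a 1-Lipschitz retraction `coord a` of the tree onto it, so statements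
about paths reduce to real functions. A closed path on a line takes every value between its extremes
twice. Hence a tour of a subtree lasts at least twice its length (`two_mul_lam_image_le`). Splicing
back-and-forth tours of segments attains this bound (`exists_isTourOf`), so a CPT of a subtree `Y`
has length `2 * lam Y`, and a CPT of `Q` never passes three times over an interval
(`lt_of_three_passes`).

If the closure of `E` is not `Q`, each of its components `C` hangs at a single point `p`
(`exists_isHanging`): between two frontier points there would be an extreme point whose small side,
contained in the closure of `E`, is a neighbourhood of one of them. Regular points near `p` outside
`C` are not extreme, so every branch of the complement of `C` has length at least `α / 2`. If `C` is
shorter than `α / 2`, there are at least two branches, for otherwise such points would have a side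
of length close to that of `C`. A CPT of `Q` covers each branch in one excursion from `C`, because a
second entry would force a third pass. So an excursion lasts at least `α`, and so does the rest of
the tour, which covers another branch (`le_excursion`).

A point outside the closure of `E` is itself a degenerate hanging subtree, so the CPT already visits
it twice, suitably separated. A point of `C` is visited at the same phase in both copies of the CPT
of `C`. The copies are separated by the duration of the first one if `C` is large, and by an
excursion if `C` is small. Two visits at least `α` apart modulo the period intercept disjoint sets
of phases of measure `α` each, which gives the probability `2 * α / L`.

Such tours exist: the complement of the interiors of the components is connected, and CPTs of the
components can be inserted into a CPT of this core at the attaching points. -/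

/-! ### Simple paths in a network and in a tree -/

/-- `X` is the image of a simple path from `x` to `y`. -/
def IsSimpleArc {Q : Type*} [MetricSpace Q] (x y : Q) (X : Set Q) : Prop :=
  ∃ T : ℝ, 0 < T ∧ ∃ p : ℝ → Q, ContinuousOn p (Icc 0 T) ∧ InjOn p (Icc 0 T) ∧
    p 0 = x ∧ p T = y ∧ p '' Icc 0 T = X

namespace IsSimpleArc

variable {Q : Type*} [MetricSpace Q] {x y z : Q} {X Y : Set Q}

lemma image_of_le {p : ℝ → Q} {s t : ℝ} (hst : s < t) (hc : ContinuousOn p (Icc s t))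
    (hi : InjOn p (Icc s t)) : IsSimpleArc (p s) (p t) (p '' Icc s t) := by
  have hm : MapsTo (fun u => s + u) (Icc 0 (t - s)) (Icc s t) := by
    intro u hu; exact ⟨by linarith [hu.1], by linarith [hu.2]⟩
  refine ⟨t - s, by linarith, fun u => p (s + u), hc.comp (by fun_prop) hm, ?_, by simp, by simp, ?_⟩
  · intro u hu v hv h
    simpa using hi (hm hu) (hm hv) h
  · have : (fun u => p (s + u)) '' Icc 0 (t - s) = p '' ((fun u => s + u) '' Icc 0 (t - s)) := by
      rw [image_image]
    rw [this]
    congr 1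
    simp

lemma symm (h : IsSimpleArc x y X) : IsSimpleArc y x X := by
  obtain ⟨T, hT, p, hc, hi, h0, h1, hX⟩ := h
  have hm : MapsTo (fun u => T - u) (Icc 0 T) (Icc 0 T) := by
    intro u hu; exact ⟨by linarith [hu.2], by linarith [hu.1]⟩
  refine ⟨T, hT, fun u => p (T - u), hc.comp (by fun_prop) hm, ?_, by simpa, by simpa, ?_⟩
  · intro u hu v hv h
    simpa using hi (hm hu) (hm hv) h
  · have : (fun u => p (T - u)) '' Icc 0 T = p '' ((fun u => T - u) '' Icc 0 T) := by
      rw [image_image]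
    rw [this, ← hX]
    congr 1
    simp

lemma trans (h : IsSimpleArc x y X) (h' : IsSimpleArc y z Y) (hXY : X ∩ Y ⊆ {y}) :
    IsSimpleArc x z (X ∪ Y) := by
  obtain ⟨T, hT, p, hc, hi, h0, h1, rfl⟩ := h
  obtain ⟨T', hT', q, hc', hi', h0', h1', rfl⟩ := h'
  set r : ℝ → Q := fun u => if u ≤ T then p u else q (u - T) with hr
  have hrp : EqOn r p (Icc 0 T) := fun u hu => by simp [hr, hu.2]
  have hrq : EqOn r (fun u => q (u - T)) (Icc T (T + T')) := by
    intro u hu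
    rcases eq_or_lt_of_le hu.1 with h | h
    · subst h; simp [hr, h1, h0']
    · simp [hr, not_le.2 h]
  have hm : MapsTo (fun u => u - T) (Icc T (T + T')) (Icc 0 T') := by
    intro u hu; exact ⟨by linarith [hu.1], by linarith [hu.2]⟩
  have hun : Icc 0 (T + T') = Icc 0 T ∪ Icc T (T + T') :=
    (Icc_union_Icc_eq_Icc hT.le (by linarith)).symm
  have hcr : ContinuousOn r (Icc 0 (T + T')) := by
    rw [hun]
    refine ContinuousOn.union_of_isClosed (hc.congr hrp) ?_ isClosed_Icc isClosed_Icc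
    exact (hc'.comp (by fun_prop) hm).congr hrq
  have key : ∀ u ∈ Icc 0 T, ∀ v ∈ Icc T (T + T'), r u = r v → u = v := by
    intro u hu v hv huv
    rw [hrp hu, hrq hv] at huv
    have hy : p u = y := hXY ⟨mem_image_of_mem p hu, huv ▸ mem_image_of_mem q (hm hv)⟩
    have e1 : u = T := hi hu ⟨hT.le, le_rfl⟩ (hy.trans h1.symm)
    have e2 : v - T = 0 := hi' (hm hv) ⟨le_rfl, hT'.le⟩ (by rw [h0', ← hy]; exact huv.symm)
    linarith
  refine ⟨T + T', by linarith, r, hcr, ?_, ?_, ?_, ?_⟩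
  · intro u hu v hv huv
    rw [hun] at hu hv
    rcases hu with hu | hu <;> rcases hv with hv | hv
    · rw [hrp hu, hrp hv] at huv; exact hi hu hv huv
    · exact key u hu v hv huv
    · exact (key v hv u hu huv.symm).symm
    · rw [hrq hu, hrq hv] at huv
      linarith [hi' (hm hu) (hm hv) huv]
  · rw [hrp ⟨le_rfl, hT.le⟩, h0]
  · rw [hrq ⟨by linarith, le_rfl⟩]; simpa
  · rw [hun, image_union, hrp.image_eq, hrq.image_eq]
    congr 1
    have : (fun u => q (u - T)) '' Icc T (T + T') = q '' ((fun u => u - T) '' Icc T (T + T')) := by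
      rw [image_image]
    rw [this]
    congr 1
    simp

lemma exists_unit (h : IsSimpleArc x y X) : ∃ p : ℝ → Q, ContinuousOn p (Icc 0 1) ∧
    InjOn p (Icc 0 1) ∧ p 0 = x ∧ p 1 = y ∧ p '' Icc 0 1 = X := by
  obtain ⟨T, hT, p, hc, hi, h0, h1, hX⟩ := h
  have hm : MapsTo (fun u => T * u) (Icc 0 1) (Icc 0 T) := by
    intro u hu; exact ⟨by nlinarith [hu.1], by nlinarith [hu.2]⟩
  refine ⟨fun u => p (T * u), hc.comp (by fun_prop) hm, ?_, by simpa, by simpa, ?_⟩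
  · intro u hu v hv h
    simpa [hT.ne'] using hi (hm hu) (hm hv) h
  · have : (fun u => p (T * u)) '' Icc 0 1 = p '' ((fun u => T * u) '' Icc 0 1) := by
      rw [image_image]
    rw [this, ← hX, image_mul_left_Icc hT.le zero_le_one]
    simp

end IsSimpleArc

namespace Network

variable {Q : Type*} [MetricSpace Q] (N : Network Q)

lemma IsTree.eq_of_isSimpleArc {N : Network Q} (hN : N.IsTree) {x y : Q} {X Y : Set Q}
    (hX : IsSimpleArc x y X) (hY : IsSimpleArc x y Y) : X = Y := by
  obtain ⟨p, pc, pi, p0, p1, rfl⟩ := hX.exists_unit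
  obtain ⟨q, qc, qi, q0, q1, rfl⟩ := hY.exists_unit
  exact hN p q pc pi qc qi (p0.trans q0.symm) (p1.trans q1.symm)

/-- The open arc `a` as a subset of the network. -/
def openArc (a : N.Arc) : Set Q := N.param a '' Ioo 0 (N.len a)

lemma dist_param_le (a : N.Arc) {s t : ℝ} (hs : s ∈ Icc 0 (N.len a)) (ht : t ∈ Icc 0 (N.len a)) :
    dist (N.param a s) (N.param a t) ≤ |s - t| := by
  wlog hst : s ≤ t generalizing s t
  · rw [dist_comm, abs_sub_comm]; exact this ht hs (le_of_not_ge hst)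
  have h := eVariationOn.edist_le (N.param a) (s := Icc s t) (x := s) (y := t)
    ⟨le_rfl, hst⟩ ⟨hst, le_rfl⟩
  rw [N.param_length a s t hs.1 hst ht.2, edist_dist,
    ENNReal.ofReal_le_ofReal_iff (by linarith)] at h
  rw [abs_sub_comm]; exact h.trans (le_abs_self _)

lemma continuousOn_param (a : N.Arc) : ContinuousOn (N.param a) (Icc 0 (N.len a)) := by
  have : LipschitzOnWith 1 (N.param a) (Icc 0 (N.len a)) :=
    LipschitzOnWith.of_dist_le_mul fun x hx y hy => by
      simpa [Real.dist_eq] using N.dist_param_le a hx hy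
  exact this.continuousOn

lemma mem_nodes_or_exists (x : Q) :
    x ∈ N.nodes ∨ ∃ a, ∃ s ∈ Ioo 0 (N.len a), N.param a s = x := by
  by_cases h : x ∈ N.nodes
  · exact .inl h
  · right
    have : x ∈ (⋃ a, N.param a '' Ioo 0 (N.len a)) := by rw [N.iUnion_arcs]; exact h
    simpa using this

lemma param_notMem_nodes (a : N.Arc) {s : ℝ} (hs : s ∈ Ioo 0 (N.len a)) :
    N.param a s ∉ N.nodes := by
  have : N.param a s ∈ (⋃ a, N.param a '' Ioo 0 (N.len a)) :=
    mem_iUnion.2 ⟨a, mem_image_of_mem _ hs⟩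
  rwa [N.iUnion_arcs] at this

lemma param_mem_nodes_iff (a : N.Arc) {s : ℝ} (hs : s ∈ Icc 0 (N.len a)) :
    N.param a s ∈ N.nodes ↔ s = 0 ∨ s = N.len a := by
  constructor
  · intro h
    by_contra! hc
    exact N.param_notMem_nodes a ⟨lt_of_le_of_ne hs.1 hc.1.symm, lt_of_le_of_ne hs.2 hc.2⟩ h
  · rintro (rfl | rfl)
    exacts [N.param_zero_mem a, N.param_len_mem a]

lemma openArc_unique {a b : N.Arc} {x : Q} (ha : x ∈ N.openArc a) (hb : x ∈ N.openArc b) :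
    a = b := by
  by_contra h
  exact (disjoint_left.1 (N.arcs_disjoint a b h)) ha hb

lemma notMem_nodes_of_mem_openArc {a : N.Arc} {x : Q} (h : x ∈ N.openArc a) : x ∉ N.nodes := by
  obtain ⟨s, hs, rfl⟩ := h
  exact N.param_notMem_nodes a hs

lemma closedArc_subset (a : N.Arc) :
    N.param a '' Icc 0 (N.len a) ⊆ {N.param a 0, N.param a (N.len a)} ∪ N.openArc a := by
  rintro _ ⟨s, hs, rfl⟩
  rcases eq_or_lt_of_le hs.1 with h | h
  · left; left; rw [h]
  rcases eq_or_lt_of_le hs.2 with h' | h'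
  · left; right; rw [h']; rfl
  · right; exact ⟨s, ⟨h, h'⟩, rfl⟩

/-- In a loop, the two halves of the arc would be different simple paths from the node to the
midpoint. -/
lemma IsTree.param_zero_ne {N : Network Q} (hN : N.IsTree) (a : N.Arc) :
    N.param a 0 ≠ N.param a (N.len a) := by
  intro h
  have hl := N.len_pos a
  set m := N.len a / 2 with hm
  have hmI : m ∈ Ioo 0 (N.len a) := ⟨by linarith, by linarith⟩
  have i1 : InjOn (N.param a) (Icc 0 m) := by
    intro s hs t ht hst
    have e : ∀ u ∈ Icc 0 m, u = 0 ∨ u ∈ Ioo 0 (N.len a) := fun u hu =>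
      (eq_or_lt_of_le hu.1).imp Eq.symm (fun h => ⟨h, by linarith [hu.2]⟩)
    rcases e s hs with rfl | hs' <;> rcases e t ht with rfl | ht'
    · rfl
    · exact absurd (hst ▸ N.param_zero_mem a) (N.param_notMem_nodes a ht')
    · exact absurd (hst ▸ N.param_zero_mem a) (N.param_notMem_nodes a hs')
    · exact N.param_injOn a hs' ht' hst
  have i2 : InjOn (N.param a) (Icc m (N.len a)) := by
    intro s hs t ht hst
    have e : ∀ u ∈ Icc m (N.len a), u = N.len a ∨ u ∈ Ioo 0 (N.len a) := fun u hu =>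
      (eq_or_lt_of_le hu.2).imp id (fun h => ⟨by linarith [hu.1], h⟩)
    rcases e s hs with hs' | hs' <;> rcases e t ht with ht' | ht'
    · rw [hs', ht']
    · rw [hs'] at hst
      exact absurd (hst ▸ N.param_len_mem a) (N.param_notMem_nodes a ht')
    · rw [ht'] at hst
      exact absurd (hst ▸ N.param_len_mem a) (N.param_notMem_nodes a hs')
    · exact N.param_injOn a hs' ht' hst
  have s1 := IsSimpleArc.image_of_le hmI.1
    ((N.continuousOn_param a).mono (Icc_subset_Icc_right hmI.2.le)) i1
  have s2 := (IsSimpleArc.image_of_le hmI.2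
    ((N.continuousOn_param a).mono (Icc_subset_Icc_left hmI.1.le)) i2).symm
  rw [h] at s1
  have e := hN.eq_of_isSimpleArc s1 s2
  have hq : m / 2 ∈ Ioo 0 (N.len a) := ⟨by linarith, by linarith⟩
  have : N.param a (m / 2) ∈ N.param a '' Icc m (N.len a) := by
    rw [← e]; exact ⟨m / 2, ⟨by linarith, by linarith⟩, rfl⟩
  obtain ⟨u, hu, he⟩ := this
  rcases eq_or_lt_of_le hu.2 with h' | h'
  · rw [h'] at he
    exact N.param_notMem_nodes a hq (he ▸ N.param_len_mem a)
  · have := N.param_injOn a ⟨by linarith [hu.1], h'⟩ hq he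
    linarith [hu.1]

lemma IsTree.injOn_param {N : Network Q} (hN : N.IsTree) (a : N.Arc) :
    InjOn (N.param a) (Icc 0 (N.len a)) := by
  intro s hs t ht hst
  by_cases h : N.param a s ∈ N.nodes
  · have h1 := (N.param_mem_nodes_iff a hs).1 h
    have h2 := (N.param_mem_nodes_iff a ht).1 (hst ▸ h)
    have := hN.param_zero_ne a
    rcases h1 with h1 | h1 <;> rcases h2 with h2 | h2
    · rw [h1, h2]
    · rw [h1, h2] at hst; exact absurd hst this
    · rw [h1, h2] at hst; exact absurd hst.symm this
    · rw [h1, h2]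
  · have e : ∀ u ∈ Icc 0 (N.len a), N.param a u ∉ N.nodes → u ∈ Ioo 0 (N.len a) := by
      intro u hu hn
      rw [N.param_mem_nodes_iff a hu] at hn
      push Not at hn
      exact ⟨lt_of_le_of_ne hu.1 hn.1.symm, lt_of_le_of_ne hu.2 hn.2⟩
    exact N.param_injOn a (e s hs h) (e t ht (hst ▸ h)) hst

/-- The graph on the points of the network whose edges are the arcs other than `a`. -/
def graphWithout (a : N.Arc) : SimpleGraph Q :=
  SimpleGraph.fromRel fun x y => ∃ b, b ≠ a ∧ N.param b 0 = x ∧ N.param b (N.len b) = y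

lemma IsTree.exists_isSimpleArc_of_adj {N : Network Q} (hN : N.IsTree) {a : N.Arc} {x y : Q}
    (h : (N.graphWithout a).Adj x y) : ∃ b, b ≠ a ∧
      ({N.param b 0, N.param b (N.len b)} : Set Q) = {x, y} ∧
      IsSimpleArc x y (N.param b '' Icc 0 (N.len b)) := by
  have key : ∀ b, IsSimpleArc (N.param b 0) (N.param b (N.len b)) (N.param b '' Icc 0 (N.len b)) :=
    fun b => IsSimpleArc.image_of_le (N.len_pos b) (N.continuousOn_param b) (hN.injOn_param b)
  rw [graphWithout, SimpleGraph.fromRel_adj] at h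
  rcases h.2 with ⟨b, hb, rfl, rfl⟩ | ⟨b, hb, rfl, rfl⟩
  · exact ⟨b, hb, rfl, key b⟩
  · exact ⟨b, hb, pair_comm _ _, (key b).symm⟩

/-- Concatenates the arcs along a graph path. The record of the nodes and arcs that are met is what
makes the next arc intersect the rest only at the joint, so that the induction closes. -/
lemma IsTree.exists_isSimpleArc_of_isPath {N : Network Q} (hN : N.IsTree) {a : N.Arc} {x y : Q}
    (w : (N.graphWithout a).Walk x y) (hw : w.IsPath) (hne : x ≠ y) :
    ∃ X, IsSimpleArc x y X ∧ (∀ z ∈ X, z ∈ N.nodes → z ∈ w.support) ∧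
      ∀ b, (X ∩ N.openArc b).Nonempty →
        b ≠ a ∧ N.param b 0 ∈ w.support ∧ N.param b (N.len b) ∈ w.support := by
  induction w with
  | nil => exact absurd rfl hne
  | @cons x y z h w ih =>
    obtain ⟨hp, hx⟩ := (SimpleGraph.Walk.cons_isPath_iff h w).1 hw
    obtain ⟨b, hba, hbe, hbs⟩ := hN.exists_isSimpleArc_of_adj h
    have hsub := N.closedArc_subset b
    rw [hbe] at hsub
    have hb0 : N.param b 0 ∈ ({x, y} : Set Q) := hbe ▸ mem_insert _ _
    have hb1 : N.param b (N.len b) ∈ ({x, y} : Set Q) :=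
      hbe ▸ mem_insert_of_mem _ (mem_singleton _)
    have hsupp : ∀ z ∈ ({x, y} : Set Q), z ∈ (SimpleGraph.Walk.cons h w).support := by
      rintro z (rfl | rfl)
      · simp
      · simp
    have hnode : ∀ z ∈ N.param b '' Icc 0 (N.len b), z ∈ N.nodes → z ∈ ({x, y} : Set Q) := by
      intro z hz hzn
      exact (hsub hz).resolve_right fun h' => N.notMem_nodes_of_mem_openArc h' hzn
    have harc : ∀ c, (N.param b '' Icc 0 (N.len b) ∩ N.openArc c).Nonempty → c = b := by
      rintro c ⟨z, hz, hzc⟩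
      rcases hsub hz with h' | h'
      · refine absurd ?_ (N.notMem_nodes_of_mem_openArc hzc)
        rw [← hbe] at h'
        rcases h' with rfl | rfl
        exacts [N.param_zero_mem b, N.param_len_mem b]
      · exact N.openArc_unique hzc h'
    by_cases hyz : y = z
    · subst hyz
      refine ⟨_, hbs, fun z hz hzn => hsupp z (hnode z hz hzn), fun c hc => ?_⟩
      obtain rfl := harc c hc
      exact ⟨hba, hsupp _ hb0, hsupp _ hb1⟩
    · obtain ⟨X, hX, hXn, hXa⟩ := ih hp hyz
      refine ⟨_, hbs.trans hX ?_, ?_, ?_⟩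
      · rintro v ⟨hv, hvX⟩
        rcases hsub hv with h' | h'
        · rcases h' with rfl | h'
          · exact absurd (hXn _ hvX (by
              have : v ∈ ({N.param b 0, N.param b (N.len b)} : Set Q) := hbe ▸ mem_insert _ _
              rcases this with rfl | rfl
              exacts [N.param_zero_mem b, N.param_len_mem b])) hx
          · exact h'
        · obtain ⟨-, h0, h1⟩ := hXa b ⟨v, hvX, h'⟩
          have : x ∈ ({N.param b 0, N.param b (N.len b)} : Set Q) := hbe ▸ mem_insert _ _
          rcases this with rfl | rfl
          exacts [absurd h0 hx, absurd h1 hx]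
      · rintro v (hv | hv) hvn
        · exact hsupp v (hnode v hv hvn)
        · simp [hXn v hv hvn]
      · rintro c ⟨v, hv | hv, hvc⟩
        · obtain rfl := harc c ⟨v, hv, hvc⟩
          exact ⟨hba, hsupp _ hb0, hsupp _ hb1⟩
        · obtain ⟨h0, h1, h2⟩ := hXa c ⟨v, hv, hvc⟩
          exact ⟨h0, by simp [h1], by simp [h2]⟩

/-- A connection avoiding `a` would be a second simple path between the ends of `a`. -/
lemma IsTree.not_reachable {N : Network Q} (hN : N.IsTree) (a : N.Arc) :
    ¬ (N.graphWithout a).Reachable (N.param a 0) (N.param a (N.len a)) := by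
  intro h
  obtain ⟨w, hw⟩ := h.exists_isPath
  obtain ⟨X, hX, -, hXa⟩ := hN.exists_isSimpleArc_of_isPath w hw (hN.param_zero_ne a)
  have e := hN.eq_of_isSimpleArc hX
    (IsSimpleArc.image_of_le (N.len_pos a) (N.continuousOn_param a) (hN.injOn_param a))
  have hl := N.len_pos a
  refine (hXa a ⟨N.param a (N.len a / 2), ?_, ?_⟩).1 rfl
  · rw [e]; exact ⟨_, ⟨by linarith, by linarith⟩, rfl⟩
  · exact ⟨_, ⟨by linarith, by linarith⟩, rfl⟩

end Network

/-! ### The retraction of a tree onto an arc, and geodesics -/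

namespace Network

variable {Q : Type*} [MetricSpace Q] (N : Network Q)

/-- The points outside the open arc `a` which are connected to its start by other arcs. -/
def nearSide (a : N.Arc) : Set Q :=
  {y | (N.graphWithout a).Reachable (N.param a 0) y ∨
    ∃ b, b ≠ a ∧ y ∈ N.openArc b ∧ (N.graphWithout a).Reachable (N.param a 0) (N.param b 0)}

open Classical in
/-- The retraction of a tree onto the arc `a`, in arc length coordinates. -/
noncomputable def coord (a : N.Arc) (y : Q) : ℝ :=
  if h : ∃ s ∈ Ioo 0 (N.len a), N.param a s = y then h.choose
  else if y ∈ N.nearSide a then 0 else N.len a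

lemma coord_mem (a : N.Arc) (y : Q) : N.coord a y ∈ Icc 0 (N.len a) := by
  have := N.len_pos a
  unfold coord
  split_ifs with h h'
  · exact Ioo_subset_Icc_self h.choose_spec.1
  · exact ⟨le_rfl, this.le⟩
  · exact ⟨this.le, le_rfl⟩

lemma coord_param_of_mem_Ioo (a : N.Arc) {s : ℝ} (hs : s ∈ Ioo 0 (N.len a)) :
    N.coord a (N.param a s) = s := by
  have h : ∃ s' ∈ Ioo 0 (N.len a), N.param a s' = N.param a s := ⟨s, hs, rfl⟩
  rw [coord, dif_pos h]
  exact N.param_injOn a h.choose_spec.1 hs h.choose_spec.2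

lemma param_coord (a : N.Arc) {y : Q} (hy : N.coord a y ∈ Ioo 0 (N.len a)) :
    N.param a (N.coord a y) = y := by
  unfold coord at hy ⊢
  split_ifs at hy ⊢ with h h'
  · exact h.choose_spec.2
  · exact absurd hy.1 (lt_irrefl _)
  · exact absurd hy.2 (lt_irrefl _)

open Classical in
lemma coord_of_notMem_openArc (a : N.Arc) {y : Q} (hy : y ∉ N.openArc a) :
    N.coord a y = if y ∈ N.nearSide a then 0 else N.len a := by
  rw [coord, dif_neg]
  rintro ⟨s, hs, rfl⟩
  exact hy ⟨s, hs, rfl⟩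

lemma mem_nodes_of_reachable {a : N.Arc} {x y : Q} (hx : x ∈ N.nodes)
    (h : (N.graphWithout a).Reachable x y) : y ∈ N.nodes := by
  obtain ⟨w⟩ := h
  induction w with
  | nil => exact hx
  | cons h w ih =>
    apply ih
    rw [graphWithout, SimpleGraph.fromRel_adj] at h
    rcases h.2 with ⟨b, hb, rfl, rfl⟩ | ⟨b, hb, rfl, rfl⟩
    exacts [N.param_len_mem b, N.param_zero_mem b]

/-- An arc other than `a` lies, ends included, on one side of `a`, because its end nodes are joined
in `graphWithout a`. This makes `coord a` constant on it. -/
lemma param_mem_nearSide_iff {a b : N.Arc} (hb : b ≠ a) {s : ℝ} (hs : s ∈ Icc 0 (N.len b)) :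
    N.param b s ∈ N.nearSide a ↔
      (N.graphWithout a).Reachable (N.param a 0) (N.param b 0) := by
  by_cases hn : N.param b s ∈ N.nodes
  · have h1 : N.param b s ∈ N.nearSide a ↔
        (N.graphWithout a).Reachable (N.param a 0) (N.param b s) := by
      refine ⟨fun h => h.resolve_right ?_, .inl⟩
      rintro ⟨c, -, hc, -⟩
      exact N.notMem_nodes_of_mem_openArc hc hn
    rw [h1]
    rcases (N.param_mem_nodes_iff b hs).1 hn with rfl | rfl
    · rfl
    · by_cases he : N.param b 0 = N.param b (N.len b)
      · rw [he]
      · have hadj : (N.graphWithout a).Adj (N.param b 0) (N.param b (N.len b)) := by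
          rw [graphWithout, SimpleGraph.fromRel_adj]
          exact ⟨he, .inl ⟨b, hb, rfl, rfl⟩⟩
        exact ⟨fun h => h.trans hadj.reachable.symm, fun h => h.trans hadj.reachable⟩
  · have hs' : s ∈ Ioo 0 (N.len b) := by
      rw [N.param_mem_nodes_iff b hs] at hn
      push Not at hn
      exact ⟨lt_of_le_of_ne hs.1 hn.1.symm, lt_of_le_of_ne hs.2 hn.2⟩
    constructor
    · rintro (h | ⟨c, -, hc, h⟩)
      · exact absurd (N.mem_nodes_of_reachable (N.param_zero_mem a) h) hn
      · rwa [N.openArc_unique ⟨s, hs', rfl⟩ hc]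
    · exact fun h => .inr ⟨b, hb, ⟨s, hs', rfl⟩, h⟩

lemma param_notMem_openArc_of_ne {a b : N.Arc} (hb : b ≠ a) {s : ℝ} (hs : s ∈ Icc 0 (N.len b)) :
    N.param b s ∉ N.openArc a := by
  intro h
  rcases N.closedArc_subset b ⟨s, hs, rfl⟩ with (h' | h') | h'
  · exact N.notMem_nodes_of_mem_openArc h (h' ▸ N.param_zero_mem b)
  · exact N.notMem_nodes_of_mem_openArc h (h' ▸ N.param_len_mem b)
  · exact hb (N.openArc_unique h' h)

lemma coord_param_of_ne {a b : N.Arc} (hb : b ≠ a) {s : ℝ} (hs : s ∈ Icc 0 (N.len b)) :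
    N.coord a (N.param b s) = N.coord a (N.param b 0) := by
  have h0 : (0 : ℝ) ∈ Icc 0 (N.len b) := ⟨le_rfl, (N.len_pos b).le⟩
  rw [N.coord_of_notMem_openArc a (N.param_notMem_openArc_of_ne hb hs),
    N.coord_of_notMem_openArc a (N.param_notMem_openArc_of_ne hb h0),
    N.param_mem_nearSide_iff hb hs, N.param_mem_nearSide_iff hb h0]

lemma IsTree.coord_param {N : Network Q} (hN : N.IsTree) (a : N.Arc) {s : ℝ}
    (hs : s ∈ Icc 0 (N.len a)) : N.coord a (N.param a s) = s := by
  have key : ∀ y ∈ N.nodes, (y ∈ N.nearSide a ↔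
      (N.graphWithout a).Reachable (N.param a 0) y) := by
    refine fun y hy => ⟨fun h => h.resolve_right ?_, .inl⟩
    rintro ⟨c, -, hc, -⟩
    exact N.notMem_nodes_of_mem_openArc hc hy
  by_cases hn : N.param a s ∈ N.nodes
  · rw [N.coord_of_notMem_openArc a fun h => N.notMem_nodes_of_mem_openArc h hn, key _ hn]
    rcases (N.param_mem_nodes_iff a hs).1 hn with rfl | rfl
    · rw [if_pos (SimpleGraph.Reachable.refl _)]
    · rw [if_neg (hN.not_reachable a)]
  · rw [N.param_mem_nodes_iff a hs] at hn
    push Not at hn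
    exact N.coord_param_of_mem_Ioo a ⟨lt_of_le_of_ne hs.1 hn.1.symm, lt_of_le_of_ne hs.2 hn.2⟩

lemma isCompact_image_param (a : N.Arc) {F : Set ℝ} (hF : IsClosed F) :
    IsCompact (N.param a '' (Icc 0 (N.len a) ∩ F)) :=
  (isCompact_Icc.inter_right hF).image_of_continuousOn
    ((N.continuousOn_param a).mono inter_subset_left)

lemma eq_iUnion_union (Y : Set Q) :
    Y = (⋃ a, N.param a '' (Icc 0 (N.len a) ∩ N.param a ⁻¹' Y)) ∪ (N.nodes ∩ Y) := by
  ext y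
  simp only [mem_union, mem_iUnion, mem_inter_iff]
  constructor
  · intro hy
    rcases N.mem_nodes_or_exists y with h | ⟨a, s, hs, rfl⟩
    · exact .inr ⟨h, hy⟩
    · exact .inl ⟨a, s, ⟨Ioo_subset_Icc_self hs, hy⟩, rfl⟩
  · rintro (⟨a, s, ⟨-, hs⟩, rfl⟩ | h)
    exacts [hs, h.2]

include N in
lemma compactSpace : CompactSpace Q := by
  refine ⟨?_⟩
  rw [N.eq_iUnion_union univ]
  refine (isCompact_iUnion fun a => ?_).union (N.nodes_finite.inter_of_left _).isCompact
  exact N.isCompact_image_param a isClosed_univ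

/-- The preimage of a closed set is a finite union of compact sets: its trace on `a`, all or nothing
of each other arc, and some nodes. -/
lemma IsTree.continuous_coord {N : Network Q} (hN : N.IsTree) (a : N.Arc) :
    Continuous (N.coord a) := by
  rw [continuous_iff_isClosed]
  intro F hF
  rw [N.eq_iUnion_union (N.coord a ⁻¹' F)]
  refine ((isCompact_iUnion fun b => ?_).union
    (N.nodes_finite.inter_of_left _).isCompact).isClosed
  by_cases hb : b = a
  · subst hb
    have : Icc 0 (N.len b) ∩ N.param b ⁻¹' (N.coord b ⁻¹' F) = Icc 0 (N.len b) ∩ F := by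
      ext s
      refine and_congr_right fun hs => ?_
      rw [mem_preimage, mem_preimage, hN.coord_param b hs]
    rw [this]
    exact N.isCompact_image_param b hF
  · have : Icc 0 (N.len b) ∩ N.param b ⁻¹' (N.coord a ⁻¹' F) =
        Icc 0 (N.len b) ∩ {_s | N.coord a (N.param b 0) ∈ F} := by
      ext s
      refine and_congr_right fun hs => ?_
      rw [mem_preimage, mem_preimage, N.coord_param_of_ne hb hs]; rfl
    rw [this]
    exact N.isCompact_image_param b isClosed_const

include N in
lemma exists_min_path (x y : Q) : ∃ p : ℝ → Q, ContinuousOn p (Icc 0 1) ∧ p 0 = x ∧ p 1 = y ∧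
    edist x y = eVariationOn p (Icc 0 1) :=
  (N.isLeast_edist x y).1

include N in
lemma exists_geodesic (x y : Q) : ∃ p : ℝ → Q, ContinuousOn p (Icc 0 1) ∧ p 0 = x ∧ p 1 = y ∧
    ∀ u ∈ Icc 0 1, dist x (p u) + dist (p u) y = dist x y := by
  obtain ⟨p, hc, h0, h1, he⟩ := N.exists_min_path x y
  refine ⟨p, hc, h0, h1, fun u hu => le_antisymm ?_ (dist_triangle _ _ _)⟩
  have h : edist x (p u) + edist (p u) y ≤ edist x y := by
    rw [he, ← univ_inter (Icc (0 : ℝ) 1), ← eVariationOn.Icc_add_Icc p hu.1 hu.2 (mem_univ u),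
      univ_inter, univ_inter]
    gcongr
    · rw [← h0]; exact eVariationOn.edist_le p ⟨le_rfl, hu.1⟩ ⟨hu.1, le_rfl⟩
    · rw [← h1]; exact eVariationOn.edist_le p ⟨le_rfl, hu.2⟩ ⟨hu.2, le_rfl⟩
  rwa [edist_dist, edist_dist, edist_dist, ← ENNReal.ofReal_add dist_nonneg dist_nonneg,
    ENNReal.ofReal_le_ofReal_iff dist_nonneg] at h

/-- A shortest path from `x` to `y` must run through the segment of `a` between the parameters `s`
and `t`. The strict inequalities keep `s` and `t` inside the open arc, where the coordinate
determines the point. -/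
lemma IsTree.sub_le_dist {N : Network Q} (hN : N.IsTree) (a : N.Arc) {x y : Q} {s t : ℝ}
    (hs : N.coord a x < s) (hst : s ≤ t) (ht : t < N.coord a y) : t - s ≤ dist x y := by
  obtain ⟨p, hc, h0, h1, he⟩ := N.exists_min_path x y
  have hf : ContinuousOn (fun u => N.coord a (p u)) (Icc 0 1) :=
    (hN.continuous_coord a).comp_continuousOn hc
  -- `g v` is the first time at which the path has coordinate `v`. It is monotone and `p ∘ g` is the
  -- arc itself, so the variation of `p` is at least that of the segment.
  set g : ℝ → ℝ := fun v => sInf (Icc 0 1 ∩ (fun u => N.coord a (p u)) ⁻¹' {v}) with hg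
  have hne : ∀ v ∈ Icc s t, (Icc 0 1 ∩ (fun u => N.coord a (p u)) ⁻¹' {v}).Nonempty := by
    intro v hv
    have := intermediate_value_Icc zero_le_one hf
    obtain ⟨u, hu, hu'⟩ := this (show v ∈ _ from
      ⟨by simp only [h0]; linarith [hv.1], by simp only [h1]; linarith [hv.2]⟩)
    exact ⟨u, hu, hu'⟩
  have hbdd : ∀ v, BddBelow (Icc 0 1 ∩ (fun u => N.coord a (p u)) ⁻¹' {v}) :=
    fun v => ⟨0, fun u hu => hu.1.1⟩
  have hgm : ∀ v ∈ Icc s t, g v ∈ Icc 0 1 ∩ (fun u => N.coord a (p u)) ⁻¹' {v} := fun v hv =>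
    (hf.preimage_isClosed_of_isClosed isClosed_Icc isClosed_singleton).csInf_mem (hne v hv) (hbdd v)
  have hmono : MonotoneOn g (Icc s t) := by
    intro v hv w hw hvw
    have hw' := hgm w hw
    have := intermediate_value_Icc hw'.1.1 (hf.mono (Icc_subset_Icc_right hw'.1.2))
    obtain ⟨u, hu, hu'⟩ := this (show v ∈ _ from
      ⟨by simp only [h0]; linarith [hv.1], by rw [show N.coord a (p (g w)) = w from hw'.2]; exact hvw⟩)
    exact (csInf_le (hbdd v) ⟨⟨hu.1, hu.2.trans hw'.1.2⟩, hu'⟩).trans hu.2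
  have hs0 : 0 < s := (N.coord_mem a x).1.trans_lt hs
  have ht1 : t < N.len a := ht.trans_le (N.coord_mem a y).2
  have hpg : EqOn (p ∘ g) (N.param a) (Icc s t) := by
    intro v hv
    have h := (hgm v hv).2
    simp only [mem_preimage, mem_singleton_iff] at h
    have := N.param_coord a (y := p (g v)) (by
      rw [h]; exact ⟨hs0.trans_le hv.1, hv.2.trans_lt ht1⟩)
    rw [h] at this
    exact this.symm
  have hle := eVariationOn.comp_le_of_monotoneOn p g hmono (fun v hv => (hgm v hv).1)
  rw [eVariationOn.congr hpg, N.param_length a s t hs0.le hst ht1.le, ← he, edist_dist,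
    ENNReal.ofReal_le_ofReal_iff dist_nonneg] at hle
  exact hle

lemma IsTree.lipschitzWith_coord {N : Network Q} (hN : N.IsTree) (a : N.Arc) :
    LipschitzWith 1 (N.coord a) := by
  refine LipschitzWith.of_le_add fun y x => ?_
  by_contra! h
  -- Moving both ends inwards by a third of the excess makes the inequalities strict and still
  -- leaves an interval longer than the distance.
  set e := (N.coord a y - N.coord a x - dist y x) / 3 with he
  have := hN.sub_le_dist a (x := x) (y := y) (s := N.coord a x + e) (t := N.coord a y - e)
    (by linarith) (by linarith [dist_nonneg (x := y) (y := x)]) (by linarith)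
  rw [dist_comm] at this
  linarith

include N in
lemma isPreconnected_univ : IsPreconnected (univ : Set Q) := by
  obtain ⟨x, -⟩ := N.nodes_nonempty
  refine isPreconnected_of_forall x fun y _ => ?_
  obtain ⟨p, hc, h0, h1, -⟩ := N.exists_geodesic x y
  exact ⟨p '' Icc 0 1, subset_univ _, ⟨0, by simp, h0⟩, ⟨1, by simp, h1⟩,
    isPreconnected_Icc.image p hc⟩

include N in
lemma preconnectedSpace : PreconnectedSpace Q := ⟨N.isPreconnected_univ⟩

include N in
lemma isPreconnected_ball (x : Q) (r : ℝ) : IsPreconnected (Metric.ball x r) := by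
  refine isPreconnected_of_forall x fun y hy => ?_
  obtain ⟨p, hc, h0, h1, hd⟩ := N.exists_geodesic x y
  refine ⟨p '' Icc 0 1, ?_, ⟨0, by simp, h0⟩, ⟨1, by simp, h1⟩, isPreconnected_Icc.image p hc⟩
  rintro _ ⟨u, hu, rfl⟩
  rw [Metric.mem_ball, dist_comm] at hy ⊢
  linarith [hd u hu, dist_nonneg (x := p u) (y := y)]

include N in
lemma locallyConnectedSpace : LocallyConnectedSpace Q :=
  locallyConnectedSpace_of_connected_bases (fun x r => Metric.ball x r) (fun _ r => 0 < r)
    (fun _ => Metric.nhds_basis_ball) fun x r _ => N.isPreconnected_ball x r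

namespace IsTree

variable {N} (hN : N.IsTree)
include hN

/-- A point of the arc `a` separating the values of `coord a` at `x` and `y` is between them. -/
lemma dist_add_dist_of_between (a : N.Arc) {x y : Q} {s : ℝ} (hs : s ∈ Ioo 0 (N.len a))
    (h : s ∈ uIcc (N.coord a x) (N.coord a y)) :
    dist x (N.param a s) + dist (N.param a s) y = dist x y := by
  obtain ⟨p, hc, h0, h1, hd⟩ := N.exists_geodesic x y
  have hf : ContinuousOn (fun u => N.coord a (p u)) (uIcc 0 1) := by
    rw [uIcc_of_le zero_le_one]
    exact (hN.continuous_coord a).comp_continuousOn hc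
  have := intermediate_value_uIcc hf
  rw [uIcc_of_le zero_le_one] at this
  simp only [h0, h1] at this
  obtain ⟨u, hu, hu'⟩ := this h
  have e : N.param a s = p u := by
    have := N.param_coord a (y := p u) (by simp only at hu'; rwa [hu'])
    simp only at hu'
    rwa [hu'] at this
  rw [e]
  exact hd u hu

/-- Coordinates cannot overshoot along a geodesic: an arc point with coordinate between that of `y`
and those of both `x` and `z` would lie between `x` and `y` and between `y` and `z`, hence equal
`y`. -/
lemma coord_mem_uIcc (a : N.Arc) {x y z : Q} (h : dist x y + dist y z = dist x z) :
    N.coord a y ∈ uIcc (N.coord a x) (N.coord a z) := by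
  have key : ∀ s ∈ Ioo 0 (N.len a), s ∈ uIcc (N.coord a x) (N.coord a y) →
      s ∈ uIcc (N.coord a y) (N.coord a z) → N.param a s = y := by
    intro s hs h1 h2
    have e1 := hN.dist_add_dist_of_between a hs h1
    have e2 := hN.dist_add_dist_of_between a hs h2
    have := dist_triangle x (N.param a s) z
    have : dist y (N.param a s) ≤ 0 := by
      rw [dist_comm (N.param a s) y] at e1
      linarith
    exact (dist_le_zero.1 this).symm
  by_contra hc
  have hx := N.coord_mem a x
  have hy := N.coord_mem a y
  have hz := N.coord_mem a z
  rw [uIcc, mem_Icc, not_and_or, not_le, not_le] at hc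
  rcases hc with hlt | hlt
  · obtain ⟨s, hs1, hs2⟩ := exists_between hlt
    have hsx := hs2.trans_le (min_le_left _ _)
    have hsz := hs2.trans_le (min_le_right _ _)
    have hs : s ∈ Ioo 0 (N.len a) := ⟨hy.1.trans_lt hs1, hsx.trans_le hx.2⟩
    have := key s hs (mem_uIcc.2 (.inr ⟨hs1.le, hsx.le⟩)) (mem_uIcc.2 (.inl ⟨hs1.le, hsz.le⟩))
    rw [← this, hN.coord_param a (Ioo_subset_Icc_self hs)] at hs1
    exact lt_irrefl _ hs1
  · obtain ⟨s, hs1, hs2⟩ := exists_between hlt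
    have hsx := (le_max_left _ _).trans_lt hs1
    have hsz := (le_max_right _ _).trans_lt hs1
    have hs : s ∈ Ioo 0 (N.len a) := ⟨hx.1.trans_lt hsx, hs2.trans_le hy.2⟩
    have := key s hs (mem_uIcc.2 (.inl ⟨hsx.le, hs2.le⟩)) (mem_uIcc.2 (.inr ⟨hsz.le, hs2.le⟩))
    rw [← this, hN.coord_param a (Ioo_subset_Icc_self hs)] at hs2
    exact lt_irrefl _ hs2

omit hN in
/-- A geodesic meets a regular point. -/
lemma _root_.Network.exists_between_regular (N : Network Q) {x y : Q} (hxy : x ≠ y) {r : ℝ} (hr : 0 < r) :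
    ∃ a, ∃ s ∈ Ioo 0 (N.len a), 0 < dist x (N.param a s) ∧
      dist x (N.param a s) < r ∧
      dist x (N.param a s) + dist (N.param a s) y = dist x y := by
  obtain ⟨p, hc, h0, h1, hd⟩ := N.exists_geodesic x y
  have hf : ContinuousOn (fun u => dist x (p u)) (Icc 0 1) :=
    (continuous_const.dist continuous_id).comp_continuousOn hc
  have hiv := intermediate_value_Icc zero_le_one hf
  simp only [h0, h1, dist_self] at hiv
  have hd0 : 0 < dist x y := dist_pos.2 hxy
  set m := min r (dist x y)
  have hm : 0 < m := lt_min hr hd0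
  -- Only finitely many distances from `x` are attained at nodes; any other distance gives a regular
  -- point.
  have hinf : (Ioo 0 m \ (dist x '' N.nodes)).Nonempty :=
    ((Ioo_infinite hm).sdiff (N.nodes_finite.image _)).nonempty
  obtain ⟨v, hv, hvn⟩ := hinf
  obtain ⟨u, hu, hu'⟩ := hiv ⟨hv.1.le, hv.2.le.trans (min_le_right _ _)⟩
  simp only at hu'
  rcases N.mem_nodes_or_exists (p u) with h | ⟨a, s, hs, hs'⟩
  · exact absurd ⟨p u, h, hu'⟩ hvn
  · refine ⟨a, s, hs, ?_, ?_, ?_⟩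
    · rw [hs', hu']; exact hv.1
    · rw [hs', hu']; exact hv.2.trans_le (min_le_left _ _)
    · rw [hs']; exact hd u hu

/-- If all coordinates agreed, a regular point between `x` and `y` would share its coordinate on its
own arc with both, which forces both to equal it. -/
lemma exists_coord_ne {x y : Q} (hxy : x ≠ y) : ∃ a, N.coord a x ≠ N.coord a y := by
  by_contra! h
  obtain ⟨a, s, hs, -, -, hd⟩ := N.exists_between_regular hxy one_pos
  have hmem := hN.coord_mem_uIcc a hd
  rw [← h a, uIcc_self, mem_singleton_iff, hN.coord_param a (Ioo_subset_Icc_self hs)] at hmem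
  have e1 := N.param_coord a (y := x) (by rwa [← hmem])
  have e2 := N.param_coord a (y := y) (by rwa [← h a, ← hmem])
  exact hxy (by rw [← e1, ← e2, h a])

/-- Arbitrarily close to `x` there are regular points strictly separating `x` from `y`. -/
lemma exists_separating {x y : Q} (hxy : x ≠ y) {r : ℝ} (hr : 0 < r) :
    ∃ a, ∃ s ∈ Ioo 0 (N.len a), dist (N.param a s) x < r ∧
      (N.coord a x < s ∧ s < N.coord a y ∨ N.coord a y < s ∧ s < N.coord a x) := by
  -- A point `z` of the geodesic close to `x` differs from `x` in some coordinate. Arc points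
  -- strictly between these two values are close to `x`, and by monotonicity along the geodesic they
  -- also separate `x` from `y`.
  obtain ⟨b, t, ht, hd0, hd, hb⟩ := N.exists_between_regular hxy hr
  set z := N.param b t with hz
  obtain ⟨a, ha⟩ := hN.exists_coord_ne (dist_pos.1 hd0)
  have hmem := hN.coord_mem_uIcc a hb
  have hx := N.coord_mem a x
  have hz := N.coord_mem a z
  have hclose : ∀ s ∈ Ioo 0 (N.len a), s ∈ uIcc (N.coord a x) (N.coord a z) →
      dist (N.param a s) x < r := by
    intro s hs h
    have := hN.dist_add_dist_of_between a hs h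
    rw [dist_comm]
    linarith [dist_nonneg (x := N.param a s) (y := z)]
  rcases lt_or_gt_of_ne ha with h | h
  · obtain ⟨s, hs1, hs2⟩ := exists_between h
    have hs : s ∈ Ioo 0 (N.len a) := ⟨hx.1.trans_lt hs1, hs2.trans_le hz.2⟩
    refine ⟨a, s, hs, hclose s hs (mem_uIcc.2 (.inl ⟨hs1.le, hs2.le⟩)), .inl ⟨hs1, ?_⟩⟩
    rcases mem_uIcc.1 hmem with h' | h'
    exacts [hs2.trans_le h'.2, by linarith [h'.2]]
  · obtain ⟨s, hs1, hs2⟩ := exists_between h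
    have hs : s ∈ Ioo 0 (N.len a) := ⟨hz.1.trans_lt hs1, hs2.trans_le hx.2⟩
    refine ⟨a, s, hs, hclose s hs (mem_uIcc.2 (.inr ⟨hs1.le, hs2.le⟩)), .inr ⟨?_, hs2⟩⟩
    rcases mem_uIcc.1 hmem with h' | h'
    exacts [by linarith [h'.1], h'.1.trans_lt hs1]

lemma isPreconnected_coord_preimage (a : N.Arc) {J : Set ℝ} (hJ : J.OrdConnected) :
    IsPreconnected (N.coord a ⁻¹' J) := by
  refine isPreconnected_of_forall_pair fun x hx y hy => ?_
  obtain ⟨p, hc, h0, h1, hd⟩ := N.exists_geodesic x y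
  refine ⟨p '' Icc 0 1, ?_, ⟨0, by simp, h0⟩, ⟨1, by simp, h1⟩, isPreconnected_Icc.image p hc⟩
  rintro _ ⟨u, hu, rfl⟩
  exact hJ.uIcc_subset hx hy (hN.coord_mem_uIcc a (hd u hu))

end IsTree

end Network

/-! ### How often a Lipschitz path on the line takes its values -/

section RealLipschitz

/-- One-dimensional Hausdorff measure is Lebesgue measure and does not grow under 1-Lipschitz maps;
`X` need not be measurable. -/
lemma LipschitzWith.volume_le_of_subset_image {f : ℝ → ℝ} (hf : LipschitzWith 1 f) {A X : Set ℝ}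
    (h : X ⊆ f '' A) : volume X ≤ volume (A ∩ f ⁻¹' X) := by
  have e : X = f '' (A ∩ f ⁻¹' X) := by
    rw [image_inter_preimage, inter_eq_right.2 h]
  have := hf.hausdorffMeasure_image_le (d := 1) zero_le_one (A ∩ f ⁻¹' X)
  rw [← e, hausdorffMeasure_real] at this
  simpa using this

/-- A closed path on the line takes each value between its extreme values twice. -/
lemma LipschitzWith.two_mul_volume_le {f : ℝ → ℝ} (hf : LipschitzWith 1 f) {u v : ℝ} (huv : u ≤ v)
    (he : f u = f v) {X : Set ℝ} (hX : X ⊆ f '' Icc u v) :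
    2 * volume X ≤ volume (Icc u v ∩ f ⁻¹' X) := by
  have hc : Continuous f := hf.continuous
  obtain ⟨tm, htm, hmin⟩ := isCompact_Icc.exists_isMinOn (nonempty_Icc.2 huv) hc.continuousOn
  obtain ⟨tM, htM, hmax⟩ := isCompact_Icc.exists_isMaxOn (nonempty_Icc.2 huv) hc.continuousOn
  set X' := X \ {f tm, f tM}
  have hvol : volume X' = volume X :=
    measure_sdiff_null ((finite_singleton _).insert _ |>.measure_zero _)
  have hX' : ∀ x ∈ X', f tm < x ∧ x < f tM := by
    rintro x ⟨hx, hx'⟩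
    obtain ⟨t, ht, rfl⟩ := hX hx
    simp only [mem_insert_iff, mem_singleton_iff, not_or] at hx'
    exact ⟨lt_of_le_of_ne (hmin ht) (Ne.symm hx'.1), lt_of_le_of_ne (hmax ht) hx'.2⟩
  -- `A` is the time between a minimum and a maximum. The remaining time also covers all values in
  -- between, since it leads from one extreme to the other through the common end value.
  have key : ∃ A, MeasurableSet A ∧ A ⊆ Icc u v ∧ X' ⊆ f '' A ∧ X' ⊆ f '' (Icc u v \ A) := by
    rcases le_total tm tM with h | h
    · refine ⟨Icc tm tM, measurableSet_Icc, Icc_subset_Icc htm.1 htM.2, ?_, ?_⟩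
      · intro x hx
        exact intermediate_value_Icc h hc.continuousOn ⟨(hX' x hx).1.le, (hX' x hx).2.le⟩
      · intro x hx
        rcases le_total x (f u) with hxu | hxu
        · obtain ⟨t, ht, rfl⟩ := intermediate_value_Icc' htm.1 hc.continuousOn
            (show x ∈ Icc (f tm) (f u) from ⟨(hX' x hx).1.le, hxu⟩)
          refine ⟨t, ⟨⟨ht.1, ht.2.trans htm.2⟩, fun h' => ?_⟩, rfl⟩
          rw [le_antisymm ht.2 h'.1] at hx
          exact lt_irrefl _ (hX' _ hx).1
        · obtain ⟨t, ht, rfl⟩ := intermediate_value_Icc' htM.2 hc.continuousOn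
            (show x ∈ Icc (f v) (f tM) from ⟨he ▸ hxu, (hX' x hx).2.le⟩)
          refine ⟨t, ⟨⟨htM.1.trans ht.1, ht.2⟩, fun h' => ?_⟩, rfl⟩
          rw [le_antisymm h'.2 ht.1] at hx
          exact lt_irrefl _ (hX' _ hx).2
    · refine ⟨Icc tM tm, measurableSet_Icc, Icc_subset_Icc htM.1 htm.2, ?_, ?_⟩
      · intro x hx
        exact intermediate_value_Icc' h hc.continuousOn ⟨(hX' x hx).1.le, (hX' x hx).2.le⟩
      · intro x hx
        rcases le_total x (f u) with hxu | hxu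
        · obtain ⟨t, ht, rfl⟩ := intermediate_value_Icc htm.2 hc.continuousOn
            (show x ∈ Icc (f tm) (f v) from ⟨(hX' x hx).1.le, he ▸ hxu⟩)
          refine ⟨t, ⟨⟨htm.1.trans ht.1, ht.2⟩, fun h' => ?_⟩, rfl⟩
          rw [le_antisymm h'.2 ht.1] at hx
          exact lt_irrefl _ (hX' _ hx).1
        · obtain ⟨t, ht, rfl⟩ := intermediate_value_Icc htM.1 hc.continuousOn
            (show x ∈ Icc (f u) (f tM) from ⟨hxu, (hX' x hx).2.le⟩)
          refine ⟨t, ⟨⟨ht.1, ht.2.trans htM.2⟩, fun h' => ?_⟩, rfl⟩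
          rw [le_antisymm ht.2 h'.1] at hx
          exact lt_irrefl _ (hX' _ hx).2
  obtain ⟨A, hAm, hA, h1, h2⟩ := key
  calc 2 * volume X = volume X' + volume X' := by rw [hvol, two_mul]
    _ ≤ volume (A ∩ f ⁻¹' X') + volume ((Icc u v \ A) ∩ f ⁻¹' X') :=
        add_le_add (hf.volume_le_of_subset_image h1) (hf.volume_le_of_subset_image h2)
    _ ≤ volume ((Icc u v ∩ f ⁻¹' X) ∩ A) + volume ((Icc u v ∩ f ⁻¹' X) \ A) := by
        refine add_le_add (measure_mono ?_) (measure_mono ?_)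
        · rintro t ⟨ht, ht'⟩; exact ⟨⟨hA ht, ht'.1⟩, ht⟩
        · rintro t ⟨ht, ht'⟩; exact ⟨⟨ht.1, ht'.1⟩, ht.2⟩
    _ = volume (Icc u v ∩ f ⁻¹' X) := measure_inter_add_sdiff _ hAm

/-- Consecutive passes share only the times `t₂` and `t₃`; removing their values, a null set, makes
the times spent in the three passes disjoint. -/
lemma LipschitzWith.three_mul_volume_le {f : ℝ → ℝ} (hf : LipschitzWith 1 f) {u v t₁ t₂ t₃ t₄ : ℝ}
    (h₁ : u ≤ t₁) (h₁₂ : t₁ ≤ t₂) (h₂₃ : t₂ ≤ t₃) (h₃₄ : t₃ ≤ t₄) (h₄ : t₄ ≤ v) {X : Set ℝ}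
    (hX₁ : X ⊆ uIcc (f t₁) (f t₂)) (hX₂ : X ⊆ uIcc (f t₂) (f t₃))
    (hX₃ : X ⊆ uIcc (f t₃) (f t₄)) : 3 * volume X ≤ volume (Icc u v ∩ f ⁻¹' X) := by
  set X' := X \ {f t₂, f t₃}
  have hvol : volume X' = volume X :=
    measure_sdiff_null ((finite_singleton _).insert _ |>.measure_zero _)
  have key : ∀ {s t}, s ≤ t → X ⊆ uIcc (f s) (f t) → X' ⊆ f '' Icc s t := by
    intro s t hst h x hx
    have := intermediate_value_uIcc (hf.continuous.continuousOn (s := uIcc s t)) (h hx.1)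
    rwa [uIcc_of_le hst] at this
  have e1 := hf.volume_le_of_subset_image (key h₁₂ hX₁)
  have e2 := hf.volume_le_of_subset_image (key h₂₃ hX₂)
  have e3 := hf.volume_le_of_subset_image (key h₃₄ hX₃)
  calc 3 * volume X = volume X' + (volume X' + volume X') := by rw [hvol]; ring
    _ ≤ volume (Icc t₁ t₂ ∩ f ⁻¹' X') + (volume (Icc t₂ t₃ ∩ f ⁻¹' X') +
          volume (Icc t₃ t₄ ∩ f ⁻¹' X')) := by gcongr
    _ ≤ volume ((Icc u v ∩ f ⁻¹' X) ∩ Iio t₂) + (volume (((Icc u v ∩ f ⁻¹' X) \ Iio t₂) ∩ Iio t₃) +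
          volume (((Icc u v ∩ f ⁻¹' X) \ Iio t₂) \ Iio t₃)) := by
        refine add_le_add (measure_mono ?_) (add_le_add (measure_mono ?_) (measure_mono ?_))
        · rintro t ⟨ht, ht'⟩
          refine ⟨⟨⟨h₁.trans ht.1, by linarith [ht.2]⟩, ht'.1⟩, lt_of_le_of_ne ht.2 ?_⟩
          rintro rfl; exact ht'.2 (.inl rfl)
        · rintro t ⟨ht, ht'⟩
          refine ⟨⟨⟨⟨by linarith [ht.1], by linarith [ht.2]⟩, ht'.1⟩, not_lt.2 ht.1⟩,
            lt_of_le_of_ne ht.2 ?_⟩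
          rintro rfl; exact ht'.2 (.inr rfl)
        · rintro t ⟨ht, ht'⟩
          exact ⟨⟨⟨⟨by linarith [ht.1], by linarith [ht.2]⟩, ht'.1⟩, not_lt.2 (h₂₃.trans ht.1)⟩,
            not_lt.2 ht.1⟩
    _ = volume (Icc u v ∩ f ⁻¹' X) := by
        rw [measure_inter_add_sdiff _ measurableSet_Iio, measure_inter_add_sdiff _ measurableSet_Iio]

end RealLipschitz

/-- `g` is a unit speed path during the time interval `[u, v]`. -/
def IsUnitSpeedOn {Q : Type*} [MetricSpace Q] (g : ℝ → Q) (u v : ℝ) : Prop :=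
  ∀ t ∈ Icc u v, ∀ t' ∈ Icc u v, dist (g t) (g t') ≤ |t - t'|

lemma IsUnitSpeedOn.exists_extension {Q : Type*} [MetricSpace Q] {g : ℝ → Q} {u v : ℝ}
    (hg : IsUnitSpeedOn g u v) (huv : u ≤ v) :
    ∃ G : ℝ → Q, LipschitzWith 1 G ∧ EqOn G g (Icc u v) := by
  refine ⟨fun t => g (projIcc u v huv t), LipschitzWith.of_dist_le_mul fun s t => ?_,
    fun t ht => by simp [projIcc_of_mem huv ht]⟩
  refine (hg _ (projIcc u v huv s).2 _ (projIcc u v huv t).2).trans ?_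
  have := (LipschitzWith.projIcc huv).dist_le_mul s t
  simpa [Subtype.dist_eq, Real.dist_eq] using this

lemma IsUnitSpeedOn.continuousOn {Q : Type*} [MetricSpace Q] {g : ℝ → Q} {u v : ℝ}
    (hg : IsUnitSpeedOn g u v) : ContinuousOn g (Icc u v) := by
  have : LipschitzOnWith 1 g (Icc u v) :=
    LipschitzOnWith.of_dist_le_mul fun x hx y hy => by
      simpa [Real.dist_eq] using hg x hx y hy
  exact this.continuousOn

lemma IsUnitSpeedOn.mono {Q : Type*} [MetricSpace Q] {g : ℝ → Q} {u v u' v' : ℝ}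
    (hg : IsUnitSpeedOn g u v) (hu : u ≤ u') (hv : v' ≤ v) : IsUnitSpeedOn g u' v' :=
  fun t ht t' ht' => hg t (Icc_subset_Icc hu hv ht) t' (Icc_subset_Icc hu hv ht')

/-! ### The length measure and lower bounds for the length of tours -/

namespace Network

variable {Q : Type*} [MetricSpace Q] (N : Network Q)

lemma lam_nonneg (Y : Set Q) : 0 ≤ N.lam Y := Finset.sum_nonneg fun _ _ => measureReal_nonneg

lemma volume_inter_ne_top (a : N.Arc) (Y : Set Q) :
    volume (Ioo 0 (N.len a) ∩ N.param a ⁻¹' Y) ≠ ⊤ :=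
  measure_ne_top_of_subset inter_subset_left (by simp)

lemma lam_mono {Y Y' : Set Q} (h : Y ⊆ Y') : N.lam Y ≤ N.lam Y' :=
  Finset.sum_le_sum fun a _ => measureReal_mono
    (inter_subset_inter_right _ (preimage_mono h)) (N.volume_inter_ne_top a _)

lemma lam_eq_toReal (Y : Set Q) :
    N.lam Y = (∑ a, volume (Ioo 0 (N.len a) ∩ N.param a ⁻¹' Y)).toReal := by
  rw [ENNReal.toReal_sum fun a _ => N.volume_inter_ne_top a Y]; rfl

/-- The length measure as a Borel measure. -/
noncomputable def lengthMeasure [MeasurableSpace Q] : Measure Q :=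
  ∑ a, (volume.restrict (Ioo 0 (N.len a))).map (N.param a)

lemma lengthMeasure_apply [MeasurableSpace Q] [BorelSpace Q] {Y : Set Q} (hY : MeasurableSet Y) :
    N.lengthMeasure Y = ∑ a, volume (Ioo 0 (N.len a) ∩ N.param a ⁻¹' Y) := by
  rw [lengthMeasure, Measure.finsetSum_apply]
  refine Finset.sum_congr rfl fun a _ => ?_
  have hm : AEMeasurable (N.param a) (volume.restrict (Ioo 0 (N.len a))) :=
    ((N.continuousOn_param a).mono Ioo_subset_Icc_self).aemeasurable measurableSet_Ioo
  rw [Measure.map_apply_of_aemeasurable hm hY, Measure.restrict_apply' measurableSet_Ioo,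
    inter_comm]

lemma lam_eq_lengthMeasure [MeasurableSpace Q] [BorelSpace Q] {Y : Set Q} (hY : MeasurableSet Y) :
    N.lam Y = N.lengthMeasure.real Y := by
  rw [lam_eq_toReal, measureReal_def, N.lengthMeasure_apply hY]

instance [MeasurableSpace Q] [BorelSpace Q] : IsFiniteMeasure N.lengthMeasure := by
  refine ⟨?_⟩
  rw [N.lengthMeasure_apply MeasurableSet.univ]
  exact ENNReal.sum_lt_top.2 fun a _ => (N.volume_inter_ne_top a _).lt_top

lemma lam_of_finite {Y : Set Q} (hY : Y.Finite) : N.lam Y = 0 := by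
  refine Finset.sum_eq_zero fun a _ => ?_
  have : (Ioo 0 (N.len a) ∩ N.param a ⁻¹' Y).Finite := by
    refine Set.Finite.of_finite_image (f := N.param a) (hY.subset ?_)
      ((N.param_injOn a).mono inter_subset_left)
    rintro _ ⟨s, hs, rfl⟩; exact hs.2
  rw [measureReal_def, this.measure_zero]; rfl

lemma lam_univ_eq : N.mu = ∑ a, N.len a := by
  refine Finset.sum_congr rfl fun a _ => ?_
  simp [measureReal_def, (N.len_pos a).le]

variable {N} (hN : N.IsTree)

include hN in
/-- The time spent in arc `a` by different arcs is disjoint. -/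
lemma IsTree.sum_volume_le {g : ℝ → Q} (hg : LipschitzWith 1 g) (u v : ℝ) :
    ∑ a, volume (Icc u v ∩ (N.coord a ∘ g) ⁻¹' Ioo 0 (N.len a)) ≤ ENNReal.ofReal (v - u) := by
  have hm : ∀ a, MeasurableSet (Icc u v ∩ (N.coord a ∘ g) ⁻¹' Ioo 0 (N.len a)) := fun a =>
    measurableSet_Icc.inter
      (isOpen_Ioo.preimage ((hN.continuous_coord a).comp hg.continuous)).measurableSet
  rw [← Real.volume_Icc, ← measure_biUnion_finset ?_ fun a _ => hm a]
  · exact measure_mono (iUnion₂_subset fun a _ => inter_subset_left)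
  · intro a _ b _ hab
    rw [Function.onFun, disjoint_left]
    rintro t ⟨-, ha⟩ ⟨-, hb⟩
    exact hab (N.openArc_unique (x := g t) ⟨_, ha, N.param_coord a ha⟩ ⟨_, hb, N.param_coord b hb⟩)

include hN in
lemma IsTree.lipschitzWith_coord_comp {g : ℝ → Q} (hg : LipschitzWith 1 g) (a : N.Arc) :
    LipschitzWith 1 (N.coord a ∘ g) := by
  simpa using (hN.lipschitzWith_coord a).comp hg

include hN in
lemma IsTree.two_mul_volume_le {g : ℝ → Q} (hg : LipschitzWith 1 g) {u v : ℝ} (huv : u ≤ v)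
    (he : g u = g v) (a : N.Arc) {X : Set ℝ} (hX : X ⊆ Ioo 0 (N.len a))
    (hX' : ∀ s ∈ X, N.param a s ∈ g '' Icc u v) :
    2 * volume X ≤ volume (Icc u v ∩ (N.coord a ∘ g) ⁻¹' X) := by
  refine (hN.lipschitzWith_coord_comp hg a).two_mul_volume_le huv (by simp [he]) ?_
  intro s hs
  obtain ⟨t, ht, hts⟩ := hX' s hs
  exact ⟨t, ht, by simp [hts, N.coord_param_of_mem_Ioo a (hX hs)]⟩

include hN in
/-- A closed unit speed path takes at least twice the length of its image. -/
lemma IsTree.two_mul_lam_image_le {g : ℝ → Q} {u v : ℝ} (hg : IsUnitSpeedOn g u v) (huv : u ≤ v)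
    (he : g u = g v) : 2 * N.lam (g '' Icc u v) ≤ v - u := by
  obtain ⟨G, hG, hGg⟩ := hg.exists_extension huv
  rw [← hGg.image_eq]
  have he' : G u = G v := by rw [hGg ⟨le_rfl, huv⟩, hGg ⟨huv, le_rfl⟩, he]
  have h : 2 * ∑ a, volume (Ioo 0 (N.len a) ∩ N.param a ⁻¹' (G '' Icc u v)) ≤
      ENNReal.ofReal (v - u) := by
    refine le_trans ?_ (hN.sum_volume_le hG u v)
    rw [Finset.mul_sum]
    refine Finset.sum_le_sum fun a _ => ?_
    refine (hN.two_mul_volume_le hG huv he' a inter_subset_left fun s hs => hs.2).trans ?_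
    gcongr
    exact inter_subset_left
  have := ENNReal.toReal_mono ENNReal.ofReal_ne_top h
  rwa [ENNReal.toReal_mul, ← lam_eq_toReal, ENNReal.toReal_ofReal (by linarith)] at this

include hN in
/-- A tour of minimal length does not pass three times through an interval of an arc. -/
lemma IsTree.lt_of_three_passes {S : ℝ → Q} {L : ℝ} (hS : IsTourOf univ S L) {a : N.Arc}
    {t₁ t₂ t₃ t₄ s₁ s₂ : ℝ} (h₁ : 0 ≤ t₁) (h₁₂ : t₁ ≤ t₂) (h₂₃ : t₂ ≤ t₃) (h₃₄ : t₃ ≤ t₄)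
    (h₄ : t₄ ≤ L) (hs : s₁ < s₂)
    (hX₁ : Ioo s₁ s₂ ⊆ uIcc (N.coord a (S t₁)) (N.coord a (S t₂)))
    (hX₂ : Ioo s₁ s₂ ⊆ uIcc (N.coord a (S t₂)) (N.coord a (S t₃)))
    (hX₃ : Ioo s₁ s₂ ⊆ uIcc (N.coord a (S t₃)) (N.coord a (S t₄))) : 2 * N.mu < L := by
  classical
  obtain ⟨⟨hL, hg, he⟩, himg⟩ := hS
  obtain ⟨G, hG, hGg⟩ := IsUnitSpeedOn.exists_extension hg hL
  rw [← hGg.image_eq] at himg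
  have he' : G 0 = G L := by rw [hGg ⟨le_rfl, hL⟩, hGg ⟨hL, le_rfl⟩, he]
  have hmem : ∀ t, 0 ≤ t → t ≤ L → G t = S t := fun t h h' => hGg ⟨h, h'⟩
  rw [← hmem t₁ (by linarith) (by linarith), ← hmem t₂ (by linarith) (by linarith)] at hX₁
  rw [← hmem t₂ (by linarith) (by linarith), ← hmem t₃ (by linarith) (by linarith)] at hX₂
  rw [← hmem t₃ (by linarith) (by linarith), ← hmem t₄ (by linarith) (by linarith)] at hX₃
  have hlen : Ioo s₁ s₂ ⊆ Ioo 0 (N.len a) := by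
    have hsub : Ioo s₁ s₂ ⊆ Icc 0 (N.len a) :=
      hX₁.trans (ordConnected_Icc.uIcc_subset (N.coord_mem a _) (N.coord_mem a _))
    exact (interior_maximal hsub isOpen_Ioo).trans interior_Icc.subset
  have h3 : 3 * volume (Ioo s₁ s₂) ≤ volume (Icc 0 L ∩ (N.coord a ∘ G) ⁻¹' Ioo s₁ s₂) :=
    (hN.lipschitzWith_coord_comp hG a).three_mul_volume_le h₁ h₁₂ h₂₃ h₃₄ h₄ hX₁ hX₂ hX₃
  have hcov : ∀ y, y ∈ G '' Icc 0 L := fun y => himg ▸ mem_univ y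
  have h2 : 2 * volume (Ioo 0 (N.len a) \ Ioo s₁ s₂) ≤
      volume (Icc 0 L ∩ (N.coord a ∘ G) ⁻¹' (Ioo 0 (N.len a) \ Ioo s₁ s₂)) :=
    hN.two_mul_volume_le hG hL he' a sdiff_subset fun s _ => hcov _
  have hm : MeasurableSet ((N.coord a ∘ G) ⁻¹' Ioo s₁ s₂) :=
    (isOpen_Ioo.preimage ((hN.continuous_coord a).comp hG.continuous)).measurableSet
  -- Each arc costs twice its length, and the third pass adds `s₂ - s₁` on the arc `a`. Summing over
  -- the arcs makes the final inequality strict.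
  have ha : 2 * ENNReal.ofReal (N.len a) + ENNReal.ofReal (s₂ - s₁) ≤
      volume (Icc 0 L ∩ (N.coord a ∘ G) ⁻¹' Ioo 0 (N.len a)) := by
    rw [← measure_inter_add_sdiff _ hm]
    have e1 : ENNReal.ofReal (N.len a) = volume (Ioo s₁ s₂) + volume (Ioo 0 (N.len a) \ Ioo s₁ s₂) := by
      have := measure_inter_add_sdiff (μ := volume) (Ioo 0 (N.len a))
        (measurableSet_Ioo (a := s₁) (b := s₂))
      rw [inter_eq_right.2 hlen] at this
      rw [this]
      simp
    rw [e1, ← Real.volume_Ioo]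
    calc _ = 3 * volume (Ioo s₁ s₂) + 2 * volume (Ioo 0 (N.len a) \ Ioo s₁ s₂) := by ring
      _ ≤ _ := by
        refine add_le_add (h3.trans (measure_mono ?_)) (h2.trans (measure_mono ?_))
        · rintro t ⟨ht, ht'⟩; exact ⟨⟨ht, hlen ht'⟩, ht'⟩
        · rintro t ⟨ht, ht'⟩; exact ⟨⟨ht, ht'.1⟩, ht'.2⟩
  have hb : ∀ b, 2 * ENNReal.ofReal (N.len b) ≤
      volume (Icc 0 L ∩ (N.coord b ∘ G) ⁻¹' Ioo 0 (N.len b)) := by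
    intro b
    have := hN.two_mul_volume_le hG hL he' b (subset_refl (Ioo 0 (N.len b))) fun s _ => hcov _
    rwa [Real.volume_Ioo, sub_zero] at this
  have htot : ∑ b, 2 * ENNReal.ofReal (N.len b) + ENNReal.ofReal (s₂ - s₁) ≤
      ENNReal.ofReal (L - 0) := by
    refine le_trans ?_ (hN.sum_volume_le hG 0 L)
    rw [← Finset.add_sum_erase _ _ (Finset.mem_univ a),
      ← Finset.add_sum_erase Finset.univ
        (fun b => volume (Icc 0 L ∩ (N.coord b ∘ G) ⁻¹' Ioo 0 (N.len b))) (Finset.mem_univ a),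
      add_right_comm]
    exact add_le_add ha (Finset.sum_le_sum fun b _ => hb b)
  rw [← Finset.mul_sum, ← ENNReal.ofReal_sum_of_nonneg fun b _ => (N.len_pos b).le,
    ← N.lam_univ_eq, sub_zero] at htot
  have hmu : 0 ≤ N.mu := N.lam_nonneg _
  have := ENNReal.toReal_mono ENNReal.ofReal_ne_top htot
  rw [ENNReal.toReal_add (by finiteness) (by finiteness), ENNReal.toReal_mul,
    ENNReal.toReal_ofReal hmu, ENNReal.toReal_ofReal (by linarith), ENNReal.toReal_ofReal hL] at this
  simp at this
  linarith

end Network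

/-! ### Inserting loops into a path -/

section Insertion

variable {k : ℕ} {s ℓ : Fin k → ℝ} {L : ℝ}

open Classical in
/-- The time in a path with inserted loops of duration `ℓ i` at times `s i` which corresponds to the
time `t` of the original path. -/
noncomputable def insertShift (s ℓ : Fin k → ℝ) (t : ℝ) : ℝ := t + ∑ i with s i < t, ℓ i

lemma le_insertShift (hℓ : ∀ j, 0 ≤ ℓ j) (t : ℝ) : t ≤ insertShift s ℓ t := by
  have : 0 ≤ ∑ i with s i < t, ℓ i := Finset.sum_nonneg fun i _ => hℓ i
  rw [insertShift]; linarith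

lemma sub_le_insertShift_sub (hℓ : ∀ j, 0 ≤ ℓ j) {t t' : ℝ} (h : t ≤ t') :
    t' - t ≤ insertShift s ℓ t' - insertShift s ℓ t := by
  have : ∑ i with s i < t, ℓ i ≤ ∑ i with s i < t', ℓ i := by
    refine Finset.sum_le_sum_of_subset_of_nonneg (fun i hi => ?_) fun i _ _ => hℓ i
    simp only [Finset.mem_filter, Finset.mem_univ, true_and] at hi ⊢
    linarith
  simp only [insertShift]; linarith

lemma insertShift_lt (hℓ : ∀ j, 0 ≤ ℓ j) {t t' : ℝ} (h : t < t') :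
    insertShift s ℓ t < insertShift s ℓ t' := by
  linarith [sub_le_insertShift_sub (s := s) hℓ h.le]

lemma insertShift_add_le (hℓ : ∀ j, 0 ≤ ℓ j) {j : Fin k} {t : ℝ} (h : s j < t) :
    insertShift s ℓ (s j) + ℓ j + (t - s j) ≤ insertShift s ℓ t := by
  have : ℓ j + ∑ i with s i < s j, ℓ i ≤ ∑ i with s i < t, ℓ i := by
    rw [← Finset.sum_insert (by simp)]
    refine Finset.sum_le_sum_of_subset_of_nonneg (fun i hi => ?_) fun i _ _ => hℓ i
    simp only [Finset.mem_insert, Finset.mem_filter, Finset.mem_univ, true_and] at hi ⊢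
    rcases hi with rfl | hi <;> linarith
  simp only [insertShift]; linarith

lemma insertShift_le (hℓ : ∀ j, 0 ≤ ℓ j) (t : ℝ) : insertShift s ℓ t ≤ t + ∑ i, ℓ i := by
  have : ∑ i with s i < t, ℓ i ≤ ∑ i, ℓ i :=
    Finset.sum_le_sum_of_subset_of_nonneg (Finset.filter_subset _ _) fun i _ _ => hℓ i
  simp only [insertShift]; linarith

lemma insertShift_add_le_add_sum (hℓ : ∀ j, 0 ≤ ℓ j) (j : Fin k) :
    insertShift s ℓ (s j) + ℓ j ≤ s j + ∑ i, ℓ i := by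
  have : ℓ j + ∑ i with s i < s j, ℓ i ≤ ∑ i, ℓ i := by
    rw [← Finset.sum_insert (by simp)]
    exact Finset.sum_le_sum_of_subset_of_nonneg (Finset.subset_univ _) fun i _ _ => hℓ i
  simp only [insertShift]; linarith

lemma insertShift_zero (hs : ∀ j, 0 ≤ s j) : insertShift s ℓ 0 = 0 := by
  simp [insertShift, Finset.filter_false_of_mem fun i _ => not_lt.2 (hs i)]

/-- Every moment of the extended time belongs either to the original path or to an inserted loop. -/
lemma exists_insertShift_eq (hℓ : ∀ j, 0 ≤ ℓ j) (hs : ∀ j, s j ∈ Icc 0 L)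
    (hinj : Function.Injective s) {τ : ℝ} (hτ : τ ∈ Icc 0 (L + ∑ i, ℓ i)) :
    (∃ t ∈ Icc 0 L, τ = insertShift s ℓ t) ∨
      ∃ j, ∃ u ∈ Icc 0 (ℓ j), τ = insertShift s ℓ (s j) + u := by
  classical
  by_contra! hcon
  obtain ⟨hno, hcopy⟩ := hcon
  -- `A` consists of the loops completed before `τ`. If `τ` is in no loop, they are the ones
  -- inserted before `t = τ - ∑ i ∈ A, ℓ i`; the last loop in `A` and the first loop outside `A`
  -- give the two bounds.
  set A : Finset (Fin k) := Finset.univ.filter fun i => insertShift s ℓ (s i) + ℓ i < τ with hA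
  have hAmem : ∀ i, i ∈ A ↔ insertShift s ℓ (s i) + ℓ i < τ := fun i => by simp [hA]
  have hAnot : ∀ i, i ∉ A → τ < insertShift s ℓ (s i) := by
    intro i hi
    rw [hAmem, not_lt] at hi
    by_contra! hc
    exact hcopy i (τ - insertShift s ℓ (s i)) ⟨by linarith, by linarith⟩ (by ring)
  have hlt : ∀ i ∈ A, ∀ j ∉ A, s i < s j := by
    intro i hi j hj
    rw [hAmem] at hi
    have := hAnot j hj
    by_contra! hc
    linarith [sub_le_insertShift_sub (s := s) hℓ hc, hℓ i]
  set t := τ - ∑ i ∈ A, ℓ i with ht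
  have h1 : ∀ i ∈ A, s i < t := by
    intro i hi
    obtain ⟨m, hm, hmax⟩ := A.exists_max_image s ⟨i, hi⟩
    have e : insert m (Finset.univ.filter fun j => s j < s m) = A := by
      ext j
      simp only [Finset.mem_insert, Finset.mem_filter, Finset.mem_univ, true_and]
      constructor
      · rintro (rfl | h)
        · exact hm
        · by_contra hj
          exact lt_asymm h (hlt m hm j hj)
      · intro hj
        rcases eq_or_lt_of_le (hmax j hj) with h | h
        exacts [.inl (hinj h), .inr h]
    have hm' := (hAmem m).1 hm
    rw [insertShift] at hm'
    have : ∑ i ∈ A, ℓ i = ℓ m + ∑ i with s i < s m, ℓ i := by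
      rw [← e, Finset.sum_insert (by simp)]
    linarith [hmax i hi]
  have h2 : ∀ i ∉ A, t < s i := by
    intro i hi
    obtain ⟨m, hm, hmin⟩ := (Aᶜ).exists_min_image s ⟨i, by simpa using hi⟩
    rw [Finset.mem_compl] at hm
    have e : (Finset.univ.filter fun j => s j < s m) = A := by
      ext j
      simp only [Finset.mem_filter, Finset.mem_univ, true_and]
      constructor
      · intro h
        by_contra hj
        exact absurd (hmin j (by simpa using hj)) (not_le.2 h)
      · exact fun hj => hlt j hj m hm
    have hm' := hAnot m hm
    have : insertShift s ℓ (s m) = s m + ∑ i ∈ A, ℓ i := by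
      rw [insertShift, ← e]
    linarith [hmin i (by simpa using hi)]
  have e : (Finset.univ.filter fun j => s j < t) = A := by
    ext j
    simp only [Finset.mem_filter, Finset.mem_univ, true_and]
    constructor
    · intro h
      by_contra hj
      exact lt_asymm h (h2 j hj)
    · exact h1 j
  refine hno t ⟨?_, ?_⟩ (by rw [insertShift, e]; linarith)
  · rcases A.eq_empty_or_nonempty with h | ⟨i, hi⟩
    · rw [ht, h]; simpa using hτ.1
    · exact (hs i).1.trans (h1 i hi).le
  · by_cases h : ∃ i, i ∉ A
    · obtain ⟨i, hi⟩ := h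
      exact (h2 i hi).le.trans (hs i).2
    · push Not at h
      rw [ht, Finset.eq_univ_iff_forall.2 h]
      linarith [hτ.2]

/-- `U` arises from the path `T` by inserting the loops `c j` of duration `ℓ j` at the times
`s j`. -/
structure IsInsertion {Q : Type*} (T : ℝ → Q) (L : ℝ) (s ℓ : Fin k → ℝ) (c : Fin k → ℝ → Q)
    (U : ℝ → Q) : Prop where
  nonneg : ∀ j, 0 ≤ ℓ j
  mem_Icc : ∀ j, s j ∈ Icc 0 L
  injective : Function.Injective s
  start : ∀ j, c j 0 = T (s j)
  finish : ∀ j, c j (ℓ j) = T (s j)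
  base : ∀ t ∈ Icc 0 L, U (insertShift s ℓ t) = T t
  loop : ∀ j, ∀ u ∈ Icc 0 (ℓ j), U (insertShift s ℓ (s j) + u) = c j u

variable {Q : Type*} {T U : ℝ → Q} {c : Fin k → ℝ → Q}

lemma exists_isInsertion (hℓ : ∀ j, 0 ≤ ℓ j) (hs : ∀ j, s j ∈ Icc 0 L)
    (hinj : Function.Injective s) (hc : ∀ j, c j 0 = T (s j)) (hc' : ∀ j, c j (ℓ j) = T (s j)) :
    ∃ U, IsInsertion T L s ℓ c U := by
  classical
  -- Together with the injectivity of `s`, this makes the time intervals of different loops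
  -- disjoint, so that the choices in `U` are unambiguous.
  have hcopy : ∀ i j, ∀ u ∈ Icc 0 (ℓ i), ∀ v ∈ Icc 0 (ℓ j),
      insertShift s ℓ (s i) + u = insertShift s ℓ (s j) + v → s i ≤ s j := by
    intro i j u hu v hv h
    by_contra! hlt
    linarith [insertShift_add_le hℓ hlt, hu.1, hv.2]
  set U : ℝ → Q := fun τ => if h : ∃ j, ∃ u ∈ Icc 0 (ℓ j), τ = insertShift s ℓ (s j) + u
    then c h.choose h.choose_spec.choose
    else if h : ∃ t ∈ Icc 0 L, τ = insertShift s ℓ t then T h.choose else T 0 with hU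
  have hloop : ∀ j, ∀ u ∈ Icc 0 (ℓ j), U (insertShift s ℓ (s j) + u) = c j u := by
    intro j u hu
    have h : ∃ i, ∃ v ∈ Icc 0 (ℓ i), insertShift s ℓ (s j) + u = insertShift s ℓ (s i) + v :=
      ⟨j, u, hu, rfl⟩
    simp only [hU, dif_pos h]
    set i := h.choose with hi
    obtain ⟨hv, he⟩ := h.choose_spec.choose_spec
    set v := h.choose_spec.choose with hv'
    have hij : i = j := hinj (le_antisymm (hcopy i j v hv u hu he.symm) (hcopy j i u hu v hv he))
    have : v = u := by rw [← hi, hij] at he; linarith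
    rw [this, ← hi, hij]
  refine ⟨U, hℓ, hs, hinj, hc, hc', ?_, hloop⟩
  intro t ht
  -- A base time falls into a loop interval only at the start of the loop: `insertShift` counts only
  -- the loops inserted strictly earlier.
  by_cases h : ∃ j, ∃ u ∈ Icc 0 (ℓ j), insertShift s ℓ t = insertShift s ℓ (s j) + u
  · obtain ⟨j, u, hu, he⟩ := h
    have h1 : t ≤ s j := by
      by_contra! hlt
      linarith [insertShift_add_le hℓ hlt, hu.2]
    have h2 : s j ≤ t := by
      by_contra! hlt
      linarith [insertShift_lt (s := s) hℓ hlt, hu.1]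
    obtain rfl := le_antisymm h1 h2
    have hu0 : u = 0 := by linarith
    rw [he, hloop j u hu, hu0, hc j]
  · have h' : ∃ t' ∈ Icc 0 L, insertShift s ℓ t = insertShift s ℓ t' := ⟨t, ht, rfl⟩
    simp only [hU, dif_neg h, dif_pos h']
    congr 1
    obtain ⟨-, he⟩ := h'.choose_spec
    rcases lt_trichotomy h'.choose t with hl | hl | hl
    · linarith [insertShift_lt (s := s) hℓ hl]
    · exact hl
    · linarith [insertShift_lt (s := s) hℓ hl]

namespace IsInsertion

lemma exists_time (h : IsInsertion T L s ℓ c U) {τ : ℝ} (hτ : τ ∈ Icc 0 (L + ∑ i, ℓ i)) :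
    (∃ t ∈ Icc 0 L, τ = insertShift s ℓ t) ∨
      ∃ j, ∃ u ∈ Icc 0 (ℓ j), τ = insertShift s ℓ (s j) + u :=
  exists_insertShift_eq h.nonneg h.mem_Icc h.injective hτ

lemma insertShift_mem (h : IsInsertion T L s ℓ c U) {t : ℝ} (ht : t ∈ Icc 0 L) :
    insertShift s ℓ t ∈ Icc 0 (L + ∑ i, ℓ i) :=
  ⟨ht.1.trans (le_insertShift h.nonneg t), (insertShift_le h.nonneg t).trans (by linarith [ht.2])⟩

lemma insertShift_add_mem (h : IsInsertion T L s ℓ c U) {j : Fin k} {u : ℝ}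
    (hu : u ∈ Icc 0 (ℓ j)) : insertShift s ℓ (s j) + u ∈ Icc 0 (L + ∑ i, ℓ i) :=
  ⟨add_nonneg (h.insertShift_mem (h.mem_Icc j)).1 hu.1, by
    linarith [insertShift_add_le_add_sum (s := s) h.nonneg j, (h.mem_Icc j).2, hu.2]⟩

lemma image_eq (h : IsInsertion T L s ℓ c U) :
    U '' Icc 0 (L + ∑ i, ℓ i) = T '' Icc 0 L ∪ ⋃ j, c j '' Icc 0 (ℓ j) := by
  ext x
  simp only [mem_union, mem_iUnion]
  constructor
  · rintro ⟨τ, hτ, rfl⟩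
    rcases h.exists_time hτ with ⟨t, ht, rfl⟩ | ⟨j, u, hu, rfl⟩
    · exact .inl ⟨t, ht, (h.base t ht).symm⟩
    · exact .inr ⟨j, u, hu, (h.loop j u hu).symm⟩
  · rintro (⟨t, ht, rfl⟩ | ⟨j, u, hu, rfl⟩)
    · exact ⟨_, h.insertShift_mem ht, h.base t ht⟩
    · exact ⟨_, h.insertShift_add_mem hu, h.loop j u hu⟩

lemma apply_zero (h : IsInsertion T L s ℓ c U) (hL : 0 ≤ L) : U 0 = T 0 := by
  have := h.base 0 ⟨le_rfl, hL⟩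
  rwa [insertShift_zero fun j => (h.mem_Icc j).1] at this

/-- A loop inserted exactly at time `L` is not counted by `insertShift s ℓ L`; in that case the end
of the extended path is the end of this loop. -/
lemma apply_length (h : IsInsertion T L s ℓ c U) (hL : 0 ≤ L) : U (L + ∑ i, ℓ i) = T L := by
  classical
  by_cases hex : ∃ j, s j = L
  · obtain ⟨j, hj⟩ := hex
    have e : insertShift s ℓ (s j) + ℓ j = L + ∑ i, ℓ i := by
      have : Finset.univ = insert j (Finset.univ.filter fun i => s i < s j) := by
        ext i
        simp only [Finset.mem_univ, Finset.mem_insert, Finset.mem_filter, true_and, true_iff]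
        rcases eq_or_lt_of_le ((h.mem_Icc i).2.trans_eq hj.symm) with h' | h'
        exacts [.inl (h.injective h'), .inr h']
      rw [this, Finset.sum_insert (by simp), insertShift, hj]
      ring
    rw [← e, h.loop j _ ⟨h.nonneg j, le_rfl⟩, h.finish, hj]
  · push Not at hex
    have e : insertShift s ℓ L = L + ∑ i, ℓ i := by
      rw [insertShift, Finset.filter_true_of_mem]
      exact fun i _ => lt_of_le_of_ne (h.mem_Icc i).2 (hex i)
    rw [← e, h.base L ⟨hL, le_rfl⟩]

lemma isClosedUnitSpeedPath [MetricSpace Q] (h : IsInsertion T L s ℓ c U)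
    (hT : IsClosedUnitSpeedPath T L) (hc : ∀ j, IsClosedUnitSpeedPath (c j) (ℓ j)) :
    IsClosedUnitSpeedPath U (L + ∑ i, ℓ i) := by
  have hL := hT.1
  have hℓ := h.nonneg
  refine ⟨add_nonneg hL (Finset.sum_nonneg fun i _ => hℓ i), ?_, ?_⟩
  -- Each time is a base time `t` plus the time `u` already spent in a loop, with `w` remaining.
  -- Both `u` and `w` bound the distance from `T t`, so two times with different base times are
  -- compared through their base points.
  · have rep : ∀ τ ∈ Icc 0 (L + ∑ i, ℓ i), ∃ t ∈ Icc 0 L, ∃ u w, 0 ≤ u ∧ 0 ≤ w ∧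
        τ = insertShift s ℓ t + u ∧ dist (T t) (U τ) ≤ u ∧ dist (U τ) (T t) ≤ w ∧
        (∀ t', t < t' → insertShift s ℓ t + u + w + (t' - t) ≤ insertShift s ℓ t') ∧
        (u = 0 ∧ U τ = T t ∨ ∃ j, t = s j ∧ u ∈ Icc 0 (ℓ j) ∧ U τ = c j u) := by
      intro τ hτ
      rcases h.exists_time hτ with ⟨t, ht, rfl⟩ | ⟨j, u, hu, rfl⟩
      · refine ⟨t, ht, 0, 0, le_rfl, le_rfl, by ring, ?_, ?_, ?_, .inl ⟨rfl, h.base t ht⟩⟩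
        · rw [h.base t ht, dist_self]
        · rw [h.base t ht, dist_self]
        · intro t' ht'
          linarith [sub_le_insertShift_sub (s := s) hℓ ht'.le]
      · have h0 : (0 : ℝ) ∈ Icc 0 (ℓ j) := ⟨le_rfl, hℓ j⟩
        have h1 : ℓ j ∈ Icc 0 (ℓ j) := ⟨hℓ j, le_rfl⟩
        refine ⟨s j, h.mem_Icc j, u, ℓ j - u, hu.1, by linarith [hu.2], rfl, ?_, ?_, ?_,
          .inr ⟨j, rfl, hu, h.loop j u hu⟩⟩
        · rw [h.loop j u hu, ← h.start j]
          refine ((hc j).2.1 0 h0 u hu).trans_eq ?_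
          rw [zero_sub, abs_neg, abs_of_nonneg hu.1]
        · rw [h.loop j u hu, ← h.finish j]
          refine ((hc j).2.1 u hu _ h1).trans_eq ?_
          rw [abs_sub_comm, abs_of_nonneg (by linarith [hu.2])]
        · intro t' ht'
          linarith [insertShift_add_le hℓ ht']
    intro τ hτ τ' hτ'
    wlog hle : τ ≤ τ' generalizing τ τ'
    · rw [dist_comm, abs_sub_comm]
      exact this τ' hτ' τ hτ (le_of_not_ge hle)
    rw [abs_sub_comm, abs_of_nonneg (by linarith)]
    obtain ⟨t, ht, u, w, hu, hw, e, d1, d2, hn, ho⟩ := rep τ hτ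
    obtain ⟨t', ht', u', w', hu', hw', e', d1', d2', hn', ho'⟩ := rep τ' hτ'
    rcases lt_trichotomy t t' with hlt | rfl | hlt
    · have := hn t' hlt
      have h3 := hT.2.1 t ht t' ht'
      rw [abs_sub_comm, abs_of_nonneg (by linarith)] at h3
      have := dist_triangle4 (U τ) (T t) (T t') (U τ')
      linarith
    · rcases ho with ⟨rfl, ho⟩ | ⟨j, rfl, huj, ho⟩
      · rw [ho]; linarith
      · rcases ho' with ⟨rfl, ho'⟩ | ⟨j', hj', huj', ho'⟩
        · have hu0 : u = 0 := by linarith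
          rw [ho, ho', hu0, h.start, dist_self]; linarith
        · obtain rfl := h.injective hj'
          rw [ho, ho']
          refine ((hc j).2.1 u huj u' huj').trans_eq ?_
          rw [abs_sub_comm, abs_of_nonneg (by linarith)]
          linarith
    · have := hn' t hlt
      linarith
  · rw [h.apply_zero hL, h.apply_length hL, hT.2.2]

end IsInsertion

end Insertion

/-! ### Periodic extension, rotation and union of closed paths -/

section PeriodicExtension

variable {Q : Type*} {S : ℝ → Q} {L : ℝ}

lemma periodicExtension_of_mem (hL : 0 ≤ L) (hS : S 0 = S L) {t : ℝ} (ht : t ∈ Icc 0 L) :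
    periodicExtension S L t = S t := by
  rcases eq_or_lt_of_le hL with rfl | hL
  · rw [Icc_self, mem_singleton_iff] at ht
    simp [periodicExtension, ht]
  rcases eq_or_lt_of_le ht.2 with rfl | h
  · simp [periodicExtension, hL.ne', hS]
  · rw [periodicExtension, Int.fract_eq_self.2 ⟨div_nonneg ht.1 hL.le, (div_lt_one hL).2 h⟩,
      mul_div_cancel₀ _ hL.ne']

lemma periodic_periodicExtension (S : ℝ → Q) (L : ℝ) :
    Function.Periodic (periodicExtension S L) L := by
  intro t
  rcases eq_or_ne L 0 with rfl | hL
  · simp [periodicExtension]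
  · rw [periodicExtension, add_div, div_self hL, Int.fract_add_one, periodicExtension]

lemma IsClosedUnitSpeedPath.lipschitzWith [MetricSpace Q] (h : IsClosedUnitSpeedPath S L) :
    LipschitzWith 1 (periodicExtension S L) := by
  obtain ⟨hL, hd, he⟩ := h
  refine LipschitzWith.of_dist_le_mul fun t t' => ?_
  rw [NNReal.coe_one, one_mul, Real.dist_eq]
  rcases eq_or_lt_of_le hL with rfl | hL
  · simp [periodicExtension]
  wlog hle : t ≤ t' generalizing t t'
  · rw [dist_comm, abs_sub_comm]; exact this t' t (le_of_not_ge hle)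
  have hm : ∀ r : ℝ, L * Int.fract r ∈ Icc 0 L := fun r =>
    ⟨mul_nonneg hL.le (Int.fract_nonneg r), mul_le_of_le_one_right hL.le (Int.fract_lt_one r).le⟩
  have hdec : ∀ r : ℝ, r = L * Int.fract (r / L) + L * ⌊r / L⌋ := fun r => by
    rw [← mul_add, Int.fract_add_floor, mul_div_cancel₀ _ hL.ne']
  have e := hdec t
  have e' := hdec t'
  unfold periodicExtension
  have hf : ⌊t / L⌋ ≤ ⌊t' / L⌋ := Int.floor_mono (by gcongr)
  set f := L * Int.fract (t / L)
  set f' := L * Int.fract (t' / L)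
  -- Times in different periods are compared through the common point `S 0 = S L`, which the path
  -- passes at a moment between them.
  rcases eq_or_lt_of_le hf with hf | hf
  · refine (hd f (hm _) f' (hm _)).trans_eq ?_
    rw [e, e', hf]; ring_nf
  · have h1 : (⌊t / L⌋ : ℝ) + 1 ≤ ⌊t' / L⌋ := by exact_mod_cast hf
    have h2 := hd f (hm _) L ⟨hL.le, le_rfl⟩
    have h3 := hd 0 ⟨le_rfl, hL.le⟩ f' (hm _)
    rw [← he] at h2
    rw [abs_sub_comm, abs_of_nonneg (by linarith [(hm (t / L)).2])] at h2
    rw [zero_sub, abs_neg, abs_of_nonneg (hm _).1] at h3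
    have h4 := dist_triangle (S f) (S 0) (S f')
    rw [abs_sub_comm, abs_of_nonneg (by linarith)]
    nlinarith

lemma IsTourOf.exists_rotation [MetricSpace Q] {Y : Set Q} (h : IsTourOf Y S L) {p : Q}
    (hp : p ∈ Y) : ∃ S', IsTourOf Y S' L ∧ S' 0 = p := by
  obtain ⟨hS, rfl⟩ := h
  obtain ⟨t, ht, rfl⟩ := hp
  have hper := periodic_periodicExtension S L
  have heq : EqOn (periodicExtension S L) S (Icc 0 L) := fun u hu =>
    periodicExtension_of_mem hS.1 hS.2.2 hu
  refine ⟨fun u => periodicExtension S L (u + t), ⟨⟨hS.1, ?_, ?_⟩, ?_⟩, by simp [heq ht]⟩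
  · intro u _ u' _
    simpa [Real.dist_eq] using hS.lipschitzWith.dist_le_mul (u + t) (u' + t)
  · simp only [zero_add]
    rw [add_comm, hper]
  · rcases eq_or_lt_of_le hS.1 with rfl | hL
    · rw [Icc_self, mem_singleton_iff] at ht
      simp [periodicExtension]
    · have : (fun u => periodicExtension S L (u + t)) '' Icc 0 L =
          periodicExtension S L '' ((fun u => u + t) '' Icc 0 L) := by rw [image_image]
      rw [this, image_add_const_Icc, zero_add, add_comm L t, hper.image_Icc hL, ← heq.image_eq,
        ← hper.image_Icc hL 0, zero_add]

lemma IsTourOf.exists_union [MetricSpace Q] {Y Y' : Set Q} {S' : ℝ → Q} {L' : ℝ}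
    (h : IsTourOf Y S L) (h' : IsTourOf Y' S' L') (hne : (Y ∩ Y').Nonempty) :
    ∃ U, IsTourOf (Y ∪ Y') U (L + L') := by
  obtain ⟨p, hp, hp'⟩ := hne
  obtain ⟨S₂, ⟨hS₂, hS₂'⟩, h0⟩ := h'.exists_rotation hp'
  obtain ⟨hS, rfl⟩ := h
  obtain ⟨t, ht, rfl⟩ := hp
  obtain ⟨U, hU⟩ := exists_isInsertion (k := 1) (T := S) (s := fun _ => t) (ℓ := fun _ => L')
    (c := fun _ => S₂) (fun _ => hS₂.1) (fun _ => ht) (Function.injective_of_subsingleton _)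
    (fun _ => h0) (fun _ => by rw [← hS₂.2.2, h0])
  refine ⟨U, ?_, ?_⟩
  · simpa using hU.isClosedUnitSpeedPath hS fun _ => hS₂
  · have := hU.image_eq
    simpa [hS₂', iUnion_const] using this

end PeriodicExtension

/-! ### Chinese Postman Tours of subtrees -/

namespace Network

variable {Q : Type*} [MetricSpace Q] (N : Network Q)

lemma exists_isTourOf_segment (a : N.Arc) {m M : ℝ} (hm : 0 ≤ m) (hmM : m ≤ M)
    (hM : M ≤ N.len a) : ∃ S, IsTourOf (N.param a '' Icc m M) S (2 * (M - m)) := by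
  have hmem : ∀ u ∈ Icc 0 (2 * (M - m)), m + |u - (M - m)| ∈ Icc m M := by
    intro u hu
    have : |u - (M - m)| ≤ M - m := abs_le.2 ⟨by linarith [hu.1], by linarith [hu.2]⟩
    exact ⟨by linarith [abs_nonneg (u - (M - m))], by linarith⟩
  have hsub : Icc m M ⊆ Icc 0 (N.len a) := Icc_subset_Icc hm hM
  -- The path runs from `M` down to `m` and back; the absolute value turns it around at time `M -
  -- m`.
  refine ⟨fun u => N.param a (m + |u - (M - m)|), ⟨by linarith, ?_, ?_⟩, ?_⟩
  · intro u hu v hv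
    refine (N.dist_param_le a (hsub (hmem u hu)) (hsub (hmem v hv))).trans ?_
    have := abs_abs_sub_abs_le_abs_sub (u - (M - m)) (v - (M - m))
    rw [add_sub_add_left_eq_sub]
    simpa using this
  · simp only
    congr 2
    rw [zero_sub, abs_neg]
    congr 1; ring
  · ext x
    constructor
    · rintro ⟨u, hu, rfl⟩
      exact ⟨_, hmem u hu, rfl⟩
    · rintro ⟨s, hs, rfl⟩
      refine ⟨(M - m) + (s - m), ⟨by linarith [hs.1], by linarith [hs.2]⟩, ?_⟩
      simp only [add_sub_cancel_left]
      rw [abs_of_nonneg (by linarith [hs.1])]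
      congr 1; ring

/-- Inside an arc the coordinate determines the point; the ends follow because `Y` is closed. -/
lemma image_param_subset {Y : Set Q} (hY : IsClosed Y)
    {a : N.Arc} {m M : ℝ} (hmM : m < M) (himg : Icc m M ⊆ N.coord a '' Y) :
    N.param a '' Icc m M ⊆ Y := by
  have hsub : Icc m M ⊆ Icc 0 (N.len a) := fun s hs => by
    obtain ⟨y, -, rfl⟩ := himg hs; exact N.coord_mem a y
  have h0 := (hsub ⟨le_rfl, hmM.le⟩).1
  have h1 := (hsub ⟨hmM.le, le_rfl⟩).2
  have hoo : N.param a '' Ioo m M ⊆ Y := by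
    rintro _ ⟨s, hs, rfl⟩
    obtain ⟨y, hy, rfl⟩ := himg (Ioo_subset_Icc_self hs)
    rw [N.param_coord a ⟨h0.trans_lt hs.1, hs.2.trans_le h1⟩]
    exact hy
  have hc : ContinuousOn (N.param a) (closure (Ioo m M)) := by
    rw [closure_Ioo hmM.ne]
    exact (N.continuousOn_param a).mono hsub
  have := hc.image_closure
  rw [closure_Ioo hmM.ne] at this
  exact this.trans (closure_minimal hoo hY)

/-- A subtree has a tour of twice its length. -/
theorem IsTree.exists_isTourOf {N : Network Q} (hN : N.IsTree) {Y : Set Q} (hY : IsClosed Y)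
    (hYc : IsPreconnected Y) {p : Q} (hp : p ∈ Y) :
    ∃ S, IsTourOf Y S (2 * N.lam Y) ∧ S 0 = p := by
  classical
  have := N.compactSpace
  -- The opposite inequality holds for every closed path, and a tour can be rotated to start at `p`.
  suffices h : ∃ S L, IsTourOf Y S L ∧ L ≤ 2 * N.lam Y by
    obtain ⟨S, L, hS, hL⟩ := h
    obtain ⟨S', hS', h0⟩ := hS.exists_rotation hp
    have := hN.two_mul_lam_image_le (g := S') hS'.1.2.1 hS'.1.1 hS'.1.2.2
    rw [hS'.2, sub_zero] at this
    exact ⟨S', le_antisymm hL this ▸ hS', h0⟩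
  have hicc : ∀ a, ∃ m M, m ≤ M ∧ N.coord a '' Y = Icc m M := by
    intro a
    have h1 : IsConnected (N.coord a '' Y) :=
      ⟨⟨_, p, hp, rfl⟩, hYc.image _ (hN.continuous_coord a).continuousOn⟩
    have h2 : IsCompact (N.coord a '' Y) := hY.isCompact.image (hN.continuous_coord a)
    have h3 := eq_Icc_of_connected_compact h1 h2
    refine ⟨_, _, ?_, h3⟩
    rw [← nonempty_Icc, ← h3]
    exact h1.nonempty
  choose m M hmM himg using hicc
  have hsub : ∀ a, Icc (m a) (M a) ⊆ Icc 0 (N.len a) := fun a s hs => by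
    rw [← himg a] at hs
    obtain ⟨y, -, rfl⟩ := hs; exact N.coord_mem a y
  have h0 : ∀ a, 0 ≤ m a := fun a => (hsub a ⟨le_rfl, hmM a⟩).1
  have h1 : ∀ a, M a ≤ N.len a := fun a => (hsub a ⟨hmM a, le_rfl⟩).2
  set A : Finset N.Arc := Finset.univ.filter fun a => m a < M a with hA
  set σ : N.Arc → Set Q := fun a => N.param a '' Icc (m a) (M a) with hσ
  have hσc : ∀ a, IsClosed (σ a) := fun a =>
    (isCompact_Icc.image_of_continuousOn ((N.continuousOn_param a).mono (hsub a))).isClosed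
  have hWc : ∀ G : Finset N.Arc, IsClosed (⋃ a ∈ G, σ a) := fun G =>
    isClosed_biUnion_finset fun a _ => hσc a
  have hσY : ∀ a ∈ A, σ a ⊆ Y := fun a ha =>
    N.image_param_subset hY (by simpa [hA] using ha) (himg a).ge
  have hσne : ∀ a, (σ a).Nonempty := fun a => (nonempty_Icc.2 (hmM a)).image _
  rcases Y.subsingleton_or_nontrivial with hsing | hnt
  · refine ⟨fun _ => p, 0, ⟨⟨le_rfl, by simp, rfl⟩, ?_⟩, by linarith [N.lam_nonneg Y]⟩
    rw [hsing.eq_singleton_of_mem hp]; simp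
  -- A nontrivial connected set has no isolated points, while only finitely many points of `Y`, all
  -- of them nodes, could lie off the nondegenerate segments.
  have hcover : Y ⊆ ⋃ a ∈ A, σ a := by
    have hF : (Y \ ⋃ a ∈ A, σ a).Finite := by
      refine N.nodes_finite.subset fun y hy => ?_
      by_contra hn
      obtain ⟨a, s, hs, rfl⟩ := (N.mem_nodes_or_exists y).resolve_left hn
      have hsm : s ∈ Icc (m a) (M a) := by
        rw [← himg a]; exact ⟨_, hy.1, N.coord_param_of_mem_Ioo a hs⟩
      refine hy.2 (mem_biUnion (x := a) ?_ ⟨s, hsm, rfl⟩)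
      simp only [hA, Finset.coe_filter, Finset.mem_univ, true_and, mem_ofPred_eq]
      by_contra hlt
      obtain ⟨z, hz, hzne⟩ := hnt.exists_ne (N.param a s)
      have hz' : N.coord a z ∈ Icc (m a) (M a) := himg a ▸ ⟨z, hz, rfl⟩
      have : N.coord a z = s := by linarith [hz'.1, hz'.2, hsm.1, hsm.2, not_lt.1 hlt]
      exact hzne (by rw [← this, N.param_coord a (this ▸ hs)])
    intro y hy
    by_contra hyW
    obtain ⟨z, hz, hzne⟩ := hnt.exists_ne y
    obtain ⟨w, -, hw, hw'⟩ := isPreconnected_closed_iff.1 hYc {y}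
      ((⋃ a ∈ A, σ a) ∪ ((Y \ ⋃ a ∈ A, σ a) \ {y})) isClosed_singleton
      ((hWc A).union (hF.subset sdiff_subset).isClosed)
      (fun w hw => by
        by_cases h : w = y
        · exact .inl h
        · by_cases h' : w ∈ ⋃ a ∈ A, σ a
          · exact .inr (.inl h')
          · exact .inr (.inr ⟨⟨hw, h'⟩, h⟩))
      ⟨y, hy, rfl⟩
      ⟨z, hz, by
        by_cases h' : z ∈ ⋃ a ∈ A, σ a
        · exact .inl h'
        · exact .inr ⟨⟨hz, h'⟩, hzne⟩⟩
    rw [mem_singleton_iff] at hw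
    subst hw
    rcases hw' with h | h
    exacts [hyW h, h.2 rfl]
  have hYW : Y = ⋃ a ∈ A, σ a := hcover.antisymm (iUnion₂_subset hσY)
  -- Families of segments whose union has a tour of twice their total length. If a largest one
  -- omitted a segment, connectedness of `Y` would provide an omitted segment touching the union,
  -- and its tour could be spliced in.
  set 𝒢 : Finset (Finset N.Arc) := A.powerset.filter fun G =>
    G.Nonempty ∧ ∃ S, IsTourOf (⋃ a ∈ G, σ a) S (∑ a ∈ G, 2 * (M a - m a)) with h𝒢
  have htour : ∀ a, ∃ S, IsTourOf (σ a) S (2 * (M a - m a)) := fun a =>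
    N.exists_isTourOf_segment a (h0 a) (hmM a) (h1 a)
  obtain ⟨a₀, ha₀⟩ : A.Nonempty := by
    obtain ⟨a, ha, -⟩ := mem_iUnion₂.1 (hcover hp)
    exact ⟨a, ha⟩
  have hne : 𝒢.Nonempty := by
    refine ⟨{a₀}, ?_⟩
    simp only [h𝒢, Finset.mem_filter, Finset.mem_powerset, Finset.singleton_subset_iff]
    refine ⟨ha₀, Finset.singleton_nonempty _, ?_⟩
    simpa using htour a₀
  obtain ⟨G, hG, hmax⟩ := 𝒢.exists_max_image Finset.card hne
  simp only [h𝒢, Finset.mem_filter, Finset.mem_powerset] at hG hmax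
  obtain ⟨hGA, ⟨g, hg⟩, S, hS⟩ := hG
  have hGeq : G = A := by
    by_contra hGne
    obtain ⟨b, hb⟩ : (A \ G).Nonempty :=
      Finset.sdiff_nonempty.2 fun h => hGne (hGA.antisymm h)
    obtain ⟨y, -, hy, hy'⟩ := isPreconnected_closed_iff.1 hYc (⋃ a ∈ G, σ a)
      (⋃ a ∈ A \ G, σ a) (hWc G) (hWc _)
      (fun y hy => by
        obtain ⟨a, ha, hya⟩ := mem_iUnion₂.1 (hcover hy)
        by_cases haG : a ∈ G
        · exact .inl (mem_iUnion₂.2 ⟨a, haG, hya⟩)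
        · exact .inr (mem_iUnion₂.2 ⟨a, Finset.mem_sdiff.2 ⟨ha, haG⟩, hya⟩))
      (by
        obtain ⟨y, hy⟩ := hσne g
        exact ⟨y, hσY g (hGA hg) hy, mem_iUnion₂.2 ⟨g, hg, hy⟩⟩)
      (by
        obtain ⟨y, hy⟩ := hσne b
        exact ⟨y, hσY b (Finset.mem_sdiff.1 hb).1 hy, mem_iUnion₂.2 ⟨b, hb, hy⟩⟩)
    obtain ⟨a, ha, hya⟩ := mem_iUnion₂.1 hy'
    obtain ⟨haA, haG⟩ := Finset.mem_sdiff.1 ha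
    obtain ⟨S', hS'⟩ := htour a
    obtain ⟨U, hU⟩ := hS'.exists_union hS ⟨y, hya, hy⟩
    have := hmax (insert a G) ⟨Finset.insert_subset haA hGA, Finset.insert_nonempty _ _, U, by
      rw [Finset.set_biUnion_insert, Finset.sum_insert haG]; exact hU⟩
    rw [Finset.card_insert_of_notMem haG] at this
    omega
  rw [hGeq] at hS
  refine ⟨S, _, hYW ▸ hS, ?_⟩
  rw [lam, ← Finset.mul_sum]
  gcongr ?_ * ?_
  calc ∑ a ∈ A, (M a - m a)
      ≤ ∑ a ∈ A, volume.real (Ioo 0 (N.len a) ∩ N.param a ⁻¹' Y) := by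
        refine Finset.sum_le_sum fun a ha => ?_
        have e : M a - m a = volume.real (Ioo (m a) (M a)) := by
          rw [Real.volume_real_Ioo_of_le (hmM a)]
        rw [e]
        refine measureReal_mono ?_ (N.volume_inter_ne_top a Y)
        intro s hs
        exact ⟨⟨(h0 a).trans_lt hs.1, hs.2.trans_le (h1 a)⟩,
          hσY a ha ⟨s, Ioo_subset_Icc_self hs, rfl⟩⟩
    _ ≤ _ := Finset.sum_le_univ_sum_of_nonneg fun _ => measureReal_nonneg

lemma IsTree.two_mul_lam_le {N : Network Q} (hN : N.IsTree) {Y : Set Q} {S : ℝ → Q} {L : ℝ}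
    (h : IsTourOf Y S L) : 2 * N.lam Y ≤ L := by
  have := hN.two_mul_lam_image_le (g := S) h.1.2.1 h.1.1 h.1.2.2
  rwa [h.2, sub_zero] at this

lemma IsTree.isCPTOf {N : Network Q} (hN : N.IsTree) {Y : Set Q} {S : ℝ → Q}
    (h : IsTourOf Y S (2 * N.lam Y)) : IsCPTOf Y S (2 * N.lam Y) :=
  ⟨h, fun _ _ h' => hN.two_mul_lam_le h'⟩

lemma IsTree.length_eq {N : Network Q} (hN : N.IsTree) {Y : Set Q} (hY : IsClosed Y)
    (hYc : IsPreconnected Y) {S : ℝ → Q} {L : ℝ} (h : IsCPTOf Y S L) : L = 2 * N.lam Y := by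
  have hp : S 0 ∈ Y := h.1.2 ▸ ⟨0, ⟨le_rfl, h.1.1.1⟩, rfl⟩
  obtain ⟨S', hS', -⟩ := hN.exists_isTourOf hY hYc hp
  exact le_antisymm (h.2 _ _ hS') (hN.two_mul_lam_le h.1)

end Network

/-! ### The extremity set and its components -/

lemma IsClosed.isClosed_connectedComponentIn {X : Type*} [TopologicalSpace X] {F : Set X}
    (hF : IsClosed F) (x : X) : IsClosed (connectedComponentIn F x) := by
  by_cases hx : x ∈ F
  · refine isClosed_of_closure_subset ?_
    exact isPreconnected_connectedComponentIn.closure.subset_connectedComponentIn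
      (subset_closure (mem_connectedComponentIn hx))
      (closure_minimal (connectedComponentIn_subset F x) hF)
  · rw [connectedComponentIn_eq_empty hx]; exact isClosed_empty

lemma notMem_connectedComponentIn_compl {X : Type*} [TopologicalSpace X] (x y : X) :
    x ∉ connectedComponentIn {x}ᶜ y := fun h => by
  simpa using connectedComponentIn_subset _ _ h

namespace Network

variable {Q : Type*} [MetricSpace Q] (N : Network Q)

include N in
lemma locallyPathConnectedSpace : LocallyPathConnectedSpace Q := by
  refine LocallyPathConnectedSpace.of_bases (p := fun _ r => (0 : ℝ) < r)
    (s := fun x r => Metric.ball x r) (fun _ => Metric.nhds_basis_ball) fun x r hr => ?_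
  refine ⟨x, Metric.mem_ball_self hr, fun {y} hy => ?_⟩
  obtain ⟨p, hc, h0, h1, hd⟩ := N.exists_geodesic x y
  refine JoinedIn.ofLine hc h0 h1 ?_
  rintro _ ⟨u, hu, rfl⟩
  rw [Metric.mem_ball, dist_comm] at hy ⊢
  linarith [hd u hu, dist_nonneg (x := p u) (y := y)]

variable {N}

namespace IsTree

variable (hN : N.IsTree)

include hN in
-- By the intermediate value theorem, a connected set that changes sides contains the point itself.
-- Thus the components of the complement of a regular point are the two coordinate half-spaces.
lemma lt_coord_of_isPreconnected {a : N.Arc} {s : ℝ} (hs : s ∈ Ioo 0 (N.len a)) {M : Set Q}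
    (hM : IsPreconnected M) (hsM : N.param a s ∉ M) {x y : Q} (hx : x ∈ M) (hy : y ∈ M)
    (h : s < N.coord a x) : s < N.coord a y := by
  by_contra! hc
  have := (hM.image _ (hN.continuous_coord a).continuousOn).ordConnected.out
    (mem_image_of_mem _ hy) (mem_image_of_mem _ hx) ⟨hc, h.le⟩
  obtain ⟨z, hz, rfl⟩ := this
  exact hsM (by rwa [N.param_coord a hs])

include hN in
lemma coord_lt_of_isPreconnected {a : N.Arc} {s : ℝ} (hs : s ∈ Ioo 0 (N.len a)) {M : Set Q}
    (hM : IsPreconnected M) (hsM : N.param a s ∉ M) {x y : Q} (hx : x ∈ M) (hy : y ∈ M)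
    (h : N.coord a x < s) : N.coord a y < s := by
  by_contra! hc
  have := (hM.image _ (hN.continuous_coord a).continuousOn).ordConnected.out
    (mem_image_of_mem _ hx) (mem_image_of_mem _ hy) ⟨h.le, hc⟩
  obtain ⟨z, hz, rfl⟩ := this
  exact hsM (by rwa [N.param_coord a hs])

include hN in
lemma connectedComponentIn_of_coord_lt {a : N.Arc} {s : ℝ} (hs : s ∈ Ioo 0 (N.len a)) {y : Q}
    (hy : N.coord a y < s) :
    connectedComponentIn {N.param a s}ᶜ y = N.coord a ⁻¹' Iio s := by
  have hsub : N.coord a ⁻¹' Iio s ⊆ {N.param a s}ᶜ := by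
    rintro z hz rfl
    rw [mem_preimage, N.coord_param_of_mem_Ioo a hs] at hz
    exact lt_irrefl _ (mem_Iio.1 hz)
  refine Subset.antisymm (fun z hz => ?_)
    ((hN.isPreconnected_coord_preimage a ordConnected_Iio).subset_connectedComponentIn hy hsub)
  exact hN.coord_lt_of_isPreconnected hs isPreconnected_connectedComponentIn
    (notMem_connectedComponentIn_compl _ _) (mem_connectedComponentIn (hsub hy)) hz hy

include hN in
lemma connectedComponentIn_of_lt_coord {a : N.Arc} {s : ℝ} (hs : s ∈ Ioo 0 (N.len a)) {y : Q}
    (hy : s < N.coord a y) :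
    connectedComponentIn {N.param a s}ᶜ y = N.coord a ⁻¹' Ioi s := by
  have hsub : N.coord a ⁻¹' Ioi s ⊆ {N.param a s}ᶜ := by
    rintro z hz rfl
    rw [mem_preimage, N.coord_param_of_mem_Ioo a hs] at hz
    exact lt_irrefl _ (mem_Ioi.1 hz)
  refine Subset.antisymm (fun z hz => ?_)
    ((hN.isPreconnected_coord_preimage a ordConnected_Ioi).subset_connectedComponentIn hy hsub)
  exact hN.lt_coord_of_isPreconnected hs isPreconnected_connectedComponentIn
    (notMem_connectedComponentIn_compl _ _) (mem_connectedComponentIn (hsub hy)) hz hy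

lemma _root_.Network.coord_ne {a : N.Arc} {s : ℝ} (hs : s ∈ Ioo 0 (N.len a)) {y : Q}
    (h : y ≠ N.param a s) : N.coord a y ≠ s := by
  rintro rfl
  exact h (N.param_coord a hs).symm

include hN in
lemma param_mem_extremity_iff {α : ℝ} {a : N.Arc} {s : ℝ} (hs : s ∈ Ioo 0 (N.len a)) :
    N.param a s ∈ N.extremity α ↔
      N.lam (N.coord a ⁻¹' Iio s) < α / 2 ∨ N.lam (N.coord a ⁻¹' Ioi s) < α / 2 := by
  have h0 : N.coord a (N.param a 0) < s := by
    rw [hN.coord_param a ⟨le_rfl, (N.len_pos a).le⟩]; exact hs.1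
  have h1 : s < N.coord a (N.param a (N.len a)) := by
    rw [hN.coord_param a ⟨(N.len_pos a).le, le_rfl⟩]; exact hs.2
  have hne : ∀ y, N.coord a y ≠ s → y ≠ N.param a s := by
    rintro y hy rfl
    exact hy (N.coord_param_of_mem_Ioo a hs)
  constructor
  · rintro ⟨-, y, hy, h⟩
    rcases lt_or_gt_of_ne (coord_ne hs hy) with h' | h'
    · left; rwa [hN.connectedComponentIn_of_coord_lt hs h'] at h
    · right; rwa [hN.connectedComponentIn_of_lt_coord hs h'] at h
  · rintro (h | h)
    · exact ⟨N.param_notMem_nodes a hs, _, hne _ h0.ne, by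
        rwa [hN.connectedComponentIn_of_coord_lt hs h0]⟩
    · exact ⟨N.param_notMem_nodes a hs, _, hne _ h1.ne', by
        rwa [hN.connectedComponentIn_of_lt_coord hs h1]⟩

include hN in
lemma isOpen_openArc (a : N.Arc) : IsOpen (N.openArc a) := by
  have : N.openArc a = N.coord a ⁻¹' Ioo 0 (N.len a) := by
    ext x
    constructor
    · rintro ⟨s, hs, rfl⟩
      rwa [mem_preimage, N.coord_param_of_mem_Ioo a hs]
    · exact fun h => ⟨_, h, N.param_coord a h⟩
  rw [this]
  exact isOpen_Ioo.preimage (hN.continuous_coord a)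

/-- The two parts of the extremity set in the arc `a`. -/
def _root_.Network.extremityPart (N : Network Q) (α : ℝ) (a : N.Arc) : Bool → Set ℝ
  | true => {s ∈ Ioo 0 (N.len a) | N.lam (N.coord a ⁻¹' Iio s) < α / 2}
  | false => {s ∈ Ioo 0 (N.len a) | N.lam (N.coord a ⁻¹' Ioi s) < α / 2}

lemma _root_.Network.extremityPart_subset (N : Network Q) (α : ℝ) (a : N.Arc) (i : Bool) :
    N.extremityPart α a i ⊆ Ioo 0 (N.len a) := by
  cases i <;> exact fun s hs => hs.1

/-- The lengths of the two sides are monotone in `s`, so the extremity set is a finite union of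
intervals of arcs. -/
lemma _root_.Network.ordConnected_extremityPart (N : Network Q) (α : ℝ) (a : N.Arc) (i : Bool) :
    (N.extremityPart α a i).OrdConnected := by
  refine ⟨fun s hs t ht u hu => ?_⟩
  have hu' : u ∈ Ioo 0 (N.len a) := ordConnected_Ioo.out (N.extremityPart_subset α a i hs)
    (N.extremityPart_subset α a i ht) hu
  cases i
  · exact ⟨hu', (N.lam_mono (preimage_mono (Ioi_subset_Ioi hu.1))).trans_lt hs.2⟩
  · exact ⟨hu', (N.lam_mono (preimage_mono (Iio_subset_Iio hu.2))).trans_lt ht.2⟩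

include hN in
lemma param_mem_extremity_iff_exists {α : ℝ} {a : N.Arc} {s : ℝ} (hs : s ∈ Ioo 0 (N.len a)) :
    N.param a s ∈ N.extremity α ↔ ∃ i, s ∈ N.extremityPart α a i := by
  rw [hN.param_mem_extremity_iff hs]
  constructor
  · rintro (h | h)
    exacts [⟨true, hs, h⟩, ⟨false, hs, h⟩]
  · rintro ⟨_ | _, h⟩
    exacts [.inr h.2, .inl h.2]

include hN in
lemma extremity_eq_iUnion (α : ℝ) :
    N.extremity α = ⋃ i : N.Arc × Bool, N.param i.1 '' N.extremityPart α i.1 i.2 := by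
  ext x
  simp only [mem_iUnion]
  constructor
  · intro hx
    obtain ⟨a, s, hs, rfl⟩ := (N.mem_nodes_or_exists x).resolve_left hx.1
    obtain ⟨i, hi⟩ := (hN.param_mem_extremity_iff_exists hs).1 hx
    exact ⟨(a, i), s, hi, rfl⟩
  · rintro ⟨⟨a, i⟩, s, hs, rfl⟩
    exact (hN.param_mem_extremity_iff_exists (N.extremityPart_subset α a i hs)).2 ⟨i, hs⟩

include hN in
lemma finite_extremityComponents (α : ℝ) : (N.extremityComponents α).Finite := by
  set P : N.Arc × Bool → Set Q := fun i => N.param i.1 '' N.extremityPart α i.1 i.2 with hP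
  have hcl : closure (N.extremity α) = ⋃ i, closure (P i) := by
    rw [hN.extremity_eq_iUnion, closure_iUnion_of_finite]
  have hpre : ∀ i, IsPreconnected (closure (P i)) := fun i =>
    ((N.ordConnected_extremityPart α i.1 i.2).isPreconnected.image _
      ((N.continuousOn_param i.1).mono
        ((N.extremityPart_subset α i.1 i.2).trans Ioo_subset_Icc_self))).closure
  -- The closure of each interval lies in one component, so the union over its points is just that
  -- component.
  refine (finite_range fun i => ⋃ z ∈ closure (P i),
    connectedComponentIn (closure (N.extremity α)) z).subset ?_
  rintro C ⟨x, hx, rfl⟩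
  have hx' := hx
  rw [hcl] at hx'
  obtain ⟨i, hi⟩ := mem_iUnion.1 hx'
  refine ⟨i, ?_⟩
  have hsub : closure (P i) ⊆ connectedComponentIn (closure (N.extremity α)) x :=
    (hpre i).subset_connectedComponentIn hi (hcl ▸ subset_iUnion (fun i => closure (P i)) i)
  refine Subset.antisymm (iUnion₂_subset fun z hz => ?_)
    (subset_biUnion_of_mem (u := fun z => connectedComponentIn (closure (N.extremity α)) z) hi)
  rw [connectedComponentIn_eq (hsub hz)]

include hN in
-- Within an open arc, taking the closure adds at most frontier points of two intervals, a null set.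
lemma lam_closure_extremity (α : ℝ) : N.lam (closure (N.extremity α)) = N.lam (N.extremity α) := by
  refine le_antisymm (Finset.sum_le_sum fun a _ => ?_) (N.lam_mono subset_closure)
  set X : Set ℝ := Ioo 0 (N.len a) ∩ N.param a ⁻¹' N.extremity α with hX
  have hsub : Ioo 0 (N.len a) ∩ N.param a ⁻¹' closure (N.extremity α) ⊆
      X ∪ ⋃ i, frontier (N.extremityPart α a i) := by
    rintro s ⟨hs, hs'⟩
    have h1 : N.param a s ∈ closure (N.extremity α ∩ N.openArc a) := by
      rw [mem_preimage] at hs'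
      rw [inter_comm]
      exact (hN.isOpen_openArc a).inter_closure ⟨⟨s, hs, rfl⟩, hs'⟩
    have h2 : s ∈ closure X := by
      have := image_closure_subset_closure_image (hN.continuous_coord a)
        (mem_image_of_mem _ h1)
      rw [N.coord_param_of_mem_Ioo a hs] at this
      refine closure_mono ?_ this
      rintro _ ⟨_, ⟨hy, ⟨t, ht, rfl⟩⟩, rfl⟩
      rw [N.coord_param_of_mem_Ioo a ht]
      exact ⟨ht, hy⟩
    have h3 : X ⊆ ⋃ i, N.extremityPart α a i := by
      rintro t ⟨ht, ht'⟩
      exact mem_iUnion.2 ((hN.param_mem_extremity_iff_exists ht).1 ht')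
    have h4 := closure_mono h3 h2
    rw [closure_iUnion_of_finite] at h4
    obtain ⟨i, hi⟩ := mem_iUnion.1 h4
    by_cases hsi : s ∈ N.extremityPart α a i
    · exact .inl ⟨hs, (hN.param_mem_extremity_iff_exists hs).2 ⟨i, hsi⟩⟩
    · exact .inr (mem_iUnion.2 ⟨i, hi, fun h => hsi (interior_subset h)⟩)
  have hnull : volume (⋃ i, frontier (N.extremityPart α a i)) = 0 :=
    measure_iUnion_null fun i => (N.ordConnected_extremityPart α a i).convex.addHaar_frontier _
  have hle : volume (Ioo 0 (N.len a) ∩ N.param a ⁻¹' closure (N.extremity α)) ≤ volume X :=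
    (measure_mono hsub).trans ((measure_union_le _ _).trans_eq (by rw [hnull, add_zero]))
  exact ENNReal.toReal_mono (N.volume_inter_ne_top a _) hle

include hN in
/-- Regular points are dense in open sets. -/
lemma exists_regular_of_isOpen (hmu : 0 < N.mu) {U : Set Q} (hU : IsOpen U) {x : Q} (hx : x ∈ U) :
    ∃ y ∈ U, y ∉ N.nodes := by
  have hne : ∃ z, x ≠ z := by
    by_contra! h
    have h1 : (univ : Set Q) = {x} := by ext z; simp [h z]
    have := N.lam_of_finite (finite_singleton x)
    rw [← h1] at this
    exact hmu.ne' this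
  obtain ⟨z, hz⟩ := hne
  obtain ⟨r, hr, hrU⟩ := Metric.isOpen_iff.1 hU x hx
  obtain ⟨a, s, hs, hd, -⟩ := hN.exists_separating hz hr
  exact ⟨_, hrU hd, N.param_notMem_nodes a hs⟩

include hN in
/-- If `D` is a small side of a regular point, all regular points of `D` are extreme. -/
lemma subset_closure_extremity (hmu : 0 < N.mu) {α : ℝ} {x y : Q} (hx : x ∉ N.nodes)
    (h : N.lam (connectedComponentIn {x}ᶜ y) < α / 2) :
    connectedComponentIn {x}ᶜ y ⊆ closure (N.extremity α) := by
  have := N.locallyConnectedSpace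
  set D := connectedComponentIn {x}ᶜ y with hD
  have hDo : IsOpen D := isOpen_compl_singleton.connectedComponentIn
  have hreg : ∀ z ∈ D, z ∉ N.nodes → z ∈ N.extremity α := by
    intro z hz hzn
    obtain ⟨b, t, ht, rfl⟩ := (N.mem_nodes_or_exists z).resolve_left hzn
    have hzx : N.param b t ≠ x := connectedComponentIn_subset _ _ hz
    rw [hN.param_mem_extremity_iff ht]
    have hDz := connectedComponentIn_eq hz
    have hct := N.coord_param_of_mem_Ioo b ht
    -- The side of `z` that does not contain `x` lies in `D`, hence is as small as `D`.
    rcases lt_or_gt_of_ne (coord_ne ht hzx.symm) with h' | h'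
    · right
      have : N.coord b ⁻¹' Ici t ⊆ D := by
        rw [hD, hDz]
        refine (hN.isPreconnected_coord_preimage b ordConnected_Ici).subset_connectedComponentIn
          hct.ge ?_
        rintro w hw rfl
        exact absurd h' (not_lt.2 hw)
      exact (N.lam_mono ((preimage_mono Ioi_subset_Ici_self).trans this)).trans_lt h
    · left
      have : N.coord b ⁻¹' Iic t ⊆ D := by
        rw [hD, hDz]
        refine (hN.isPreconnected_coord_preimage b ordConnected_Iic).subset_connectedComponentIn
          hct.le ?_
        rintro w hw rfl
        exact absurd h' (not_lt.2 hw)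
      exact (N.lam_mono ((preimage_mono Iio_subset_Iic_self).trans this)).trans_lt h
  intro z hz
  rw [mem_closure_iff]
  intro U hU hzU
  obtain ⟨w, hw, hwn⟩ := hN.exists_regular_of_isOpen hmu (hU.inter hDo) ⟨hzU, hz⟩
  exact ⟨w, hw.1, hreg w hw.2 hwn⟩

include hN in
-- An extreme point strictly between `p` and `q` has a small side, which is open, connected,
-- contained in the closure of `E` and contains `p` or `q`. It is then part of the component, so
-- that point would be interior.
lemma eq_of_mem_frontier (hmu : 0 < N.mu) {α : ℝ} {x₀ p q : Q}
    (hp : p ∈ frontier (connectedComponentIn (closure (N.extremity α)) x₀))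
    (hq : q ∈ frontier (connectedComponentIn (closure (N.extremity α)) x₀)) : p = q := by
  have := N.locallyConnectedSpace
  by_contra hpq
  set C := connectedComponentIn (closure (N.extremity α)) x₀ with hC
  have hCc : IsClosed C := isClosed_closure.isClosed_connectedComponentIn x₀
  have hpC := hCc.frontier_subset hp
  have hqC := hCc.frontier_subset hq
  obtain ⟨a, ha⟩ := hN.exists_coord_ne hpq
  wlog hlt : N.coord a p < N.coord a q generalizing p q
  · exact this (Ne.symm hpq) hq hp hqC hpC ha.symm (lt_of_le_of_ne (not_lt.1 hlt) ha.symm)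
  obtain ⟨t, ht1, ht2⟩ := exists_between hlt
  have hIoo : ∀ s ∈ Ioo (N.coord a p) (N.coord a q), s ∈ Ioo 0 (N.len a) := fun s hs =>
    ⟨(N.coord_mem a p).1.trans_lt hs.1, hs.2.trans_le (N.coord_mem a q).2⟩
  have htC : N.param a t ∈ C := by
    have := (isPreconnected_connectedComponentIn.image _
      (hN.continuous_coord a).continuousOn).ordConnected.out
      (mem_image_of_mem _ hpC) (mem_image_of_mem _ hqC) ⟨ht1.le, ht2.le⟩
    obtain ⟨z, hz, rfl⟩ := this
    rwa [N.param_coord a (hIoo _ ⟨ht1, ht2⟩)]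
  have htK : N.param a t ∈ closure (N.extremity α) := connectedComponentIn_subset _ _ htC
  obtain ⟨x, hxo, hxE⟩ := mem_closure_iff.1 htK (N.coord a ⁻¹' Ioo (N.coord a p) (N.coord a q))
    (isOpen_Ioo.preimage (hN.continuous_coord a)) (by
      rw [mem_preimage, N.coord_param_of_mem_Ioo a (hIoo _ ⟨ht1, ht2⟩)]; exact ⟨ht1, ht2⟩)
  rw [mem_preimage] at hxo
  have hxs := hIoo _ hxo
  have hxe := N.param_coord a hxs
  obtain ⟨hxn, y, hyx, hy⟩ := hxE
  have hDK := hN.subset_closure_extremity hmu hxn hy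
  have hfin : ∀ r ∈ C, r ∈ connectedComponentIn {x}ᶜ y →
      connectedComponentIn {x}ᶜ y ∈ nhds r ∧ connectedComponentIn {x}ᶜ y ⊆ C := by
    intro r hrC hr
    refine ⟨isOpen_compl_singleton.connectedComponentIn.mem_nhds hr, ?_⟩
    rw [hC, connectedComponentIn_eq hrC]
    exact isPreconnected_connectedComponentIn.subset_connectedComponentIn hr hDK
  have hcon : ∀ r ∈ frontier C, r ∉ connectedComponentIn {x}ᶜ y := by
    intro r hr hrD
    obtain ⟨h1, h2⟩ := hfin r (hCc.frontier_subset hr) hrD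
    exact hr.2 (mem_interior_iff_mem_nhds.2 (Filter.mem_of_superset h1 h2))
  rw [← hxe] at hyx hcon
  rcases lt_or_gt_of_ne (coord_ne hxs hyx) with h | h
  · rw [hN.connectedComponentIn_of_coord_lt hxs h] at hcon
    exact hcon p hp hxo.1
  · rw [hN.connectedComponentIn_of_lt_coord hxs h] at hcon
    exact hcon q hq hxo.2

end IsTree

end Network

/-! ### Hanging subtrees, their branches and excursions -/

namespace Network

variable {Q : Type*} [MetricSpace Q] (N : Network Q)

/-- `C` is a subtree attached to the rest of the tree at the single point `p`, near which all
extreme points belong to `C`. -/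
structure IsHanging (α : ℝ) (C : Set Q) (p : Q) : Prop where
  isClosed : IsClosed C
  isPreconnected : IsPreconnected C
  frontier_eq : frontier C = {p}
  exists_ball : ∃ r > 0, Metric.ball p r ∩ closure (N.extremity α) ⊆ C

variable {N} {α : ℝ} {C : Set Q} {p : Q}

lemma lam_eq_add_compl {Y : Set Q} (hY : IsClosed Y) : N.mu = N.lam Y + N.lam Yᶜ := by
  borelize Q
  rw [mu, N.lam_eq_lengthMeasure MeasurableSet.univ, N.lam_eq_lengthMeasure hY.measurableSet,
    N.lam_eq_lengthMeasure hY.measurableSet.compl, measureReal_add_measureReal_compl hY.measurableSet]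

namespace IsTree

variable (hN : N.IsTree)

lemma _root_.Network.frontier_nonempty (N : Network Q) {C : Set Q}
    (hne : C.Nonempty) (huniv : C ≠ univ) : (frontier C).Nonempty := by
  have := N.preconnectedSpace
  rw [nonempty_iff_ne_empty, Ne, ← isClopen_iff_frontier_eq_empty, isClopen_iff]
  rintro (h | h)
  exacts [hne.ne_empty h, huniv h]

include hN in
lemma exists_isHanging (hmu : 0 < N.mu) (hK : closure (N.extremity α) ≠ univ)
    (hC : C ∈ N.extremityComponents α) : ∃ p, N.IsHanging α C p := by
  obtain ⟨x, hx, rfl⟩ := hC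
  set C := connectedComponentIn (closure (N.extremity α)) x with hC
  have hCc : IsClosed C := isClosed_closure.isClosed_connectedComponentIn x
  obtain ⟨p, hp⟩ := N.frontier_nonempty
    ⟨x, mem_connectedComponentIn hx⟩ fun h => hK (by
      rw [eq_univ_iff_forall] at h ⊢
      exact fun y => connectedComponentIn_subset _ _ (h y))
  refine ⟨p, hCc, isPreconnected_connectedComponentIn, ?_, ?_⟩
  · ext q
    exact ⟨fun hq => hN.eq_of_mem_frontier hmu hq hp, fun hq => by rw [hq]; exact hp⟩
  -- The other components are finitely many closed sets that miss `p`, hence stay away from it.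
  · have hfin : (N.extremityComponents α \ {C}).Finite :=
      (hN.finite_extremityComponents α).subset sdiff_subset
    have hcl : IsClosed (⋃₀ (N.extremityComponents α \ {C})) := by
      rw [sUnion_eq_biUnion]
      refine hfin.isClosed_biUnion ?_
      rintro _ ⟨⟨y, -, rfl⟩, -⟩
      exact isClosed_closure.isClosed_connectedComponentIn y
    have hpn : p ∉ ⋃₀ (N.extremityComponents α \ {C}) := by
      rintro ⟨_, ⟨⟨y, -, rfl⟩, hne⟩, hy⟩
      refine hne ?_
      rw [mem_singleton_iff, hC, connectedComponentIn_eq hy,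
        connectedComponentIn_eq (hCc.frontier_subset hp)]
    obtain ⟨r, hr, hsub⟩ := Metric.isOpen_iff.1 hcl.isOpen_compl p hpn
    refine ⟨r, hr, ?_⟩
    rintro y ⟨hy, hyK⟩
    by_contra hyC
    refine hsub hy ⟨connectedComponentIn (closure (N.extremity α)) y, ⟨⟨y, hyK, rfl⟩, ?_⟩,
      mem_connectedComponentIn hyK⟩
    rintro h
    rw [mem_singleton_iff] at h
    exact hyC (h ▸ mem_connectedComponentIn hyK)

/-- Treats a point outside the closure of `E` as a degenerate hanging subtree, so that the estimates
for excursions also serve such points. -/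
lemma _root_.Network.isHanging_singleton (N : Network Q) (hmu : 0 < N.mu) {x : Q} (hx : x ∉ closure (N.extremity α)) :
    N.IsHanging α {x} x := by
  have hne : ({x} : Set Q) ≠ univ := fun h => by
    have := N.lam_of_finite (finite_singleton x)
    rw [h] at this
    exact hmu.ne' this
  refine ⟨isClosed_singleton, isPreconnected_singleton, ?_, ?_⟩
  · obtain ⟨y, hy⟩ := N.frontier_nonempty (singleton_nonempty x) hne
    refine Subset.antisymm isClosed_singleton.frontier_subset ?_
    rw [singleton_subset_iff]
    have hyx := isClosed_singleton.frontier_subset hy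
    rw [mem_singleton_iff] at hyx
    rwa [hyx] at hy
  · obtain ⟨r, hr, hsub⟩ := Metric.isOpen_iff.1 isClosed_closure.isOpen_compl x hx
    exact ⟨r, hr, fun y hy => absurd hy.2 (hsub hy.1)⟩

include hN in
/-- Points of a component of the complement of `C` are on the same side of a regular point which is
close enough to the attaching point of `C`. -/
lemma exists_same_side (hC : IsClosed C) (hp : p ∈ C) {z z' : Q}
    (hz' : z' ∈ connectedComponentIn Cᶜ z) : ∃ r > 0, ∀ a, ∀ s ∈ Ioo 0 (N.len a),
      dist (N.param a s) p < r → (N.coord a z < s → N.coord a z' < s) ∧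
        (s < N.coord a z → s < N.coord a z') := by
  have := N.locallyPathConnectedSpace
  have := N.locallyConnectedSpace
  have hBo : IsOpen (connectedComponentIn Cᶜ z) := hC.isOpen_compl.connectedComponentIn
  have hzC : z ∈ Cᶜ := connectedComponentIn_nonempty_iff.1 ⟨z', hz'⟩
  have hBc : IsConnected (connectedComponentIn Cᶜ z) := isConnected_connectedComponentIn_iff.2 hzC
  -- A path from `z` to `z'` inside the component keeps a positive distance from `p`, so a regular
  -- point closer to `p` does not separate its ends.
  obtain ⟨γ, hγ⟩ := (hBo.isConnected_iff_isPathConnected.1 hBc).joinedIn z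
    (mem_connectedComponentIn hzC) z' hz'
  have hpγ : p ∈ (range γ)ᶜ := by
    rintro ⟨t, ht⟩
    exact connectedComponentIn_subset _ _ (hγ t) (ht ▸ hp)
  obtain ⟨r, hr, hsub⟩ := Metric.isOpen_iff.1 (isCompact_range γ.continuous).isClosed.isOpen_compl
    p hpγ
  refine ⟨r, hr, fun a s hs hd => ?_⟩
  have h0 : z ∈ range γ := ⟨0, γ.source⟩
  have h1 : z' ∈ range γ := ⟨1, γ.target⟩
  have hpre : IsPreconnected (range γ) := isPreconnected_range γ.continuous
  exact ⟨hN.coord_lt_of_isPreconnected hs hpre (hsub hd) h0 h1,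
    hN.lt_coord_of_isPreconnected hs hpre (hsub hd) h0 h1⟩

end IsTree

namespace IsHanging

variable (hN : N.IsTree) (h : N.IsHanging α C p)

include h in
lemma mem : p ∈ C := h.isClosed.frontier_subset (by rw [h.frontier_eq]; rfl)

include h in
-- A branch has no boundary point other than `p`; without `p` it would be clopen in the connected
-- space.
lemma mem_closure_component {z : Q} (hz : z ∉ C) : p ∈ closure (connectedComponentIn Cᶜ z) := by
  have := N.locallyConnectedSpace
  have := N.preconnectedSpace
  set B := connectedComponentIn Cᶜ z with hB
  have hBo : IsOpen B := h.isClosed.isOpen_compl.connectedComponentIn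
  have hzB : z ∈ B := mem_connectedComponentIn hz
  by_contra hp
  have hcl : closure B ⊆ B := by
    intro y hy
    by_contra hyB
    by_cases hyC : y ∈ C
    · have : y ∈ frontier C := by
        rw [frontier_eq_closure_inter_closure]
        exact ⟨subset_closure hyC, closure_mono (connectedComponentIn_subset _ _) hy⟩
      rw [h.frontier_eq, mem_singleton_iff] at this
      exact hp (this ▸ hy)
    · obtain ⟨w, hw, hw'⟩ := mem_closure_iff.1 hy (connectedComponentIn Cᶜ y)
        h.isClosed.isOpen_compl.connectedComponentIn (mem_connectedComponentIn hyC)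
      refine hyB ?_
      rw [hB, connectedComponentIn_eq hw', ← connectedComponentIn_eq hw]
      exact mem_connectedComponentIn hyC
  rcases isClopen_iff.1 ⟨isClosed_of_closure_subset hcl, hBo⟩ with h' | h'
  · rw [h'] at hzB; exact hzB
  · exact connectedComponentIn_subset _ _ (h' ▸ mem_univ p : p ∈ B) h.mem

include hN h in
/-- Arbitrarily close to the attaching point of `C` there are regular points separating `C` from a
given point. -/
lemma exists_separating {z : Q} (hz : z ∉ C) {r : ℝ} (hr : 0 < r) :
    ∃ a, ∃ s ∈ Ioo 0 (N.len a), ∃ A D : Set Q, dist (N.param a s) p < r ∧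
      N.param a s ∈ connectedComponentIn Cᶜ z ∧ N.param a s ∉ closure (N.extremity α) ∧
      (A = N.coord a ⁻¹' Iio s ∧ D = N.coord a ⁻¹' Ioi s ∨
        A = N.coord a ⁻¹' Ioi s ∧ D = N.coord a ⁻¹' Iio s) ∧
      C ⊆ A ∧ z ∈ D ∧ D ⊆ connectedComponentIn Cᶜ z ∧ α / 2 ≤ N.lam A ∧ α / 2 ≤ N.lam D := by
  obtain ⟨δ, hδ, hball⟩ := h.exists_ball
  have hpz : p ≠ z := fun e => hz (e ▸ h.mem)
  obtain ⟨a, s, hs, hd, hsep⟩ := hN.exists_separating hpz (lt_min hr hδ)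
  set B := connectedComponentIn Cᶜ z with hB
  have hzB : z ∈ B := mem_connectedComponentIn hz
  -- The branch together with `p` is connected, so a point separating `p` from `z` lies in the
  -- branch.
  have hpB : IsPreconnected (insert p B) :=
    isPreconnected_connectedComponentIn.subset_closure (subset_insert _ _)
      (insert_subset (h.mem_closure_component hz) subset_closure)
  have hxB : N.param a s ∈ B := by
    have hmem : N.param a s ∈ insert p B := by
      by_contra hcon
      rcases hsep with ⟨h1, h2⟩ | ⟨h1, h2⟩
      · exact lt_asymm h2 (hN.coord_lt_of_isPreconnected hs hpB hcon (mem_insert _ _)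
          (mem_insert_of_mem _ hzB) h1)
      · exact lt_asymm h1 (hN.lt_coord_of_isPreconnected hs hpB hcon (mem_insert _ _)
          (mem_insert_of_mem _ hzB) h2)
    refine hmem.resolve_left fun e => ?_
    rw [← e, N.coord_param_of_mem_Ioo a hs] at hsep
    rcases hsep with h' | h'
    exacts [lt_irrefl _ h'.1, lt_irrefl _ h'.2]
  have hxC : N.param a s ∉ C := connectedComponentIn_subset _ _ hxB
  -- Near `p` all points of the closure of `E` are in `C`. So the separating point is not extreme,
  -- and both its sides have length at least `α / 2`.
  have hxK : N.param a s ∉ closure (N.extremity α) := fun hK =>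
    hxC (hball ⟨hd.trans_le (min_le_right _ _), hK⟩)
  have hxE := mt (fun h => subset_closure h) hxK
  rw [hN.param_mem_extremity_iff hs, not_or, not_lt, not_lt] at hxE
  refine ⟨a, s, hs, ?_⟩
  rcases hsep with ⟨h1, h2⟩ | ⟨h1, h2⟩
  · have hCA : C ⊆ N.coord a ⁻¹' Iio s := fun y hy =>
      hN.coord_lt_of_isPreconnected hs h.isPreconnected hxC h.mem hy h1
    refine ⟨_, _, hd.trans_le (min_le_left _ _), hxB, hxK, .inl ⟨rfl, rfl⟩, hCA, h2, ?_, hxE⟩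
    refine (hN.isPreconnected_coord_preimage a ordConnected_Ioi).subset_connectedComponentIn h2 ?_
    intro y hy hyC
    exact lt_asymm (mem_Ioi.1 (mem_preimage.1 hy)) (mem_Iio.1 (mem_preimage.1 (hCA hyC)))
  · have hCA : C ⊆ N.coord a ⁻¹' Ioi s := fun y hy =>
      hN.lt_coord_of_isPreconnected hs h.isPreconnected hxC h.mem hy h2
    refine ⟨_, _, hd.trans_le (min_le_left _ _), hxB, hxK, .inr ⟨rfl, rfl⟩, hCA, h1, ?_, hxE.2,
      hxE.1⟩
    refine (hN.isPreconnected_coord_preimage a ordConnected_Iio).subset_connectedComponentIn h1 ?_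
    intro y hy hyC
    exact lt_asymm (mem_Iio.1 (mem_preimage.1 hy)) (mem_Ioi.1 (mem_preimage.1 (hCA hyC)))

include hN h in
lemma half_le_lam_component {z : Q} (hz : z ∉ C) :
    α / 2 ≤ N.lam (connectedComponentIn Cᶜ z) := by
  obtain ⟨a, s, hs, A, D, -, -, -, -, -, -, hD, -, hlam⟩ := h.exists_separating hN hz one_pos
  exact hlam.trans (N.lam_mono hD)

include hN h in
/-- A small hanging subtree has several branches at its attaching point. -/
lemma exists_notMem_component (hlam : N.lam C < α / 2) {z : Q} (hz : z ∉ C) :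
    ∃ z', z' ∉ C ∧ z' ∉ connectedComponentIn Cᶜ z := by
  by_contra! hcon
  have hB : connectedComponentIn Cᶜ z = Cᶜ :=
    (connectedComponentIn_subset _ _).antisymm hcon
  -- If there were only one branch, separating points tending to `p` would have far sides `D n` that
  -- eventually contain each point of it. Then the near sides `A n` would become almost as short as
  -- `C`, contradicting `hA`.
  have hr : ∀ n : ℕ, (0 : ℝ) < 1 / (n + 1) := fun n => by positivity
  choose a s hs A D hd hx hxK hor hCA hzD hDB hA hD using
    fun n : ℕ => h.exists_separating hN hz (hr n)
  have hDo : ∀ n, IsOpen (D n) := by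
    intro n
    rcases hor n with ⟨-, h'⟩ | ⟨-, h'⟩ <;> rw [h']
    exacts [isOpen_Ioi.preimage (hN.continuous_coord _),
      isOpen_Iio.preimage (hN.continuous_coord _)]
  have hAD : ∀ n, A n ⊆ (D n)ᶜ := by
    intro n y hy hy'
    rcases hor n with ⟨h1, h2⟩ | ⟨h1, h2⟩ <;> rw [h1] at hy <;> rw [h2] at hy'
    · exact lt_asymm (mem_Iio.1 (mem_preimage.1 hy)) (mem_Ioi.1 (mem_preimage.1 hy'))
    · exact lt_asymm (mem_Iio.1 (mem_preimage.1 hy')) (mem_Ioi.1 (mem_preimage.1 hy))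
  have hev : ∀ z' ∈ Cᶜ, ∃ n₀, ∀ n ≥ n₀, z' ∈ D n := by
    intro z' hz'
    rw [← hB] at hz'
    obtain ⟨r, hr, hside⟩ := hN.exists_same_side h.isClosed h.mem hz'
    obtain ⟨n₀, hn₀⟩ := exists_nat_one_div_lt hr
    refine ⟨n₀, fun n hn => ?_⟩
    have hdr : dist (N.param (a n) (s n)) p < r :=
      (hd n).trans_le ((one_div_le_one_div_of_le (by positivity) (by gcongr)).trans hn₀.le)
    have := hside (a n) (s n) (hs n) hdr
    have hzDn := hzD n
    rcases hor n with ⟨-, h2⟩ | ⟨-, h2⟩ <;> rw [h2] at hzDn ⊢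
    exacts [this.2 hzDn, this.1 hzDn]
  borelize Q
  -- The sets `D n` need not be monotone; the intersections of their tails are, which allows
  -- continuity from below.
  set U : ℕ → Set Q := fun n => ⋂ m ≥ n, D m with hU
  have hmono : Monotone U := by
    intro n m hnm y hy
    simp only [hU, mem_iInter] at hy ⊢
    exact fun i hi => hy i (hnm.trans hi)
  have hlim := tendsto_measure_iUnion_atTop (μ := N.lengthMeasure) hmono
  have hlim' := (ENNReal.tendsto_toReal (measure_ne_top _ _)).comp hlim
  have hCU : N.lam Cᶜ ≤ (N.lengthMeasure (⋃ n, U n)).toReal := by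
    rw [N.lam_eq_lengthMeasure h.isClosed.isOpen_compl.measurableSet]
    refine measureReal_mono fun y hy => ?_
    obtain ⟨n₀, hn₀⟩ := hev y hy
    simp only [hU, mem_iUnion, mem_iInter]
    exact ⟨n₀, hn₀⟩
  have hμ := lam_eq_add_compl (N := N) h.isClosed
  obtain ⟨n, hn⟩ := (hlim'.eventually (lt_mem_nhds
    (show N.lam Cᶜ - (α / 2 - N.lam C) < _ by linarith))).exists
  have hn' : N.lam Cᶜ - (α / 2 - N.lam C) < N.lam (D n) := by
    refine hn.trans_le ?_
    rw [N.lam_eq_lengthMeasure (hDo n).measurableSet]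
    exact measureReal_mono (iInter₂_subset n le_rfl)
  have h1 := lam_eq_add_compl (N := N) (hDo n).isClosed_compl
  rw [compl_compl] at h1
  have h2 := N.lam_mono (hAD n)
  have h3 := hA n
  linarith

include hN h in
/-- Two points of the same component of the complement of `C` are separated from `C` by a common
interval of an arc. -/
lemma exists_Ioo_subset_uIcc {z z' : Q} (hz' : z' ∈ connectedComponentIn Cᶜ z) :
    ∃ a, ∃ s₁ s₂ : ℝ, s₁ < s₂ ∧ Ioo s₁ s₂ ⊆ uIcc (N.coord a p) (N.coord a z) ∧
      Ioo s₁ s₂ ⊆ uIcc (N.coord a p) (N.coord a z') := by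
  have hz : z ∈ Cᶜ := connectedComponentIn_nonempty_iff.1 ⟨z', hz'⟩
  obtain ⟨r, hr, hside⟩ := hN.exists_same_side h.isClosed h.mem hz'
  obtain ⟨a, s, hs, A, D, hd, -, -, hor, hCA, hzD, -⟩ := h.exists_separating hN hz hr
  obtain ⟨hs1, hs2⟩ := hside a s hs hd
  have hpA := hCA h.mem
  rcases hor with ⟨rfl, rfl⟩ | ⟨rfl, rfl⟩
  · have h1 : N.coord a p < s := hpA
    have h2 : s < N.coord a z := hzD
    refine ⟨a, s, min (N.coord a z) (N.coord a z'), lt_min h2 (hs2 h2), fun t ht => ?_,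
      fun t ht => ?_⟩
    · exact mem_uIcc.2 (.inl ⟨by linarith [ht.1], ht.2.le.trans (min_le_left _ _)⟩)
    · exact mem_uIcc.2 (.inl ⟨by linarith [ht.1], ht.2.le.trans (min_le_right _ _)⟩)
  · have h1 : s < N.coord a p := hpA
    have h2 : N.coord a z < s := hzD
    refine ⟨a, max (N.coord a z) (N.coord a z'), s, max_lt h2 (hs1 h2), fun t ht => ?_,
      fun t ht => ?_⟩
    · exact mem_uIcc.2 (.inr ⟨(le_max_left _ _).trans ht.1.le, by linarith [ht.2]⟩)
    · exact mem_uIcc.2 (.inr ⟨(le_max_right _ _).trans ht.1.le, by linarith [ht.2]⟩)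

include h in
lemma eq_of_mem_closure_compl {x : Q} (hx : x ∈ C) (hx' : x ∈ closure Cᶜ) : x = p := by
  have : x ∈ frontier C := by
    rw [frontier_eq_closure_inter_closure]; exact ⟨subset_closure hx, hx'⟩
  rwa [h.frontier_eq] at this

include h in
/-- An excursion leaves and reenters `C` at the attaching point. -/
lemma eq_of_excursion {S : ℝ → Q} {t₁ t₂ : ℝ} (ht : t₁ < t₂) (hS : ContinuousOn S (Icc t₁ t₂))
    (h1 : S t₁ ∈ C) (h2 : S t₂ ∈ C) (hex : ∀ t ∈ Ioo t₁ t₂, S t ∉ C) : S t₁ = p ∧ S t₂ = p := by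
  have hc : S '' Icc t₁ t₂ ⊆ closure Cᶜ := by
    have hcl : closure (Ioo t₁ t₂) = Icc t₁ t₂ := closure_Ioo ht.ne
    rw [← hcl] at hS ⊢
    refine hS.image_closure.trans (closure_mono ?_)
    rintro _ ⟨t, ht, rfl⟩
    exact hex t ht
  exact ⟨h.eq_of_mem_closure_compl h1 (hc ⟨t₁, ⟨le_rfl, ht.le⟩, rfl⟩),
    h.eq_of_mem_closure_compl h2 (hc ⟨t₂, ⟨ht.le, le_rfl⟩, rfl⟩)⟩

include hN h in
/-- In a minimal tour, an excursion from `C` is the only visit to a component of the complement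
of `C`. -/
lemma notMem_of_excursion {S : ℝ → Q} {L t₁ t₂ v u : ℝ} (hS : IsTourOf univ S L)
    (hL : L = 2 * N.mu) (h0 : 0 ≤ t₁) (hv : v ∈ Ioo t₁ t₂) (hL' : t₂ ≤ L)
    (h1 : S t₁ = p) (h2 : S t₂ = p) (hu : u ∈ Icc 0 L) (hu' : u ∉ Icc t₁ t₂) :
    S u ∉ connectedComponentIn Cᶜ (S v) := by
  intro hcomp
  obtain ⟨a, s₁, s₂, hs, hI1, hI2⟩ := h.exists_Ioo_subset_uIcc hN hcomp
  rw [mem_Icc, not_and_or, not_le, not_le] at hu'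
  -- Together with the way out and back of the excursion, the extra visit at time `u` gives a third
  -- pass over a common interval next to `p`.
  rcases hu' with hu' | hu'
  · refine (hN.lt_of_three_passes (a := a) hS hu.1 hu'.le hv.1.le hv.2.le hL' hs ?_ ?_ ?_).ne' hL
    · rw [h1, uIcc_comm]; exact hI2
    · rw [h1]; exact hI1
    · rw [h2, uIcc_comm]; exact hI1
  · refine (hN.lt_of_three_passes (a := a) hS h0 hv.1.le hv.2.le hu'.le hu.2 hs ?_ ?_ ?_).ne' hL
    · rw [h1]; exact hI1
    · rw [h2, uIcc_comm]; exact hI1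
    · rw [h2]; exact hI2

include hN h in
/-- An excursion from a hanging subtree with several branches takes at least time `α`, and so does
the rest of a minimal tour. -/
lemma le_excursion {S : ℝ → Q} {L t₀ t₁ t₂ : ℝ} (hS : IsTourOf univ S L) (hL : L = 2 * N.mu)
    (h0 : 0 ≤ t₀) (h01 : t₀ ≤ t₁) (h12 : t₁ < t₂) (hL' : t₂ ≤ L)
    (hC : ∀ t ∈ Icc t₀ t₁, S t ∈ C) (hS₀ : S t₀ = S t₁) (hS₂ : S t₂ ∈ C)
    (hex : ∀ t ∈ Ioo t₁ t₂, S t ∉ C)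
    (hbr : ∀ z, z ∉ C → ∃ z', z' ∉ C ∧ z' ∉ connectedComponentIn Cᶜ z) :
    α ≤ t₂ - t₁ ∧ α ≤ L - (t₂ - t₀) := by
  have hus : IsUnitSpeedOn S 0 L := hS.1.2.1
  have hus' : IsUnitSpeedOn S t₁ t₂ := hus.mono (h0.trans h01) hL'
  obtain ⟨e1, e2⟩ := h.eq_of_excursion h12 hus'.continuousOn (hC t₁ ⟨h01, le_rfl⟩) hS₂ hex
  obtain ⟨v, hv⟩ := nonempty_Ioo.2 h12
  have himg : ∀ z, ∃ u ∈ Icc 0 L, S u = z := fun z => by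
    have : z ∈ S '' Icc 0 L := hS.2 ▸ mem_univ z
    exact this
  constructor
  -- The branch is not visited at any other time, so the excursion covers all of it. As a closed
  -- path it takes at least twice the length of the branch.
  · have hcov : connectedComponentIn Cᶜ (S v) ⊆ S '' Icc t₁ t₂ := by
      intro z hz
      obtain ⟨u, hu, rfl⟩ := himg z
      by_contra hcon
      exact h.notMem_of_excursion hN hS hL (h0.trans h01) hv hL' e1 e2 hu
        (fun hu' => hcon ⟨u, hu', rfl⟩) hz
    have := hN.two_mul_lam_image_le hus' h12.le (e1.trans e2.symm)
    have := N.lam_mono hcov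
    have := h.half_le_lam_component hN (hex v hv)
    linarith
  · obtain ⟨z', hz'C, hz'⟩ := hbr _ (hex v hv)
    set G := periodicExtension S L with hG
    have hper : Function.Periodic G L := periodic_periodicExtension S L
    have hLip : LipschitzWith 1 G := hS.1.lipschitzWith
    have hGS : ∀ t ∈ Icc 0 L, G t = S t := fun t ht =>
      periodicExtension_of_mem hS.1.1 hS.1.2.2 ht
    have hunit : IsUnitSpeedOn G t₂ (L + t₀) := fun t _ t' _ => by
      simpa [Real.dist_eq] using hLip.dist_le_mul t t'
    have hends : G t₂ = G (L + t₀) := by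
      rw [add_comm, hper, hGS t₂ ⟨by linarith, hL'⟩, hGS t₀ ⟨h0, by linarith⟩, e2, hS₀, e1]
    -- Between `t₀` and `t₂` the tour is only in `C` or in the branch of `S v`. Another branch is
    -- therefore covered during the complementary part of the period, again a closed path.
    have hcov : connectedComponentIn Cᶜ z' ⊆ G '' Icc t₂ (L + t₀) := by
      intro z hz
      have hzC : z ∉ C := connectedComponentIn_subset _ _ hz
      have hzv : z ∉ connectedComponentIn Cᶜ (S v) := fun hzv => hz' (by
        rw [connectedComponentIn_eq hzv, ← connectedComponentIn_eq hz]
        exact mem_connectedComponentIn hz'C)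
      obtain ⟨u, hu, rfl⟩ := himg z
      rcases le_or_gt u t₀ with hut | hut
      · exact ⟨u + L, ⟨by linarith [hu.1], by linarith⟩, by rw [hper, hGS u hu]⟩
      rcases le_or_gt t₂ u with hut₂ | hut₂
      · exact ⟨u, ⟨hut₂, by linarith [hu.2]⟩, hGS u hu⟩
      exfalso
      rcases le_or_gt u t₁ with hut₁ | hut₁
      · exact hzC (hC u ⟨hut.le, hut₁⟩)
      · refine hzv (IsPreconnected.subset_connectedComponentIn (s := S '' Ioo t₁ t₂) ?_ ?_ ?_ ?_)
        · exact isPreconnected_Ioo.image _ (hus'.continuousOn.mono Ioo_subset_Icc_self)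
        · exact ⟨v, hv, rfl⟩
        · rintro _ ⟨t, ht, rfl⟩; exact hex t ht
        · exact ⟨u, ⟨hut₁, hut₂⟩, rfl⟩
    have := hN.two_mul_lam_image_le hunit (by linarith) hends
    have := N.lam_mono hcov
    have := h.half_le_lam_component hN hz'C
    linarith

end IsHanging

/-- A path that begins and ends outside the branch of `S v` must meet `C` before and after time `v`;
the last such time before and the first after bound the excursion. -/
lemma exists_excursion {S : ℝ → Q} {L v : ℝ} (hS : ContinuousOn S (Icc 0 L)) (hC : IsClosed C)
    (hv : v ∈ Icc 0 L) (hvC : S v ∉ C) (h0 : S 0 ∉ connectedComponentIn Cᶜ (S v))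
    (hL : S L ∉ connectedComponentIn Cᶜ (S v)) :
    ∃ t₁ t₂, 0 ≤ t₁ ∧ t₁ < v ∧ v < t₂ ∧ t₂ ≤ L ∧ S t₁ ∈ C ∧ S t₂ ∈ C ∧
      ∀ t ∈ Ioo t₁ t₂, S t ∉ C := by
  have key : ∀ u w, u ≤ w → 0 ≤ u → w ≤ L → v ∈ Icc u w →
      (S u ∉ connectedComponentIn Cᶜ (S v) ∨ S w ∉ connectedComponentIn Cᶜ (S v)) →
      (Icc u w ∩ S ⁻¹' C).Nonempty := by
    intro u w huw hu hw hvuw hor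
    by_contra hcon
    rw [not_nonempty_iff_eq_empty] at hcon
    have hsub : S '' Icc u w ⊆ connectedComponentIn Cᶜ (S v) := by
      refine (isPreconnected_Icc.image _ (hS.mono (Icc_subset_Icc hu hw)))
        |>.subset_connectedComponentIn ⟨v, hvuw, rfl⟩ ?_
      rintro _ ⟨t, ht, rfl⟩ htC
      exact (hcon ▸ (⟨ht, htC⟩ : t ∈ Icc u w ∩ S ⁻¹' C) : t ∈ (∅ : Set ℝ))
    rcases hor with h' | h'
    · exact h' (hsub ⟨u, ⟨le_rfl, huw⟩, rfl⟩)
    · exact h' (hsub ⟨w, ⟨huw, le_rfl⟩, rfl⟩)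
  have hcomp : ∀ u w, 0 ≤ u → w ≤ L → IsCompact (Icc u w ∩ S ⁻¹' C) := fun u w hu hw =>
    isCompact_Icc.of_isClosed_subset
      ((hS.mono (Icc_subset_Icc hu hw)).preimage_isClosed_of_isClosed isClosed_Icc hC)
      inter_subset_left
  obtain ⟨t₁, ⟨ht₁, ht₁C⟩, hmax⟩ := (hcomp 0 v le_rfl hv.2).exists_isGreatest
    (key 0 v hv.1 le_rfl hv.2 ⟨hv.1, le_rfl⟩ (.inl h0))
  obtain ⟨t₂, ⟨ht₂, ht₂C⟩, hmin⟩ := (hcomp v L hv.1 le_rfl).exists_isLeast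
    (key v L hv.2 hv.1 le_rfl ⟨le_rfl, hv.2⟩ (.inr hL))
  refine ⟨t₁, t₂, ht₁.1, lt_of_le_of_ne ht₁.2 ?_, lt_of_le_of_ne ht₂.1 ?_, ht₂.2, ht₁C, ht₂C, ?_⟩
  · rintro rfl; exact hvC ht₁C
  · rintro rfl; exact hvC ht₂C
  · intro t ht htC
    rcases le_total t v with h' | h'
    · exact absurd (hmax ⟨⟨by linarith [ht.1, ht₁.1], h'⟩, htC⟩) (not_le.2 ht.1)
    · exact absurd (hmin ⟨⟨h', by linarith [ht.2, ht₂.2]⟩, htC⟩) (not_le.2 ht.2)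

end Network

/-! ### Length and visits of the patrolling tours -/

lemma IsTourOf.congr {Q : Type*} [MetricSpace Q] {Y : Set Q} {S S' : ℝ → Q} {L : ℝ}
    (h : IsTourOf Y S L) (hS : EqOn S' S (Icc 0 L)) : IsTourOf Y S' L := by
  obtain ⟨⟨hL, hd, he⟩, hi⟩ := h
  refine ⟨⟨hL, fun t ht t' ht' => ?_, ?_⟩, hS.image_eq.trans hi⟩
  · rw [hS ht, hS ht']; exact hd t ht t' ht'
  · rw [hS ⟨le_rfl, hL⟩, hS ⟨hL, le_rfl⟩, he]

namespace Network

variable {Q : Type*} [MetricSpace Q] {N : Network Q} {α : ℝ}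

lemma lam_union_le (Y Y' : Set Q) : N.lam (Y ∪ Y') ≤ N.lam Y + N.lam Y' := by
  rw [lam, lam, lam, ← Finset.sum_add_distrib]
  refine Finset.sum_le_sum fun a _ => ?_
  rw [preimage_union, inter_union_distrib_left]
  exact measureReal_union_le _ _

lemma isClosed_of_mem_extremityComponents {C : Set Q} (hC : C ∈ N.extremityComponents α) :
    IsClosed C := by
  obtain ⟨x, -, rfl⟩ := hC
  exact isClosed_closure.isClosed_connectedComponentIn x

lemma isPreconnected_of_mem_extremityComponents {C : Set Q} (hC : C ∈ N.extremityComponents α) :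
    IsPreconnected C := by
  obtain ⟨x, -, rfl⟩ := hC
  exact isPreconnected_connectedComponentIn

lemma subset_of_mem_extremityComponents {C : Set Q} (hC : C ∈ N.extremityComponents α) :
    C ⊆ closure (N.extremity α) := by
  obtain ⟨x, -, rfl⟩ := hC
  exact connectedComponentIn_subset _ _

lemma eq_of_mem_extremityComponents {C C' : Set Q} (hC : C ∈ N.extremityComponents α)
    (hC' : C' ∈ N.extremityComponents α) {x : Q} (hx : x ∈ C) (hx' : x ∈ C') : C = C' := by
  obtain ⟨y, -, rfl⟩ := hC
  obtain ⟨y', -, rfl⟩ := hC'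
  rw [connectedComponentIn_eq hx, connectedComponentIn_eq hx']

section Components

variable {k : ℕ} {C : Fin k → Set Q} (hinj : Function.Injective C)
  (hrange : range C = N.extremityComponents α)

include hrange in
lemma mem_extremityComponents_of_range (j : Fin k) : C j ∈ N.extremityComponents α :=
  hrange ▸ mem_range_self j

include hinj hrange in
lemma eq_of_mem_of_mem {i j : Fin k} {x : Q} (hi : x ∈ C i) (hj : x ∈ C j) : i = j :=
  hinj (eq_of_mem_extremityComponents (mem_extremityComponents_of_range hrange i)
    (mem_extremityComponents_of_range hrange j) hi hj)

include hrange in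
lemma iUnion_eq_closure_extremity : ⋃ j, C j = closure (N.extremity α) := by
  refine (iUnion_subset fun j => subset_of_mem_extremityComponents
    (mem_extremityComponents_of_range hrange j)).antisymm fun x hx => ?_
  have : connectedComponentIn (closure (N.extremity α)) x ∈ range C := hrange ▸ ⟨x, hx, rfl⟩
  obtain ⟨j, hj⟩ := this
  exact mem_iUnion.2 ⟨j, hj ▸ mem_connectedComponentIn hx⟩

include hinj hrange in
lemma sum_lam_eq : ∑ j, N.lam (C j) = N.lam (closure (N.extremity α)) := by
  borelize Q
  have hm : ∀ j, MeasurableSet (C j) := fun j =>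
    (isClosed_of_mem_extremityComponents (mem_extremityComponents_of_range hrange j)).measurableSet
  rw [← iUnion_eq_closure_extremity hrange, N.lam_eq_lengthMeasure (MeasurableSet.iUnion hm),
    measureReal_def, measure_iUnion ?_ hm, tsum_fintype,
    ENNReal.toReal_sum fun _ _ => measure_ne_top _ _]
  · exact Finset.sum_congr rfl fun j _ => N.lam_eq_lengthMeasure (hm j)
  · intro i j hij
    rw [Function.onFun, disjoint_left]
    exact fun x hi hj => hij (eq_of_mem_of_mem hinj hrange hi hj)

end Components

/-- The data of an `E`-patrolling tour `SE` obtained from the tour `S` by repeating the tours of the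
components `C j` of the closure of the extremity set. -/
structure IsRepetition (N : Network Q) (α : ℝ) (S : ℝ → Q) (L₀ : ℝ) {k : ℕ} (C : Fin k → Set Q)
    (b ℓ s : Fin k → ℝ) (SE : ℝ → Q) : Prop where
  isCPTOf : IsCPTOf univ S L₀
  start_notMem : S 0 ∉ closure (N.extremity α)
  injective : Function.Injective C
  range_eq : range C = N.extremityComponents α
  search : ∀ j, 0 ≤ b j ∧ b j + ℓ j ≤ L₀ ∧ IsCPTOf (C j) (fun u => S (b j + u)) (ℓ j)
  large : ∀ j, α / 2 ≤ N.lam (C j) → s j = b j + ℓ j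
  small : ∀ j, N.lam (C j) < α / 2 → b j + ℓ j < s j ∧ s j ≤ L₀ ∧ S (s j) ∈ C j ∧
    ∀ t ∈ Ioo (b j + ℓ j) (s j), S t ∉ C j
  base : ∀ t ∈ Icc 0 L₀, SE (insertShift s ℓ t) = S t
  loop : ∀ j, ∀ u ∈ Icc 0 (ℓ j), SE (insertShift s ℓ (s j) + u) = S (b j + u)

namespace IsRepetition

variable {S SE : ℝ → Q} {L₀ : ℝ} {k : ℕ} {C : Fin k → Set Q} {b ℓ s : Fin k → ℝ}
  (hN : N.IsTree) (hα : 0 < α) (hα' : α < 2 * N.mu) (hK : closure (N.extremity α) ≠ univ)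
  (h : N.IsRepetition α S L₀ C b ℓ s SE)

include h in
lemma mem_components (j : Fin k) : C j ∈ N.extremityComponents α :=
  mem_extremityComponents_of_range h.range_eq j

include hN h in
lemma length_eq : L₀ = 2 * N.mu :=
  hN.length_eq isClosed_univ N.isPreconnected_univ h.isCPTOf

include hN h in
lemma loop_length_eq (j : Fin k) : ℓ j = 2 * N.lam (C j) :=
  hN.length_eq (isClosed_of_mem_extremityComponents (h.mem_components j))
    (isPreconnected_of_mem_extremityComponents (h.mem_components j)) (h.search j).2.2

include hN h in
lemma sum_length_eq : ∑ j, ℓ j = 2 * N.lam (N.extremity α) := by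
  rw [← hN.lam_closure_extremity, ← sum_lam_eq h.injective h.range_eq, Finset.mul_sum]
  exact Finset.sum_congr rfl fun j _ => h.loop_length_eq hN j

include h in
lemma continuousOn : ContinuousOn S (Icc 0 L₀) :=
  IsUnitSpeedOn.continuousOn h.isCPTOf.1.1.2.1

include h in
lemma mem_of_mem_Icc {j : Fin k} {t : ℝ} (ht : t ∈ Icc (b j) (b j + ℓ j)) : S t ∈ C j := by
  rw [← (h.search j).2.2.1.2]
  exact ⟨t - b j, ⟨by linarith [ht.1], by linarith [ht.2]⟩, by simp⟩

include h in
lemma loop_length_nonneg (j : Fin k) : 0 ≤ ℓ j := (h.search j).2.2.1.1.1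

include h in
lemma apply_start_eq (j : Fin k) : S (b j) = S (b j + ℓ j) := by
  simpa using (h.search j).2.2.1.1.2.2

include h in
lemma le_insertion_time (j : Fin k) : b j + ℓ j ≤ s j := by
  rcases le_or_gt (α / 2) (N.lam (C j)) with hl | hl
  · exact (h.large j hl).ge
  · exact (h.small j hl).1.le

include h in
lemma apply_insertion_time_mem (j : Fin k) : S (s j) ∈ C j := by
  rcases le_or_gt (α / 2) (N.lam (C j)) with hl | hl
  · rw [h.large j hl]
    exact h.mem_of_mem_Icc ⟨by linarith [h.loop_length_nonneg j], le_rfl⟩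
  · exact (h.small j hl).2.2.1

include h in
-- Strict because the tour ends where it starts, outside the closure of `E`. This keeps the repeated
-- visits within the half-open period.
lemma insertion_time_lt (j : Fin k) : s j < L₀ := by
  have hle : s j ≤ L₀ := by
    rcases le_or_gt (α / 2) (N.lam (C j)) with hl | hl
    · exact (h.large j hl).trans_le (h.search j).2.1
    · exact (h.small j hl).2.1
  refine lt_of_le_of_ne hle fun e => h.start_notMem ?_
  rw [h.isCPTOf.1.1.2.2, ← e]
  exact subset_of_mem_extremityComponents (h.mem_components j) (h.apply_insertion_time_mem j)

include hN hα hα' hK h in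
-- The inserted copies fit: the excursion after the search of a small component leaves and returns
-- at its attaching point, so `S (s j)` is the base point of the loop. Different components have
-- different insertion times because they are disjoint.
lemma isInsertion : IsInsertion S L₀ s ℓ (fun j u => S (b j + u)) SE := by
  have hmu : 0 < N.mu := by linarith
  have hstart : ∀ j, S (b j) = S (s j) := by
    intro j
    rcases le_or_gt (α / 2) (N.lam (C j)) with hl | hl
    · rw [h.large j hl, h.apply_start_eq]
    · obtain ⟨p, hp⟩ := hN.exists_isHanging hmu hK (h.mem_components j)
      obtain ⟨h1, h2, h3, h4⟩ := h.small j hl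
      have h0 := h.loop_length_nonneg j
      have hb := (h.search j).1
      obtain ⟨e1, e2⟩ := hp.eq_of_excursion h1
        (h.continuousOn.mono (Icc_subset_Icc (by linarith) h2))
        (h.mem_of_mem_Icc ⟨by linarith, le_rfl⟩) h3 h4
      rw [h.apply_start_eq, e1, e2]
  refine ⟨h.loop_length_nonneg, fun j => ⟨?_, (h.insertion_time_lt j).le⟩, fun i j hij => ?_,
    fun j => by simpa using hstart j, fun j => by rw [← h.apply_start_eq, hstart], h.base, h.loop⟩
  · linarith [(h.search j).1, h.loop_length_nonneg j, h.le_insertion_time j]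
  · exact eq_of_mem_of_mem h.injective h.range_eq (h.apply_insertion_time_mem i)
      (hij ▸ h.apply_insertion_time_mem j)

include hN hα hα' hK h in
lemma isTourOf : IsTourOf univ SE (L₀ + ∑ j, ℓ j) := by
  have hi := h.isInsertion hN hα hα' hK
  refine ⟨hi.isClosedUnitSpeedPath h.isCPTOf.1.1 fun j => (h.search j).2.2.1.1, ?_⟩
  rw [hi.image_eq, h.isCPTOf.1.2, univ_union]

include hN hα hα' hK h in
lemma exists_visits_of_mem {x : Q} {j : Fin k} (hx : x ∈ C j) : ∃ t₁ t₂ : ℝ, 0 ≤ t₁ ∧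
    t₂ < L₀ + ∑ j, ℓ j ∧ SE t₁ = x ∧ SE t₂ = x ∧ α ≤ t₂ - t₁ ∧ t₂ - t₁ ≤ L₀ + ∑ j, ℓ j - α := by
  have hmu : 0 < N.mu := by linarith
  have hi := h.isInsertion hN hα hα' hK
  have hℓ := h.loop_length_nonneg
  have hL := h.length_eq hN
  have hj := h.loop_length_eq hN j
  obtain ⟨hb, hbL, hcpt⟩ := h.search j
  obtain ⟨u, hu, rfl⟩ : x ∈ (fun u => S (b j + u)) '' Icc 0 (ℓ j) := hcpt.1.2 ▸ hx
  have hbu : b j + u ∈ Icc 0 L₀ := ⟨by linarith [hu.1], by linarith [hu.2]⟩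
  -- The copies start at least `α` apart. For a large component the search alone lasts `2 * lam (C
  -- j) ≥ α`, and the second bound reduces to `α ≤ 2 * mu`; for a small one both bounds come from
  -- the excursion before `s j` and the rest of the tour.
  have hgap : α ≤ s j - b j ∧ s j - b j - ℓ j ≤ L₀ - α := by
    rcases le_or_gt (α / 2) (N.lam (C j)) with hl | hl
    · rw [h.large j hl]; constructor <;> linarith
    · obtain ⟨p, hp⟩ := hN.exists_isHanging hmu hK (h.mem_components j)
      obtain ⟨h1, h2, h3, h4⟩ := h.small j hl
      have h0 := hℓ j
      obtain ⟨e1, e2⟩ := hp.le_excursion hN h.isCPTOf.1 hL hb (by linarith) h1 h2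
        (fun t ht => h.mem_of_mem_Icc ht) (h.apply_start_eq j) h3 h4
        (fun z hz => hp.exists_notMem_component hN hl hz)
      constructor <;> linarith
  have hle : b j + u ≤ s j := by linarith [hu.2, h.le_insertion_time j]
  have h1 := sub_le_insertShift_sub (s := s) hℓ hle
  have h2 := insertShift_add_le_add_sum (s := s) hℓ j
  have h3 := le_insertShift (s := s) hℓ (b j + u)
  have h4 := h.insertion_time_lt j
  refine ⟨insertShift s ℓ (b j + u), insertShift s ℓ (s j) + u, (hi.insertShift_mem hbu).1, ?_,
    h.base _ hbu, h.loop j u hu, ?_, ?_⟩ <;> linarith [hu.1, hu.2]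

include hN hα hα' hK h in
lemma exists_visits_of_notMem {x : Q} (hx : x ∉ closure (N.extremity α)) : ∃ t₁ t₂ : ℝ, 0 ≤ t₁ ∧
    t₂ < L₀ + ∑ j, ℓ j ∧ SE t₁ = x ∧ SE t₂ = x ∧ α ≤ t₂ - t₁ ∧ t₂ - t₁ ≤ L₀ + ∑ j, ℓ j - α := by
  have hmu : 0 < N.mu := by linarith
  have hi := h.isInsertion hN hα hα' hK
  have hℓ := h.loop_length_nonneg
  have hL := h.length_eq hN
  have hx' := N.isHanging_singleton hmu hx
  have hlam : N.lam {x} < α / 2 := by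
    rw [N.lam_of_finite (finite_singleton x)]; linarith
  have hbr : ∀ z, z ∉ ({x} : Set Q) → ∃ z', z' ∉ ({x} : Set Q) ∧
      z' ∉ connectedComponentIn {x}ᶜ z := fun z hz => hx'.exists_notMem_component hN hlam hz
  -- A branch at `x` that does not contain the starting point is visited in an excursion that begins
  -- and ends at `x`.
  obtain ⟨z, hzx, hz⟩ : ∃ z, z ∉ ({x} : Set Q) ∧ S 0 ∉ connectedComponentIn {x}ᶜ z := by
    by_cases h0 : S 0 = x
    · have hne : ({x} : Set Q) ≠ univ := fun e => by
        have := N.lam_of_finite (finite_singleton x)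
        rw [e] at this
        exact hmu.ne' this
      obtain ⟨z, hz⟩ := (ne_univ_iff_exists_notMem _).1 hne
      exact ⟨z, hz, h0 ▸ notMem_connectedComponentIn_compl _ _⟩
    · obtain ⟨z, hz, hz'⟩ := hbr (S 0) h0
      refine ⟨z, hz, fun hmem => hz' ?_⟩
      rw [← connectedComponentIn_eq hmem]
      exact mem_connectedComponentIn hz
  obtain ⟨v, hv, rfl⟩ : z ∈ S '' Icc 0 L₀ := h.isCPTOf.1.2 ▸ mem_univ z
  obtain ⟨t₁, t₂, h1, h1v, hv2, h2, hS1, hS2, hex⟩ := exists_excursion h.continuousOn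
    isClosed_singleton hv hzx hz (by rwa [← h.isCPTOf.1.1.2.2])
  have h12 := h1v.trans hv2
  obtain ⟨e1, e2⟩ := hx'.le_excursion hN h.isCPTOf.1 hL h1 le_rfl h12 h2
    (fun t ht => by rwa [le_antisymm ht.2 ht.1]) rfl hS2 hex hbr
  rw [mem_singleton_iff] at hS1 hS2
  have ht1 : t₁ ∈ Icc 0 L₀ := ⟨h1, h12.le.trans h2⟩
  have ht2 : t₂ ∈ Icc 0 L₀ := ⟨h1.trans h12.le, h2⟩
  have f1 := sub_le_insertShift_sub (s := s) hℓ h12.le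
  have f2 := insertShift_le (s := s) hℓ t₁
  have f3 := insertShift_le (s := s) hℓ t₂
  have f4 := le_insertShift (s := s) hℓ t₁
  -- An excursion ending at `L₀` would give a visit at the excluded end of the period; time `0`
  -- replaces it, and the two gaps change roles.
  rcases eq_or_lt_of_le h2 with e | hlt
  · refine ⟨0, insertShift s ℓ t₁, le_rfl, by linarith, ?_, (h.base _ ht1).trans hS1, by linarith,
      by linarith⟩
    rw [hi.apply_zero h.isCPTOf.1.1.1, h.isCPTOf.1.1.2.2, ← e, hS2]
  · exact ⟨insertShift s ℓ t₁, insertShift s ℓ t₂, by linarith, by linarith,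
      (h.base _ ht1).trans hS1, (h.base _ ht2).trans hS2, by linarith, by linarith⟩

include hN hα hα' hK h in
lemma exists_visits (x : Q) : ∃ t₁ t₂ : ℝ, 0 ≤ t₁ ∧
    t₂ < L₀ + ∑ j, ℓ j ∧ SE t₁ = x ∧ SE t₂ = x ∧ α ≤ t₂ - t₁ ∧ t₂ - t₁ ≤ L₀ + ∑ j, ℓ j - α := by
  by_cases hx : x ∈ closure (N.extremity α)
  · rw [← iUnion_eq_closure_extremity h.range_eq] at hx
    obtain ⟨j, hj⟩ := mem_iUnion.1 hx
    exact h.exists_visits_of_mem hN hα hα' hK hj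
  · exact h.exists_visits_of_notMem hN hα hα' hK hx

end IsRepetition

end Network

/-! ### Existence of patrolling tours -/

namespace Network

variable {Q : Type*} [MetricSpace Q] {N : Network Q} {α : ℝ}

section Core

variable {k : ℕ} {C : Fin k → Set Q} {p : Fin k → Q} (hinj : Function.Injective C)
  (hrange : range C = N.extremityComponents α) (hp : ∀ j, N.IsHanging α (C j) (p j))

include hinj hrange hp in
lemma attachingPoint_notMem_interior (i j : Fin k) : p i ∉ interior (C j) := by
  intro hi
  obtain rfl := eq_of_mem_of_mem hinj hrange (hp i).mem (interior_subset hi)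
  have : p i ∈ frontier (C i) := by rw [(hp i).frontier_eq]; rfl
  exact this.2 hi

include hp in
lemma eq_attachingPoint {j : Fin k} {x : Q} (hx : x ∈ C j) (hx' : x ∉ interior (C j)) :
    x = p j := by
  have : x ∈ frontier (C j) := ⟨subset_closure hx, hx'⟩
  rwa [(hp j).frontier_eq] at this

include hinj hrange hp in
/-- Removing the components of the closure of the extremity set, except for their attaching points,
leaves a connected set. -/
lemma isPreconnected_core : IsPreconnected (⋃ j, interior (C j))ᶜ := by
  classical
  set Z := (⋃ j, interior (C j))ᶜ with hZ
  have hpZ : ∀ j, p j ∈ Z := fun j hj => by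
    obtain ⟨i, hi⟩ := mem_iUnion.1 hj
    exact attachingPoint_notMem_interior hinj hrange hp j i hi
  -- `ρ` collapses each component to its attaching point. It is continuous by pasting on finitely
  -- many closed sets, so its image, the core, is connected.
  set ρ : Q → Q := fun x => if h : ∃ j, x ∈ C j then p h.choose else x with hρ
  have hρC : ∀ j, ∀ x ∈ C j, ρ x = p j := by
    intro j x hx
    have hex : ∃ j, x ∈ C j := ⟨j, hx⟩
    simp only [hρ, dif_pos hex]
    rw [eq_of_mem_of_mem hinj hrange hex.choose_spec hx]
  have hρZ : ∀ x ∈ Z, ρ x = x := by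
    intro x hx
    by_cases hex : ∃ j, x ∈ C j
    · obtain ⟨j, hj⟩ := hex
      rw [hρC j x hj]
      exact (eq_attachingPoint hp hj fun h' => hx (mem_iUnion.2 ⟨j, h'⟩)).symm
    · simp only [hρ, dif_neg hex]
  have hcov : ∀ x, x ∈ Z ∨ ∃ j, x ∈ C j := by
    intro x
    by_cases hx : x ∈ Z
    · exact .inl hx
    · rw [hZ, notMem_compl_iff, mem_iUnion] at hx
      obtain ⟨j, hj⟩ := hx
      exact .inr ⟨j, interior_subset hj⟩
  have hcont : Continuous ρ := by
    refine LocallyFinite.continuous (f := fun o : Option (Fin k) => o.elim Z C)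
      (locallyFinite_of_finite _) ?_ ?_ ?_
    · rw [eq_univ_iff_forall]
      intro x
      rcases hcov x with h | ⟨j, h⟩
      exacts [mem_iUnion.2 ⟨none, h⟩, mem_iUnion.2 ⟨some j, h⟩]
    · rintro (_ | j)
      exacts [(isOpen_iUnion fun j => isOpen_interior).isClosed_compl, (hp j).isClosed]
    · rintro (_ | j)
      · exact continuousOn_id.congr hρZ
      · exact continuousOn_const.congr (hρC j)
  have himg : ρ '' univ = Z := by
    refine Subset.antisymm ?_ fun x hx => ⟨x, mem_univ x, hρZ x hx⟩
    rintro _ ⟨x, -, rfl⟩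
    rcases hcov x with h | ⟨j, h⟩
    · rwa [hρZ x h]
    · rw [hρC j x h]; exact hpZ j
  rw [← himg]
  exact N.isPreconnected_univ.image _ hcont.continuousOn

end Core

/-- The tour `S` is a CPT `T` of the core with a CPT of each component inserted at its attaching
point. For a small component this happens just before an excursion of `T`, so that the return of `T`
determines the time of the second copy. -/
theorem IsTree.exists_isRepetition (hN : N.IsTree) (hα : 0 < α) (hα' : α < 2 * N.mu)
    (hK : closure (N.extremity α) ≠ univ) : ∃ (S : ℝ → Q) (L₀ : ℝ) (k : ℕ) (C : Fin k → Set Q)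
      (b ℓ s : Fin k → ℝ) (SE : ℝ → Q), N.IsRepetition α S L₀ C b ℓ s SE ∧ S 0 ∉ N.nodes := by
  classical
  have hmu : 0 < N.mu := by linarith
  have := (hN.finite_extremityComponents α).to_subtype
  obtain ⟨k, ⟨e⟩⟩ := Finite.exists_equiv_fin (N.extremityComponents α)
  set C : Fin k → Set Q := fun j => (e.symm j).1 with hC
  have hinj : Function.Injective C := Subtype.val_injective.comp e.symm.injective
  have hrange : range C = N.extremityComponents α := by
    rw [show C = Subtype.val ∘ e.symm from rfl, e.symm.surjective.range_comp, Subtype.range_coe]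
  have hCmem := mem_extremityComponents_of_range hrange
  choose p hp using fun j => hN.exists_isHanging hmu hK (hCmem j)
  have hCK : ∀ j, C j ⊆ closure (N.extremity α) := fun j =>
    subset_of_mem_extremityComponents (hCmem j)
  obtain ⟨r₀, hr₀⟩ := (ne_univ_iff_exists_notMem _).1 hK
  obtain ⟨r, hrK, hrn⟩ := hN.exists_regular_of_isOpen hmu isClosed_closure.isOpen_compl hr₀
  set Z : Set Q := (⋃ j, interior (C j))ᶜ with hZ
  have hZc : IsClosed Z := (isOpen_iUnion fun j => isOpen_interior).isClosed_compl
  have hKZ : ∀ x, x ∉ closure (N.extremity α) → x ∈ Z := by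
    intro x hx hx'
    obtain ⟨j, hj⟩ := mem_iUnion.1 hx'
    exact hx (hCK j (interior_subset hj))
  have hZC : ∀ j, ∀ x ∈ Z, x ∈ C j → x = p j := fun j x hx hxC =>
    eq_attachingPoint hp hxC fun h' => hx (mem_iUnion.2 ⟨j, h'⟩)
  have hpZ : ∀ j, p j ∈ Z := fun j hj => by
    obtain ⟨i, hi⟩ := mem_iUnion.1 hj
    exact attachingPoint_notMem_interior hinj hrange hp j i hi
  obtain ⟨T, hT, hT0⟩ := hN.exists_isTourOf hZc (isPreconnected_core hinj hrange hp) (hKZ r hrK)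
  set LZ := 2 * N.lam Z with hLZ
  have hTc : ContinuousOn T (Icc 0 LZ) := IsUnitSpeedOn.continuousOn hT.1.2.1
  have hTZ : ∀ t ∈ Icc 0 LZ, T t ∈ Z := fun t ht => hT.2 ▸ mem_image_of_mem T ht
  have hTsurj : ∀ x ∈ Z, ∃ t ∈ Icc 0 LZ, T t = x := fun x hx => by
    rw [← hT.2] at hx; exact hx
  -- For a large component any visit to `p j` will do, and `t'` is a dummy. A small one has a branch
  -- without `r`, whose visit by `T` is an excursion from `p j`.
  have htime : ∀ j, ∃ t ∈ Icc 0 LZ, T t = p j ∧ ∃ t', N.lam (C j) < α / 2 → t < t' ∧ t' ≤ LZ ∧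
      T t' = p j ∧ ∀ w ∈ Ioo t t', T w ∉ C j := by
    intro j
    rcases le_or_gt (α / 2) (N.lam (C j)) with hl | hl
    · obtain ⟨t, ht, h⟩ := hTsurj _ (hpZ j)
      exact ⟨t, ht, h, 0, fun h' => absurd hl (not_le.2 h')⟩
    · have hrC : r ∉ C j := fun h => hrK (hCK j h)
      obtain ⟨z, hzC, hz⟩ := (hp j).exists_notMem_component hN hl hrC
      obtain ⟨a, s, -, A, D, -, hx, hxK, -⟩ := (hp j).exists_separating hN hzC one_pos
      obtain ⟨v, hv, hv'⟩ := hTsurj _ (hKZ _ hxK)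
      rw [← hv'] at hx
      have hvr : T 0 ∉ connectedComponentIn (C j)ᶜ (T v) := by
        rw [← connectedComponentIn_eq hx, hT0]
        intro hmem
        refine hz ?_
        rw [← connectedComponentIn_eq hmem]
        exact mem_connectedComponentIn hzC
      obtain ⟨t₁, t₂, h1, h1v, hv2, h2, hS1, hS2, hex⟩ := exists_excursion hTc (hp j).isClosed hv
        (connectedComponentIn_subset _ _ hx) hvr (by rwa [← hT.1.2.2])
      have ht1 : t₁ ∈ Icc 0 LZ := ⟨h1, by linarith⟩
      exact ⟨t₁, ht1, hZC j _ (hTZ _ ht1) hS1, t₂, fun _ => ⟨by linarith, h2,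
        hZC j _ (hTZ _ ⟨by linarith, h2⟩) hS2, hex⟩⟩
  choose t ht htp t' ht' using htime
  have htinj : Function.Injective t := by
    intro i j hij
    refine eq_of_mem_of_mem hinj hrange (x := p i) (hp i).mem ?_
    rw [← htp i, hij, htp j]
    exact (hp j).mem
  choose c hc hc0 using fun j => hN.exists_isTourOf (hp j).isClosed (hp j).isPreconnected (hp j).mem
  set ℓ : Fin k → ℝ := fun j => 2 * N.lam (C j) with hℓdef
  have hℓ : ∀ j, 0 ≤ ℓ j := fun j => mul_nonneg zero_le_two (N.lam_nonneg _)
  have hcℓ : ∀ j, c j (ℓ j) = p j := fun j => by rw [← hc0 j]; exact (hc j).1.2.2.symm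
  obtain ⟨S, hS⟩ := exists_isInsertion (T := T) (L := LZ) (s := t) (ℓ := ℓ) (c := c) hℓ ht htinj
    (fun j => by rw [hc0, htp]) (fun j => by rw [hcℓ, htp])
  set L₀ := LZ + ∑ j, ℓ j with hL₀
  have hS0 : S 0 = r := (hS.apply_zero hT.1.1).trans hT0
  have hcC : ∀ j, ∀ u ∈ Icc 0 (ℓ j), c j u ∈ C j := fun j u hu =>
    (hc j).2 ▸ mem_image_of_mem (c j) hu
  have hStour : IsTourOf univ S L₀ := by
    refine ⟨hS.isClosedUnitSpeedPath hT.1 fun j => (hc j).1, ?_⟩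
    rw [hS.image_eq, hT.2, eq_univ_iff_forall]
    intro x
    by_cases hx : x ∈ Z
    · exact .inl hx
    · rw [hZ, notMem_compl_iff, mem_iUnion] at hx
      obtain ⟨j, hj⟩ := hx
      refine .inr (mem_iUnion.2 ⟨j, ?_⟩)
      rw [(hc j).2]
      exact interior_subset hj
  -- The core and the components overlap only in the finitely many attaching points, so their
  -- lengths add up to at most `mu`.
  have hL₀mu : L₀ = 2 * N.mu := by
    refine le_antisymm ?_ (hN.two_mul_lam_le hStour)
    have h1 : ∑ j, ℓ j = 2 * N.lam (closure (N.extremity α)) := by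
      rw [← sum_lam_eq hinj hrange, Finset.mul_sum]
    have h2 := lam_eq_add_compl (N := N) hZc
    have h3 : closure (N.extremity α) ⊆ Zᶜ ∪ range p := by
      rw [← iUnion_eq_closure_extremity hrange]
      refine iUnion_subset fun j x hx => ?_
      by_cases hxZ : x ∈ Z
      · exact .inr ⟨j, (hZC j x hxZ hx).symm⟩
      · exact .inl hxZ
    have h4 := (N.lam_mono h3).trans (lam_union_le _ _)
    rw [N.lam_of_finite (finite_range p)] at h4
    linarith
  set b : Fin k → ℝ := fun j => insertShift t ℓ (t j) with hb
  set s : Fin k → ℝ := fun j => if N.lam (C j) < α / 2 then insertShift t ℓ (t' j)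
    else b j + ℓ j with hs
  have hsearch : ∀ j, EqOn (fun u => S (b j + u)) (c j) (Icc 0 (ℓ j)) := fun j u hu =>
    hS.loop j u hu
  have hbmem : ∀ j, ∀ u ∈ Icc 0 (ℓ j), b j + u ∈ Icc 0 L₀ := fun j u hu =>
    hS.insertShift_add_mem hu
  have hsmall : ∀ j, N.lam (C j) < α / 2 → s j = insertShift t ℓ (t' j) := fun j hj => by
    simp only [hs, if_pos hj]
  have hlarge : ∀ j, ¬ N.lam (C j) < α / 2 → s j = b j + ℓ j := fun j hj => by
    simp only [hs, if_neg hj]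
  have ht'mem : ∀ j, N.lam (C j) < α / 2 → t' j ∈ Icc 0 LZ := fun j hj =>
    ⟨(ht j).1.trans (ht' j hj).1.le, (ht' j hj).2.1⟩
  have hsmem : ∀ j, s j ∈ Icc 0 L₀ := by
    intro j
    by_cases hj : N.lam (C j) < α / 2
    · rw [hsmall j hj]; exact hS.insertShift_mem (ht'mem j hj)
    · rw [hlarge j hj]; exact hbmem j _ ⟨hℓ j, le_rfl⟩
  have hSs : ∀ j, S (s j) = p j := by
    intro j
    by_cases hj : N.lam (C j) < α / 2
    · rw [hsmall j hj, hS.base _ (ht'mem j hj), (ht' j hj).2.2.1]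
    · rw [hlarge j hj, hS.loop j _ ⟨hℓ j, le_rfl⟩, hcℓ]
  have hsinj : Function.Injective s := by
    intro i j hij
    refine eq_of_mem_of_mem hinj hrange (x := p i) (hp i).mem ?_
    rw [← hSs i, hij, hSs j]
    exact (hp j).mem
  obtain ⟨SE, hSE⟩ := exists_isInsertion (T := S) (L := L₀) (s := s) (ℓ := ℓ)
    (c := fun j u => S (b j + u)) hℓ hsmem hsinj
    (fun j => by rw [hSs, hS.loop j 0 ⟨le_rfl, hℓ j⟩, hc0])
    (fun j => by rw [hSs, hS.loop j _ ⟨hℓ j, le_rfl⟩, hcℓ])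
  refine ⟨S, L₀, k, C, b, ℓ, s, SE, ⟨hL₀mu ▸ hN.isCPTOf (Y := univ) (hL₀mu ▸ hStour), hS0 ▸ hrK, hinj,
    hrange, fun j => ⟨?_, ?_, ?_⟩, fun j hj => hlarge j (not_lt.2 hj), ?_, hSE.base, hSE.loop⟩,
    hS0 ▸ hrn⟩
  · simpa using (hbmem j 0 ⟨le_rfl, hℓ j⟩).1
  · exact (hbmem j _ ⟨hℓ j, le_rfl⟩).2
  · exact hN.isCPTOf ((hc j).congr (hsearch j))
  · intro j hj
    obtain ⟨h1, h2, h3, h4⟩ := ht' j hj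
    refine ⟨?_, (hsmem j).2, hSs j ▸ (hp j).mem, ?_⟩
    · rw [hsmall j hj]
      linarith [insertShift_add_le hℓ h1]
    · intro τ hτ hτC
      rw [hsmall j hj] at hτ
      have hτm : τ ∈ Icc 0 L₀ := ⟨by linarith [(hbmem j _ ⟨hℓ j, le_rfl⟩).1, hτ.1],
        hτ.2.le.trans (hS.insertShift_mem (ht'mem j hj)).2⟩
      -- No earlier return is possible: base times belong to the excursion of `T`, loops of other
      -- components are disjoint from `C j`, and the loop of `C j` is over.
      rcases hS.exists_time hτm with ⟨w, hw, rfl⟩ | ⟨i, u, hu, rfl⟩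
      · rw [hS.base w hw] at hτC
        refine h4 w ⟨?_, ?_⟩ hτC
        · by_contra! hwt
          linarith [sub_le_insertShift_sub (s := t) hℓ hwt, hτ.1, hℓ j]
        · by_contra! hwt
          linarith [sub_le_insertShift_sub (s := t) hℓ hwt, hτ.2]
      · rw [hS.loop i u hu] at hτC
        obtain rfl := eq_of_mem_of_mem hinj hrange (hcC i u hu) hτC
        linarith [hτ.1, hu.2]

end Network

/-! ### From visits to interception probabilities -/

section Probability

variable {Q : Type*} {S : ℝ → Q} {L α τ : ℝ}

/-- A set of starting phases in one period for which the attack is intercepted gives a lower bound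
of the interception probability. -/
lemma volume_div_le_interceptionProb (hL : 0 < L) {x : Q} {X : Set ℝ} {a : ℝ}
    (hX : MeasurableSet X) (hXa : X ⊆ Ioc a (a + L))
    (h : ∀ Δ ∈ X, ∃ t ∈ Icc τ (τ + α), periodicExtension S L (t + Δ) = x) :
    volume.real X / L ≤ interceptionProb S L α x τ := by
  have hper := periodic_periodicExtension S L
  -- The periodic set generated by `X` has the same measure in every period; this moves the phases
  -- from `(a, a + L]` to `(0, L]`.
  set P : Set ℝ := ⋃ n : ℤ, (fun Δ => Δ + n * L) ⁻¹' X with hP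
  have hPm : MeasurableSet P := MeasurableSet.iUnion fun n =>
    hX.preimage (by fun_prop)
  have hPper : Function.Periodic (P.indicator (fun _ => (1 : ℝ))) L := by
    intro Δ
    have : Δ + L ∈ P ↔ Δ ∈ P := by
      simp only [hP, mem_iUnion, mem_preimage]
      constructor
      · rintro ⟨n, hn⟩
        exact ⟨n + 1, by push_cast; convert hn using 1; ring⟩
      · rintro ⟨n, hn⟩
        exact ⟨n - 1, by push_cast; convert hn using 1; ring⟩
    by_cases hΔ : Δ ∈ P
    · rw [indicator_of_mem hΔ, indicator_of_mem (this.2 hΔ)]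
    · rw [indicator_of_notMem hΔ, indicator_of_notMem (mt this.1 hΔ)]
  have hint := hPper.intervalIntegral_add_eq a 0
  rw [intervalIntegral.integral_of_le (by linarith), intervalIntegral.integral_of_le (by linarith),
    integral_indicator hPm, integral_indicator hPm, zero_add] at hint
  simp only [integral_const, smul_eq_mul, mul_one, measureReal_restrict_apply_univ,
    measureReal_restrict_apply hPm] at hint
  have hsub : P ⊆ {Δ | ∃ t ∈ Icc τ (τ + α), periodicExtension S L (t + Δ) = x} := by
    intro Δ hΔ
    obtain ⟨n, hn⟩ := mem_iUnion.1 hΔ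
    obtain ⟨t, ht, he⟩ := h _ hn
    refine ⟨t, ht, ?_⟩
    have := hper.int_mul n (t + Δ)
    rw [← this, ← he]
    congr 1
    ring
  have hXP : X ⊆ P ∩ Ioc a (a + L) := fun Δ hΔ =>
    ⟨mem_iUnion.2 ⟨0, by simpa using hΔ⟩, hXa hΔ⟩
  rw [interceptionProb, measureReal_def _ {Δ | _}, ProbabilityTheory.cond_apply measurableSet_Icc,
    ENNReal.toReal_mul, ENNReal.toReal_inv, Real.volume_Icc, sub_zero, ENNReal.toReal_ofReal hL.le,
    div_eq_inv_mul]
  gcongr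
  calc volume.real X ≤ volume.real (P ∩ Ioc a (a + L)) :=
        measureReal_mono hXP (measure_ne_top_of_subset inter_subset_right (by simp))
    _ = volume.real (P ∩ Ioc 0 L) := hint
    _ ≤ volume.real (Icc 0 L ∩ {Δ | ∃ t ∈ Icc τ (τ + α), periodicExtension S L (t + Δ) = x}) :=
        measureReal_mono (fun Δ hΔ => ⟨Ioc_subset_Icc_self hΔ.2, hsub hΔ.1⟩)
          (measure_ne_top_of_subset inter_subset_left (by simp))

/-- A visit at time `t` intercepts for an interval of phases of length `α`. Taking it half-open
makes the intervals of two visits exactly `α` apart disjoint. -/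
lemma intercepted_of_mem_Ioc {x : Q} {t Δ : ℝ} (ht : periodicExtension S L t = x)
    (hΔ : Δ ∈ Ioc (t - τ - α) (t - τ)) :
    ∃ t' ∈ Icc τ (τ + α), periodicExtension S L (t' + Δ) = x :=
  ⟨t - Δ, ⟨by linarith [hΔ.2], by linarith [hΔ.1]⟩, by rwa [sub_add_cancel]⟩

lemma div_le_interceptionProb (hL : 0 < L) (hα : 0 ≤ α) (hαL : α ≤ L) {x : Q} {t : ℝ}
    (ht : periodicExtension S L t = x) : α / L ≤ interceptionProb S L α x τ := by
  have := volume_div_le_interceptionProb (S := S) (τ := τ) (α := α) hL (x := x)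
    (X := Ioc (t - τ - α) (t - τ)) (a := t - τ - α) measurableSet_Ioc
    (Ioc_subset_Ioc_right (by linarith)) fun Δ hΔ => intercepted_of_mem_Ioc ht hΔ
  rwa [Real.volume_real_Ioc_of_le (by linarith), sub_sub_cancel] at this

lemma two_mul_div_le_interceptionProb (hL : 0 < L) (hα : 0 ≤ α) {x : Q} {t₁ t₂ : ℝ}
    (h₁ : periodicExtension S L t₁ = x) (h₂ : periodicExtension S L t₂ = x)
    (hle : α ≤ t₂ - t₁) (hle' : t₂ - t₁ ≤ L - α) :
    2 * α / L ≤ interceptionProb S L α x τ := by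
  have := volume_div_le_interceptionProb (S := S) (τ := τ) (α := α) hL (x := x)
    (X := Ioc (t₁ - τ - α) (t₁ - τ) ∪ Ioc (t₂ - τ - α) (t₂ - τ)) (a := t₁ - τ - α)
    (measurableSet_Ioc.union measurableSet_Ioc)
    (union_subset (Ioc_subset_Ioc_right (by linarith)) (Ioc_subset_Ioc (by linarith) (by linarith)))
    (by
      rintro Δ (hΔ | hΔ)
      exacts [intercepted_of_mem_Ioc h₁ hΔ, intercepted_of_mem_Ioc h₂ hΔ])
  rwa [measureReal_union (Ioc_disjoint_Ioc_of_le (by linarith)) measurableSet_Ioc (by simp) (by simp),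
    Real.volume_real_Ioc_of_le (by linarith), Real.volume_real_Ioc_of_le (by linarith),
    sub_sub_cancel, sub_sub_cancel, ← two_mul] at this

end Probability

/-! ### Several periods as a tour, and the theorem -/

lemma IsTourOf.periodicExtension {Q : Type*} [MetricSpace Q] {Y : Set Q} {S : ℝ → Q} {L : ℝ}
    (h : IsTourOf Y S L) (n : ℕ) (hn : 0 < n) : IsTourOf Y (periodicExtension S L) (n * L) := by
  have hper := periodic_periodicExtension S L
  have heq : EqOn (_root_.periodicExtension S L) S (Icc 0 L) := fun t ht =>
    periodicExtension_of_mem h.1.1 h.1.2.2 ht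
  have hnL := (hper.nat_mul n)
  refine ⟨⟨mul_nonneg n.cast_nonneg h.1.1, fun t _ t' _ => ?_, ?_⟩, ?_⟩
  · simpa [Real.dist_eq] using h.1.lipschitzWith.dist_le_mul t t'
  · have := hnL 0
    rw [zero_add] at this
    exact this.symm
  · rw [← h.2, ← heq.image_eq]
    rcases eq_or_lt_of_le h.1.1 with hL | hL
    · rw [← hL, mul_zero]
    · have hn' : (0 : ℝ) < n := by exact_mod_cast hn
      have h1 := hnL.image_Icc (mul_pos hn' hL) 0
      have h2 := hper.image_Icc hL 0
      rw [zero_add] at h1 h2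
      rw [h1, h2]

theorem mainTheorem10 {Q : Type*} [MetricSpace Q] (N : Network Q) (hN : N.IsTree)
    (α : ℝ) (hα : 0 < α) (hα' : α < 2 * N.mu) :
    (∃ (S : ℝ → Q) (L : ℝ), N.IsEPatrollingTour α S L) ∧
    ∀ (S : ℝ → Q) (L : ℝ), N.IsEPatrollingTour α S L →
      (closure (N.extremity α) ≠ Set.univ → L = 2 * (N.mu + N.lam (N.extremity α))) ∧
      (closure (N.extremity α) = Set.univ → L = N.mu + N.lam (N.extremity α)) ∧
      IsTourOf Set.univ (periodicExtension S L) (2 * (N.mu + N.lam (N.extremity α))) ∧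
      (∀ x : Q, ∃ t₁ t₂ : ℝ, 0 ≤ t₁ ∧ t₂ < 2 * (N.mu + N.lam (N.extremity α)) ∧
        periodicExtension S L t₁ = x ∧ periodicExtension S L t₂ = x ∧
        α ≤ t₂ - t₁ ∧ t₂ - t₁ ≤ 2 * (N.mu + N.lam (N.extremity α)) - α) ∧
      ∀ (x : Q) (τ : ℝ), 0 ≤ τ →
        α / (N.mu + N.lam (N.extremity α)) ≤ interceptionProb S L α x τ := by
  have hmu : 0 < N.mu := by linarith
  have hlam : 0 ≤ N.lam (N.extremity α) := N.lam_nonneg _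
  constructor
  · by_cases hK : closure (N.extremity α) = univ
    · obtain ⟨x, -⟩ := N.nodes_nonempty
      obtain ⟨S, hS, -⟩ := hN.exists_isTourOf isClosed_univ N.isPreconnected_univ (mem_univ x)
      exact ⟨S, _, .inl ⟨hK, hN.isCPTOf hS⟩⟩
    · obtain ⟨S, L₀, k, C, b, ℓ, s, SE, h, hn⟩ := hN.exists_isRepetition hα hα' hK
      exact ⟨SE, L₀ + ∑ j, ℓ j, .inr ⟨hK, S, L₀, k, C, b, ℓ, s, h.isCPTOf, hn, h.start_notMem,
        h.injective, h.range_eq, h.search, h.large, h.small, rfl, h.base, h.loop⟩⟩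
  · rintro S L (⟨hK, hS⟩ | ⟨hK, S₀, L₀, k, C, b, ℓ, s, h1, -, h2, h3, h4, h5, h6, h7, rfl, h8, h9⟩)
    -- If the closure of `E` is `Q`, then `mu + lam E` is the length `2 * mu` of a CPT. One visit
    -- per period suffices for the probability, and the two visits of the doubled tour are one
    -- period apart, which exceeds `α`.
    · have hL := hN.length_eq isClosed_univ N.isPreconnected_univ hS
      change L = 2 * N.mu at hL
      have hE : N.lam (N.extremity α) = N.mu := by rw [← hN.lam_closure_extremity, hK]; rfl
      have hper := periodic_periodicExtension S L
      have hvisit : ∀ x, ∃ t, 0 ≤ t ∧ t < L ∧ periodicExtension S L t = x := by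
        intro x
        obtain ⟨t, ht, rfl⟩ : x ∈ S '' Icc 0 L := hS.1.2 ▸ mem_univ x
        rcases eq_or_lt_of_le ht.2 with rfl | hlt
        · refine ⟨0, le_rfl, by linarith, ?_⟩
          rw [periodicExtension_of_mem ht.1 hS.1.1.2.2 ⟨le_rfl, ht.1⟩, hS.1.1.2.2]
        · exact ⟨t, ht.1, hlt, periodicExtension_of_mem (by linarith) hS.1.1.2.2 ht⟩
      rw [hE]
      refine ⟨fun h => absurd hK h, fun _ => by linarith, ?_, fun x => ?_, fun x τ _ => ?_⟩
      · have := hS.1.periodicExtension 2 two_pos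
        rwa [hL, Nat.cast_two, ← two_mul, ← hL] at *
      · obtain ⟨t, h0, hlt, rfl⟩ := hvisit x
        exact ⟨t, t + L, h0, by linarith, rfl, hper t, by linarith, by linarith⟩
      · obtain ⟨t, h0, hlt, ht⟩ := hvisit x
        have := div_le_interceptionProb (τ := τ) (show 0 < L by linarith) hα.le (by linarith) ht
        rwa [show N.mu + N.mu = L by linarith]
    · have h : N.IsRepetition α S₀ L₀ C b ℓ s S := ⟨h1, h2, h3, h4, h5, h6, h7, h8, h9⟩
      have hL : L₀ + ∑ j, ℓ j = 2 * (N.mu + N.lam (N.extremity α)) := by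
        rw [h.length_eq hN, h.sum_length_eq hN]; ring
      have htour := h.isTourOf hN hα hα' hK
      have hvisit : ∀ x, ∃ t₁ t₂ : ℝ, 0 ≤ t₁ ∧ t₂ < 2 * (N.mu + N.lam (N.extremity α)) ∧
          periodicExtension S (L₀ + ∑ j, ℓ j) t₁ = x ∧ periodicExtension S (L₀ + ∑ j, ℓ j) t₂ = x ∧
          α ≤ t₂ - t₁ ∧ t₂ - t₁ ≤ 2 * (N.mu + N.lam (N.extremity α)) - α := by
        intro x
        obtain ⟨t₁, t₂, e1, e2, e3, e4, e5, e6⟩ := h.exists_visits hN hα hα' hK x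
        have hmem : ∀ t, 0 ≤ t → t < L₀ + ∑ j, ℓ j →
            periodicExtension S (L₀ + ∑ j, ℓ j) t = S t := fun t ht ht' =>
          periodicExtension_of_mem htour.1.1 htour.1.2.2 ⟨ht, ht'.le⟩
        exact ⟨t₁, t₂, e1, hL ▸ e2, (hmem t₁ e1 (by linarith)).trans e3,
          (hmem t₂ (by linarith) e2).trans e4, e5, hL ▸ e6⟩
      refine ⟨fun _ => hL, fun hK' => absurd hK' hK, ?_, hvisit, fun x τ _ => ?_⟩
      · have := htour.periodicExtension 1 one_pos
        rw [Nat.cast_one, one_mul] at this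
        rwa [hL] at this ⊢
      · obtain ⟨t₁, t₂, -, -, e3, e4, e5, e6⟩ := hvisit x
        have hpos : 0 < L₀ + ∑ j, ℓ j := by rw [hL]; linarith
        have := two_mul_div_le_interceptionProb (τ := τ) hpos hα.le e3 e4 e5 (by rw [hL]; exact e6)
        refine le_trans (le_of_eq ?_) this
        rw [hL, mul_div_mul_left _ _ two_ne_zero]
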